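/- Let $-2<a<2$. The McMillan sextupole map is $(q,p)\mapsto\bigl(p,\,-q+f(p)\bigr)$ with $f(p)=-\dfrac{p(p-a)}{p+1}$; it preserves $$\mathcal K(p,q)=p^2q+pq^2+p^2-a\,pq+q^2 .$$ A closed invariant curve at level $K$ is a non-constant periodic orbit (of minimal period $T>0$) on $\{\mathcal K=K\}$ of Hamilton's equations $\dot q=\partial\mathcal K/\partial p$, $\dot p=-\partial\mathcal K/\partial q$; its canonical action is $J=\frac1{2\pi}\oint p\,dq=\frac{1}{2\pi}\int_0^T p\,\dot q\,dt$. Write $\mathrm K[\kappa],\mathrm E[\kappa],\Pi[n,\kappa]$ for the complete elliptic integrals of modulus $\kappa$, e.g. $\Pi[n,\kappa]=\int_0^{\pi/2}\frac{d\theta}{(1-n\sin^2\theta)\sqrt{1-\kappa^2\sin^2\theta}}$. Closed invariant curves at level $K$ exist if and only if $0<K<\min\{(2-a)^3/27,\,(2+a)^2\}$. For such $K$ all of them have the same action $J=J(K)$, and the following hold. (1) The polynomial $\mathcal P(q)=q^4-2(2+a)q^3+(a^2-4)q^2+4Kq+4K$ has four distinct real roots $q_1<q_2<q_3<q_4$,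 and, with $\kappa=\sqrt{\frac{(q_3-q_2)(q_4-q_1)}{(q_3-q_1)(q_4-q_2)}}$, $$J=\frac1{2\pi}\int_{q_2}^{q_3}\frac{\sqrt{\mathcal P(q)}}{q+1}\,dq=\frac{q_2-q_1}{\pi}\sqrt{\frac{q_3-q_1}{q_4-q_2}}\Bigl\{\tfrac{a+4+q_4-q_1}{4}\mathrm K[\kappa]+\tfrac{a+4}{4}\tfrac{q_4-q_2}{q_2-q_1}\mathrm E[\kappa]-\tfrac{a+1}{q_3-q_1}\Pi\bigl[\tfrac{q_4-q_2}{q_4-q_1}\kappa^2,\kappa\bigr]-\tfrac{(1+q_3)(1+q_4)}{q_3-q_1}\Pi\bigl[\tfrac{1+q_1}{1+q_2}\tfrac{q_4-q_2}{q_4-q_1}\kappa^2,\kappa\bigr]\Bigr\}.$$ (2) Let $Q=(q+p)/\sqrt2$, $P=(p-q)/\sqrt2$, $\mathcal G(Q)=\sqrt2K-\frac{2-a}{\sqrt2}Q^2-Q^3$, $Q_4=\frac{2+a}{\sqrt2}$ and, with $c=\frac{2-a}{3\sqrt2}$ and $w=1-\frac{54K}{(2-a)^3}$, $$Q_1=-c\bigl(1+2\cos(\tfrac13\arccos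 w)\bigr),\quad Q_2=-c\bigl(1-2\sin(\tfrac13\arcsin w)\bigr),\quad Q_3=-c\bigl(1-2\cos(\tfrac13\arccos(-w))\bigr).$$ Then $Q_1<Q_2<Q_3<Q_4$, $Q_1,Q_2,Q_3$ are the roots of $\mathcal G$, and, with $\kappa=\sqrt{\frac{(Q_3-Q_2)(Q_4-Q_1)}{(Q_3-Q_1)(Q_4-Q_2)}}$, $$J=\frac1{2\pi}\oint P\,dQ=\frac1\pi\int_{Q_2}^{Q_3}\sqrt{\frac{\mathcal G(Q)}{Q_4-Q}}\,dQ=\frac2\pi\frac{1}{\sqrt{(Q_4-Q_2)(Q_3-Q_1)}}\Bigl\{(1+a)(Q_4-Q_3)\,\Pi\bigl[\tfrac{Q_3-Q_2}{Q_4-Q_2},\kappa\bigr]+\tfrac{(2+a)^2-K}{4}\Bigl[\bigl(\tfrac{4+a}{Q_4-Q_1}-3\sqrt2\bigr)\mathrm K[\kappa]+\tfrac{(4+a)(Q_3-Q_1)}{(Q_4-Q_1)(Q_4-Q_3)}\mathrm E[\kappa]\Bigr]\Bigr\}.$$ (3) As $K\to0^+$ one has $\kappa\to0^+$ (with $\kappa$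 as in (2)) and $$J=\tfrac{(2-a)(4-a^2)^{3/2}}{2^8}\Bigl[\kappa^4+\kappa^6+\tfrac{97-27a-15a^2-a^3}{2^7}\kappa^8+\tfrac{33-27a-15a^2-a^3}{2^6}\kappa^{10}+O(\kappa^{12})\Bigr],$$ $$J=\tfrac1{\sqrt{4-a^2}}\Bigl[K-3\tfrac{2+2a+a^2}{(a-2)(a^2-4)^2}K^2+10\tfrac{22+48a+42a^2+16a^3+3a^4}{(a-2)^2(a^2-4)^4}K^3+O(K^4)\Bigr].$$ (4) On every closed invariant curve the map acts as a time shift: there is $T'\in(0,T)$ such that the map sends $(q(t),p(t))$ to $(q(t+T'),p(t+T'))$ for all $t$. The rotation number $T'/T$ is a function $\nu(J)$ of the action alone; setting $\nu(0)=\nu_0=\frac1{2\pi}\arccos\frac a2$, as $J\to0^+$, $$\nu(J)=\nu_0-\tfrac1{2\pi}\tfrac{1+a}{(2-a)(4-a^2)}\Bigl[(8+a)J+\tfrac{736+626a+198a^2+7a^3-a^4}{2(2-a)(4-a^2)^{3/2}}J^2+O(J^3)\Bigr],$$ and the detuning at the origin is the one-sided derivative $$\frac{d\nu}{dJ}\Big|_{J=0}=-\frac1{2\pi}\frac{(1+a)(8+a)}{(2+a)(2-a)^2}.$$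 -/

import Mathlib

open Filter Topology Asymptotics

noncomputable section

/-! ### The McMillan sextupole map and its invariant -/

/-- The McMillan sextupole map `(q, p) ↦ (p, -q + f p)` with force
`f p = - p (p - a) / (p + 1)`. -/
def sextMap (a : ℝ) (z : ℝ × ℝ) : ℝ × ℝ :=
  (z.2, -z.1 - z.2 * (z.2 - a) / (z.2 + 1))

/-- The invariant of the map. -/
def sextInv (a q p : ℝ) : ℝ :=
  p ^ 2 * q + p * q ^ 2 + p ^ 2 - a * p * q + q ^ 2

/-- A closed invariant curve of the map, at the value `E` of the invariant, traversed once: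
`t ↦ (q t, p t)` is an orbit of Hamilton's equations `q' = ∂H/∂p`, `p' = -∂H/∂q` with
Hamiltonian `H = sextInv a`, lying on the level set `H = E`, and periodic with minimal period
`T > 0` (in particular it is not an equilibrium). -/
structure IsSextClosedCurve (a E : ℝ) (q p : ℝ → ℝ) (T : ℝ) : Prop where
  period_pos : 0 < T
  hasDerivAt_q : ∀ t, HasDerivAt q (deriv (fun y => sextInv a (q t) y) (p t)) t
  hasDerivAt_p : ∀ t, HasDerivAt p (-deriv (fun x => sextInv a x (p t)) (q t)) t
  level : ∀ t, sextInv a (q t) (p t) = E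
  periodic : ∀ t, q (t + T) = q t ∧ p (t + T) = p t
  minimal : ∀ s, 0 < s → s < T → (q s, p s) ≠ (q 0, p 0)

/-- The canonical action `(1/2π) ∮ p dq` of a closed curve parametrized over one period `T`. -/
def canonicalAction (q p : ℝ → ℝ) (T : ℝ) : ℝ :=
  1 / (2 * Real.pi) * ∫ t in (0 : ℝ)..T, p t * deriv q t

/-- The smallest value of the invariant at its critical points `(a-2)/3 · (1,1)` (value
`(2-a)³/27`) and the 2-cycle (value `(2+a)²`); this is the level of the separatrix. -/
def sextSep (a : ℝ) : ℝ := min ((2 - a) ^ 3 / 27) ((2 + a) ^ 2)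

/-! ### Complete elliptic integrals, as functions of the elliptic modulus `k` -/

def ellipticK (k : ℝ) : ℝ :=
  ∫ θ in (0 : ℝ)..(Real.pi / 2), 1 / Real.sqrt (1 - k ^ 2 * Real.sin θ ^ 2)

def ellipticE (k : ℝ) : ℝ :=
  ∫ θ in (0 : ℝ)..(Real.pi / 2), Real.sqrt (1 - k ^ 2 * Real.sin θ ^ 2)

def ellipticPi (n k : ℝ) : ℝ :=
  ∫ θ in (0 : ℝ)..(Real.pi / 2),
    1 / ((1 - n * Real.sin θ ^ 2) * Real.sqrt (1 - k ^ 2 * Real.sin θ ^ 2))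

/-- The elliptic modulus attached to four roots. -/
def rootModulus (x₁ x₂ x₃ x₄ : ℝ) : ℝ :=
  Real.sqrt ((x₃ - x₂) * (x₄ - x₁) / ((x₃ - x₁) * (x₄ - x₂)))

/-! ### The original coordinates -/

/-- The characteristic polynomial `𝒫`. -/
def sextP (a E q : ℝ) : ℝ :=
  q ^ 4 - 2 * (2 + a) * q ^ 3 + (a ^ 2 - 4) * q ^ 2 + 4 * E * q + 4 * E

/-- The closed form of the action in terms of the roots of `𝒫`. -/
def sextActionRoots (a q₁ q₂ q₃ q₄ : ℝ) : ℝ :=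
  let k := rootModulus q₁ q₂ q₃ q₄
  (q₂ - q₁) / Real.pi * Real.sqrt ((q₃ - q₁) / (q₄ - q₂)) *
    ((a + 4 + q₄ - q₁) / 4 * ellipticK k
      + (a + 4) / 4 * ((q₄ - q₂) / (q₂ - q₁)) * ellipticE k
      - (a + 1) / (q₃ - q₁) * ellipticPi ((q₄ - q₂) / (q₄ - q₁) * k ^ 2) k
      - (1 + q₃) * (1 + q₄) / (q₃ - q₁) *
          ellipticPi ((1 + q₁) / (1 + q₂) * ((q₄ - q₂) / (q₄ - q₁)) * k ^ 2) k)

/-! ### The coordinates rotated by `π/4`: `Q = (q + p)/√2`, `P = (p - q)/√2` -/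

def rotQ (q p : ℝ → ℝ) (t : ℝ) : ℝ := (q t + p t) / Real.sqrt 2

def rotP (q p : ℝ → ℝ) (t : ℝ) : ℝ := (p t - q t) / Real.sqrt 2

/-- The cubic polynomial `𝒢`. -/
def sextG (a E Q : ℝ) : ℝ :=
  Real.sqrt 2 * E - (2 - a) / Real.sqrt 2 * Q ^ 2 - Q ^ 3

def sextQ₁ (a E : ℝ) : ℝ :=
  -((2 - a) / (3 * Real.sqrt 2)) *
    (1 + 2 * Real.cos (1 / 3 * Real.arccos (1 - 54 * E / (2 - a) ^ 3)))

def sextQ₂ (a E : ℝ) : ℝ :=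
  -((2 - a) / (3 * Real.sqrt 2)) *
    (1 - 2 * Real.sin (1 / 3 * Real.arcsin (1 - 54 * E / (2 - a) ^ 3)))

def sextQ₃ (a E : ℝ) : ℝ :=
  -((2 - a) / (3 * Real.sqrt 2)) *
    (1 - 2 * Real.cos (1 / 3 * Real.arccos (54 * E / (2 - a) ^ 3 - 1)))

def sextQ₄ (a : ℝ) : ℝ := (2 + a) / Real.sqrt 2

/-- The elliptic modulus of the curve at the level `E`, in terms of the rotated roots. -/
def sextModulus (a E : ℝ) : ℝ :=
  rootModulus (sextQ₁ a E) (sextQ₂ a E) (sextQ₃ a E) (sextQ₄ a)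

/-- The closed form of the action in terms of the rotated roots. -/
def sextActionRotated (a E : ℝ) : ℝ :=
  let Q₁ := sextQ₁ a E
  let Q₂ := sextQ₂ a E
  let Q₃ := sextQ₃ a E
  let Q₄ := sextQ₄ a
  let k := sextModulus a E
  2 / Real.pi * (1 / Real.sqrt ((Q₄ - Q₂) * (Q₃ - Q₁))) *
    ((1 + a) * (Q₄ - Q₃) * ellipticPi ((Q₃ - Q₂) / (Q₄ - Q₂)) k
      + ((2 + a) ^ 2 - E) / 4 *
        (((4 + a) / (Q₄ - Q₁) - 3 * Real.sqrt 2) * ellipticK k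
          + (4 + a) * (Q₃ - Q₁) / ((Q₄ - Q₁) * (Q₄ - Q₃)) * ellipticE k))

/-! ### The truncated power series -/

/-- The series of the action in the elliptic modulus. -/
def sextActionSeriesModulus (a k : ℝ) : ℝ :=
  (2 - a) * (4 - a ^ 2) ^ (3 / 2 : ℝ) / 2 ^ 8 *
    (k ^ 4 + k ^ 6
      + (97 - 27 * a - 15 * a ^ 2 - a ^ 3) / 2 ^ 7 * k ^ 8
      + (33 - 27 * a - 15 * a ^ 2 - a ^ 3) / 2 ^ 6 * k ^ 10)

/-- The series of the action in the value of the invariant. -/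
def sextActionSeriesInv (a E : ℝ) : ℝ :=
  1 / Real.sqrt (4 - a ^ 2) *
    (E - 3 * ((2 + 2 * a + a ^ 2) / ((a - 2) * (a ^ 2 - 4) ^ 2)) * E ^ 2
      + 10 * ((22 + 48 * a + 42 * a ^ 2 + 16 * a ^ 3 + 3 * a ^ 4)
          / ((a - 2) ^ 2 * (a ^ 2 - 4) ^ 4)) * E ^ 3)

/-- The rotation number at the origin. -/
def sextNu₀ (a : ℝ) : ℝ := 1 / (2 * Real.pi) * Real.arccos (a / 2)

/-- The series of the rotation number in the action. -/
def sextNuSeries (a J : ℝ) : ℝ :=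
  sextNu₀ a - 1 / (2 * Real.pi) * ((1 + a) / ((2 - a) * (4 - a ^ 2))) *
    ((8 + a) * J
      + (736 + 626 * a + 198 * a ^ 2 + 7 * a ^ 3 - a ^ 4)
          / (2 * (2 - a) * (4 - a ^ 2) ^ (3 / 2 : ℝ)) * J ^ 2)

end

/-! In the variables s = q + p and d = p − q the level set is d²(2 + a − s) = 4E − (2 − a)s² − s³,
and the flow satisfies s' = d(2 + a − s). The line s = 2 + a is invariant. On a periodic orbit the
extrema of s are therefore points with d = 0, that is, roots of the cubic. The cubic has no linear
term, and excluding equilibria forces the orbit to oscillate between the two larger of three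
distinct roots s₁ < s₂ < s₃ < 2 + a (`IsSextClosedCurve.exists_roots`). Such roots exist exactly in
the stated range of E (`sextRoots`, `SextRoots.level_lt`).

Conversely, s = (s₂ + s₃)/2 − (s₃ − s₂)/2 · cos x gives a model curve on which the angle moves with
velocity ω = √((s − s₁)(2 + a − s)) (`isSextAngleCurve`, `exists_angle`). Every closed curve of the
level passes through (s₃/2, s₃/2), so by uniqueness for the differential equation it is a time shift
of the model curve. The map sends orbits to orbits, so on each curve it is a time shift too; the
shift is read off from the image of that one point (`SextRoots.closedCurve_spec`). Action, period
and step time thus become integrals over x.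

The closed forms come from one Legendre reduction (`integral_legendre`), applied to the integral in
the rotated coordinates and to the integral in q. The latter belongs to a second parametrization of
a closed curve of the same level, so it has the same value.

For the series, the roots are written as rational functions of a parameter t (`paramS₁`, `paramS₂`,
`paramS₃`). Then 1/ω is, up to a factor independent of x, (1 + u t cos x + v t² cos² x)^(−1/2) with
bounded u and v. It is expanded uniformly and integrated as a polynomial in cos x. The results are
expansions of the action, of the rotation number and of κ² in t. Each claimed series is verified by
substituting these expansions into it, so no series is ever inverted. The action increases strictly
with E (`SextRoots.angleAction_lt`), so the rotation number is a function of the action, and the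
intermediate value theorem carries the estimates from t to J. -/

noncomputable section

/-! ### Hamiltonian orbits, uniqueness, and quantities that depend only on the curve. -/

/-- `q` and `p` solve Hamilton's equations of the Hamiltonian `sextInv a`, written out. -/
def IsSextOrbit (a : ℝ) (q p : ℝ → ℝ) : Prop :=
  ∀ t, HasDerivAt q (2 * q t * p t + q t ^ 2 + 2 * p t - a * q t) t ∧
    HasDerivAt p (-(p t ^ 2 + 2 * q t * p t - a * p t + 2 * q t)) t

theorem deriv_sextInv_right (a q p : ℝ) :
    deriv (fun y => sextInv a q y) p = 2 * q * p + q ^ 2 + 2 * p - a * q := by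
  have h : HasDerivAt (fun y => sextInv a q y) (2 * q * p + q ^ 2 + 2 * p - a * q) p := by
    have := (((((hasDerivAt_id p).pow 2).mul_const q).add ((hasDerivAt_id p).mul_const (q ^ 2))).add
      ((hasDerivAt_id p).pow 2)).sub ((hasDerivAt_id p).const_mul a |>.mul_const q) |>.add_const (q
      ^ 2)
    refine HasDerivAt.congr_deriv this ?_
    simp only [id, Nat.add_one_sub_one, pow_one]
    push_cast
    ring
  exact h.deriv

theorem deriv_sextInv_left (a q p : ℝ) :
    deriv (fun x => sextInv a x p) q = p ^ 2 + 2 * q * p - a * p + 2 * q := by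
  have h : HasDerivAt (fun x => sextInv a x p) (p ^ 2 + 2 * q * p - a * p + 2 * q) q := by
    have := ((((hasDerivAt_id q).const_mul (p ^ 2)).add (((hasDerivAt_id q).pow 2).const_mul
        p)).add_const
      (p ^ 2)).sub ((hasDerivAt_id q).const_mul (a * p)) |>.add ((hasDerivAt_id q).pow 2)
    refine HasDerivAt.congr_deriv this ?_
    simp only [id, Nat.add_one_sub_one, pow_one]
    push_cast
    ring
  exact h.deriv

theorem isSextClosedCurve_iff {a E T : ℝ} {q p : ℝ → ℝ} :
    IsSextClosedCurve a E q p T ↔ 0 < T ∧ IsSextOrbit a q p ∧ (∀ t, sextInv a (q t) (p t) = E) ∧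
      (∀ t, q (t + T) = q t ∧ p (t + T) = p t) ∧
      ∀ s, 0 < s → s < T → (q s, p s) ≠ (q 0, p 0) := by
  constructor
  · intro h
    refine ⟨h.period_pos, fun t => ⟨?_, ?_⟩, h.level, h.periodic, h.minimal⟩
    · rw [← deriv_sextInv_right]; exact h.hasDerivAt_q t
    · rw [← deriv_sextInv_left]; exact h.hasDerivAt_p t
  · rintro ⟨h1, h2, h3, h4, h5⟩
    refine ⟨h1, fun t => ?_, fun t => ?_, h3, h4, h5⟩
    · rw [deriv_sextInv_right]; exact (h2 t).1
    · rw [deriv_sextInv_left]; exact (h2 t).2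

theorem IsSextClosedCurve.orbit {a E T : ℝ} {q p : ℝ → ℝ} (h : IsSextClosedCurve a E q p T) :
    IsSextOrbit a q p := (isSextClosedCurve_iff.1 h).2.1

namespace IsSextOrbit

variable {a : ℝ} {q p : ℝ → ℝ}

theorem continuous_left (h : IsSextOrbit a q p) : Continuous q :=
  continuous_iff_continuousAt.2 fun t => (h t).1.continuousAt

theorem continuous_right (h : IsSextOrbit a q p) : Continuous p :=
  continuous_iff_continuousAt.2 fun t => (h t).2.continuousAt

theorem comp_add (h : IsSextOrbit a q p) (c : ℝ) :
    IsSextOrbit a (fun t => q (t + c)) (fun t => p (t + c)) :=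
  fun t => ⟨(h (t + c)).1.comp_add_const t c, (h (t + c)).2.comp_add_const t c⟩

/-- The vector field is polynomial, hence Lipschitz on every ball; boundedness supplies one ball
that contains both orbits for all time. -/
theorem eq_of_bounded (h : IsSextOrbit a q p) {q' p' : ℝ → ℝ} (h' : IsSextOrbit a q' p')
    (hb : Bornology.IsBounded (Set.range fun t => (q t, p t)))
    (hb' : Bornology.IsBounded (Set.range fun t => (q' t, p' t))) {t₀ : ℝ}
    (h0 : (q t₀, p t₀) = (q' t₀, p' t₀)) (t : ℝ) : (q t, p t) = (q' t, p' t) := by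
  obtain ⟨R, hR⟩ := (hb.union hb').subset_closedBall (0 : ℝ × ℝ)
  let v : ℝ × ℝ → ℝ × ℝ := fun z => (2 * z.1 * z.2 + z.1 ^ 2 + 2 * z.2 - a * z.1,
    -(z.2 ^ 2 + 2 * z.1 * z.2 - a * z.2 + 2 * z.1))
  have hv : ContDiff ℝ 1 v := by fun_prop
  obtain ⟨K, hK⟩ := hv.contDiffOn.exists_lipschitzOnWith one_ne_zero
    (convex_closedBall (0 : ℝ × ℝ) R) (isCompact_closedBall _ _)
  have := ODE_solution_unique_univ (v := fun _ => v) (s := fun _ => Metric.closedBall 0 R)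
    (f := fun t => (q t, p t)) (g := fun t => (q' t, p' t)) (t₀ := t₀) (fun _ => hK)
    (fun t => ⟨(h t).1.prodMk (h t).2, hR (Or.inl ⟨t, rfl⟩)⟩)
    (fun t => ⟨(h' t).1.prodMk (h' t).2, hR (Or.inr ⟨t, rfl⟩)⟩) h0
  exact congrFun this t

end IsSextOrbit

namespace IsSextClosedCurve

variable {a E T : ℝ} {q p : ℝ → ℝ}

theorem isBounded (h : IsSextClosedCurve a E q p T) :
    Bornology.IsBounded (Set.range fun t => (q t, p t)) := by
  refine Function.Periodic.isBounded_of_continuous (c := T) (fun t => ?_) h.period_pos.ne'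
    (h.orbit.continuous_left.prodMk h.orbit.continuous_right)
  simp [h.periodic t]

/-- Two closed curves with a common point are the same curve up to a shift of time. -/
theorem shift_eq (h : IsSextClosedCurve a E q p T) {E' T' : ℝ} {q' p' : ℝ → ℝ}
    (h' : IsSextClosedCurve a E' q' p' T') {t₁ t₂ : ℝ} (h0 : (q t₁, p t₁) = (q' t₂, p' t₂)) (t : ℝ)
        :
    q t = q' (t + (t₂ - t₁)) ∧ p t = p' (t + (t₂ - t₁)) := by
  have := h.orbit.eq_of_bounded (h'.orbit.comp_add (t₂ - t₁)) h.isBounded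
    (h'.isBounded.subset (by rintro _ ⟨t, rfl⟩; exact ⟨_, rfl⟩)) (t₀ := t₁)
    (by simpa using h0) t
  simpa using this

/-- By uniqueness an orbit through an equilibrium is constant, and then T / 2 already violates the
minimality of the period. -/
theorem not_equilibrium (h : IsSextClosedCurve a E q p T) (t : ℝ)
    (h1 : 2 * q t * p t + q t ^ 2 + 2 * p t - a * q t = 0)
    (h2 : p t ^ 2 + 2 * q t * p t - a * p t + 2 * q t = 0) : False := by
  have ho : IsSextOrbit a (fun _ => q t) (fun _ => p t) := fun s => by
    simp only [h1, h2, neg_zero]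
    exact ⟨hasDerivAt_const _ _, hasDerivAt_const _ _⟩
  have key := h.orbit.eq_of_bounded ho h.isBounded (by simp) (t₀ := t) rfl
  exact h.minimal (T / 2) (by linarith [h.period_pos]) (by linarith [h.period_pos])
    ((key _).trans (key 0).symm)

/-- Two closed curves with a common point have the same period. -/
theorem period_le (h : IsSextClosedCurve a E q p T) {E' T' : ℝ} {q' p' : ℝ → ℝ}
    (h' : IsSextClosedCurve a E' q' p' T') {t₁ t₂ : ℝ} (h0 : (q t₁, p t₁) = (q' t₂, p' t₂)) :
    T ≤ T' := by
  by_contra! hlt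
  have e := h.shift_eq h' h0
  refine h.minimal T' h'.period_pos hlt ?_
  rw [(e T').1, (e T').2, (e 0).1, (e 0).2]
  have := h'.periodic (0 + (t₂ - t₁))
  rw [show T' + (t₂ - t₁) = 0 + (t₂ - t₁) + T' by ring, this.1, this.2]

theorem period_eq (h : IsSextClosedCurve a E q p T) {E' T' : ℝ} {q' p' : ℝ → ℝ}
    (h' : IsSextClosedCurve a E' q' p' T') {t₁ t₂ : ℝ} (h0 : (q t₁, p t₁) = (q' t₂, p' t₂)) :
    T = T' :=
  (h.period_le h' h0).antisymm (h'.period_le h h0.symm)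

/-- The curves are time shifts of each other, and the integral of a periodic function over one
period does not depend on where the period starts. -/
theorem canonicalAction_eq (h : IsSextClosedCurve a E q p T) {E' T' : ℝ} {q' p' : ℝ → ℝ}
    (h' : IsSextClosedCurve a E' q' p' T') {t₁ t₂ : ℝ} (h0 : (q t₁, p t₁) = (q' t₂, p' t₂)) :
    canonicalAction q p T = canonicalAction q' p' T' := by
  have hT := h.period_eq h' h0
  subst hT
  have e := h.shift_eq h' h0
  unfold canonicalAction
  congr 1
  have hper : Function.Periodic (fun t => p' t * deriv q' t) T := fun t => by
    have hq : (fun t => q' (t + T)) = q' := funext fun t => (h'.periodic t).1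
    have := deriv_comp_add_const q' T t
    rw [hq] at this
    simp only [(h'.periodic t).2, this]
  have hq : q = fun t => q' (t + (t₂ - t₁)) := funext fun t => (e t).1
  calc ∫ t in (0:ℝ)..T, p t * deriv q t
      = ∫ t in (0:ℝ)..T, (fun t => p' t * deriv q' t) (t + (t₂ - t₁)) := by
        refine intervalIntegral.integral_congr fun t _ => ?_
        simp only [(e t).2]
        congr 1
        rw [hq, deriv_comp_add_const]
    _ = ∫ t in (0 + (t₂ - t₁))..(T + (t₂ - t₁)), p' t * deriv q' t := by
        rw [intervalIntegral.integral_comp_add_right (fun t => p' t * deriv q' t)]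
    _ = ∫ t in (0:ℝ)..T, p' t * deriv q' t := by
        have := hper.intervalIntegral_add_eq (0 + (t₂ - t₁)) 0
        rw [zero_add] at this ⊢
        rw [add_comm T]
        simpa using this

/-- The action in the coordinates rotated by `π / 4`. -/
theorem canonicalAction_rot (h : IsSextClosedCurve a E q p T) :
    canonicalAction (rotQ q p) (rotP q p) T = canonicalAction q p T := by
  unfold canonicalAction
  congr 1
  have h2 : (Real.sqrt 2) ^ 2 = 2 := Real.sq_sqrt (by norm_num)
  have h2' : Real.sqrt 2 ≠ 0 := by positivity
  have hq := fun t => (h.orbit t).1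
  have hp := fun t => (h.orbit t).2
  have cq := h.orbit.continuous_left
  have cp := h.orbit.continuous_right
  have e1 : ∀ t, deriv q t = 2 * q t * p t + q t ^ 2 + 2 * p t - a * q t := fun t => (hq t).deriv
  have e2 : ∀ t, deriv (rotQ q p) t = ((2 * q t * p t + q t ^ 2 + 2 * p t - a * q t) +
      -(p t ^ 2 + 2 * q t * p t - a * p t + 2 * q t)) / Real.sqrt 2 := fun t =>
    (((hq t).add (hp t)).div_const _).deriv
  -- P dQ − p dq is the differential of (p² − q²)/4 − pq/2, which returns to its initial value after
  -- one period.
  have e3 : ∀ t, HasDerivAt (fun t => (p t ^ 2 - q t ^ 2) / 4 - p t * q t / 2)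
      (rotP q p t * deriv (rotQ q p) t - p t * deriv q t) t := fun t => by
    have := ((((hp t).pow 2).sub ((hq t).pow 2)).div_const 4).sub
      (((hp t).mul (hq t)).div_const 2)
    refine HasDerivAt.congr_deriv this ?_
    rw [e1, e2, rotP]
    field_simp
    rw [h2]
    push_cast
    ring
  have c1 : Continuous fun t => rotP q p t * deriv (rotQ q p) t := by
    simp only [e2, rotP]; fun_prop
  have c2 : Continuous fun t => p t * deriv q t := by simp only [e1]; fun_prop
  have := intervalIntegral.integral_eq_sub_of_hasDerivAt (a := 0) (b := T) (fun t _ => e3 t)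
    ((c1.sub c2).intervalIntegrable _ _)
  rw [intervalIntegral.integral_sub (c1.intervalIntegrable _ _) (c2.intervalIntegrable _ _)] at this
  have hper := h.periodic 0
  rw [zero_add] at hper
  rw [hper.1, hper.2, sub_self] at this
  linarith

end IsSextClosedCurve

/-! ### Orbits from a parametrization by an angle -/

/-- Separation of variables: the elapsed time τ(y) = ∫₀^y 1/ω is strictly increasing and, its
integrand being periodic with positive mean, maps onto ℝ. The solution φ of φ' = ω(φ) is its
inverse. -/
theorem exists_angle {ω : ℝ → ℝ} (hc : Continuous ω) (hpos : ∀ x, 0 < ω x)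
    (hper : ∀ x, ω (x + 2 * Real.pi) = ω x) :
    ∃ φ : ℝ → ℝ, StrictMono φ ∧ (∀ t, HasDerivAt φ (ω (φ t)) t) ∧
      (∀ t, ∫ x in (0:ℝ)..φ t, 1 / ω x = t) ∧ ∀ y, φ (∫ x in (0:ℝ)..y, 1 / ω x) = y := by
  have hci : Continuous fun x => 1 / ω x := continuous_const.div hc fun x => (hpos x).ne'
  have hii : ∀ u v, IntervalIntegrable (fun x => 1 / ω x) MeasureTheory.volume u v :=
    fun u v => hci.intervalIntegrable u v
  have hipos : ∀ x, 0 < 1 / ω x := fun x => one_div_pos.2 (hpos x)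
  set τ : ℝ → ℝ := fun y => ∫ x in (0:ℝ)..y, 1 / ω x with hτ
  have hder : ∀ y, HasDerivAt τ (1 / ω y) y := fun y => hci.integral_hasStrictDerivAt 0 y
      |>.hasDerivAt
  have hmono : StrictMono τ := strictMono_of_deriv_pos fun y => by
    rw [(hder y).deriv]
    exact hipos y
  have hcont : Continuous τ := continuous_iff_continuousAt.2 fun y => (hder y).continuousAt
  have hperi : Function.Periodic (fun x => 1 / ω x) (2 * Real.pi) := fun x => by simp only [hper]
  have hT : 0 < ∫ x in (0:ℝ)..2 * Real.pi, 1 / ω x :=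
    intervalIntegral.intervalIntegral_pos_of_pos (hii _ _) hipos (by positivity)
  have htop : Tendsto τ atTop atTop :=
    hperi.tendsto_atTop_intervalIntegral_of_pos hT (by positivity)
  have hbot : Tendsto τ atBot atBot :=
    hperi.tendsto_atBot_intervalIntegral_of_pos hT (by positivity)
  have hsurj : Function.Surjective τ := hcont.surjective htop hbot
  let e := hmono.orderIsoOfSurjective τ hsurj
  have he : ∀ t, τ (e.symm t) = t := fun t => e.apply_symm_apply t
  refine ⟨e.symm, e.symm.strictMono, fun t => ?_, he, fun y => e.symm_apply_apply y⟩
  have := (hder (e.symm t)).of_local_left_inverse (f := τ) (g := e.symm)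
      e.symm.continuous.continuousAt
    (hipos _).ne' (Eventually.of_forall he)
  simpa using this

/-- A closed curve parametrized by an angle `x`, which the flow turns with angular velocity `ω x`.
      -/
structure IsSextAngleCurve (a E : ℝ) (ω q p : ℝ → ℝ) : Prop where
  continuous : Continuous ω
  pos : ∀ x, 0 < ω x
  periodic : ∀ x, ω (x + 2 * Real.pi) = ω x
  hasDerivAt_q : ∀ x, HasDerivAt q ((2 * q x * p x + q x ^ 2 + 2 * p x - a * q x) / ω x) x
  hasDerivAt_p : ∀ x, HasDerivAt p (-(p x ^ 2 + 2 * q x * p x - a * p x + 2 * q x) / ω x) x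
  level : ∀ x, sextInv a (q x) (p x) = E
  periodic_q : ∀ x, q (x + 2 * Real.pi) = q x
  periodic_p : ∀ x, p (x + 2 * Real.pi) = p x
  injective : ∀ x, 0 < x → x < 2 * Real.pi → (q x, p x) ≠ (q 0, p 0)

namespace IsSextAngleCurve

variable {a E : ℝ} {ω q p : ℝ → ℝ}

theorem continuous_inv (h : IsSextAngleCurve a E ω q p) : Continuous fun x => 1 / ω x :=
  continuous_const.div h.continuous fun x => (h.pos x).ne'

/-- The orbit along the curve; the time of a point is the integral of `1 / ω` up to its angle. -/
theorem exists_closedCurve (h : IsSextAngleCurve a E ω q p) :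
    ∃ φ : ℝ → ℝ, (∀ t, ∫ x in (0:ℝ)..φ t, 1 / ω x = t) ∧
      (∀ y, φ (∫ x in (0:ℝ)..y, 1 / ω x) = y) ∧
      IsSextClosedCurve a E (fun t => q (φ t)) (fun t => p (φ t))
        (∫ x in (0:ℝ)..2 * Real.pi, 1 / ω x) ∧
      canonicalAction (fun t => q (φ t)) (fun t => p (φ t)) (∫ x in (0:ℝ)..2 * Real.pi, 1 / ω x) =
        1 / (2 * Real.pi) * ∫ x in (0:ℝ)..2 * Real.pi,
          p x * ((2 * q x * p x + q x ^ 2 + 2 * p x - a * q x) / ω x) := by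
  obtain ⟨φ, hφ, hd, h1, h2⟩ := exists_angle h.continuous h.pos h.periodic
  have hii : ∀ u v, IntervalIntegrable (fun x => 1 / ω x) MeasureTheory.volume u v :=
    fun u v => h.continuous_inv.intervalIntegrable u v
  have hipos : ∀ x, 0 < 1 / ω x := fun x => one_div_pos.2 (h.pos x)
  set T := ∫ x in (0:ℝ)..2 * Real.pi, 1 / ω x with hT
  have hφ0 : φ 0 = 0 := by simpa using h2 0
  have hφT : φ T = 2 * Real.pi := h2 _
  have hshift : ∀ t, φ (t + T) = φ t + 2 * Real.pi := fun t => by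
    have hperi : Function.Periodic (fun x => 1 / ω x) (2 * Real.pi) := fun x => by
      simp only [h.periodic]
    rw [← h2 (φ t + 2 * Real.pi)]
    congr 1
    rw [← intervalIntegral.integral_add_adjacent_intervals (hii 0 (φ t)) (hii _ _), h1,
      hperi.intervalIntegral_add_eq (φ t) 0, zero_add]
  have cq : Continuous q := continuous_iff_continuousAt.2 fun x => (h.hasDerivAt_q x).continuousAt
  have cp : Continuous p := continuous_iff_continuousAt.2 fun x => (h.hasDerivAt_p x).continuousAt
  have dq : ∀ t, HasDerivAt (fun t => q (φ t))
      (2 * q (φ t) * p (φ t) + q (φ t) ^ 2 + 2 * p (φ t) - a * q (φ t)) t := fun t => by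
    have := (h.hasDerivAt_q (φ t)).comp t (hd t)
    rwa [div_mul_cancel₀ _ (h.pos _).ne'] at this
  have dp : ∀ t, HasDerivAt (fun t => p (φ t))
      (-(p (φ t) ^ 2 + 2 * q (φ t) * p (φ t) - a * p (φ t) + 2 * q (φ t))) t := fun t => by
    have := (h.hasDerivAt_p (φ t)).comp t (hd t)
    rwa [div_mul_cancel₀ _ (h.pos _).ne'] at this
  refine ⟨φ, h1, h2, isSextClosedCurve_iff.2 ⟨?_, fun t => ⟨dq t, dp t⟩, fun t => h.level _,
    fun t => ?_, fun s hs hsT => ?_⟩, ?_⟩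
  · exact intervalIntegral.intervalIntegral_pos_of_pos (hii _ _) hipos (by positivity)
  · simp only [hshift, h.periodic_q, h.periodic_p, and_self]
  · simp only [hφ0]
    exact h.injective _ (by simpa [hφ0] using hφ hs) (by simpa [hφT] using hφ hsT)
  · unfold canonicalAction
    congr 1
    have := intervalIntegral.integral_comp_mul_deriv (a := 0) (b := T) (f := φ)
      (f' := fun t => ω (φ t))
      (g := fun x => p x * ((2 * q x * p x + q x ^ 2 + 2 * p x - a * q x) / ω x))
      (fun t _ => hd t)
      (h.continuous.comp (continuous_iff_continuousAt.2 fun t => (hd t).continuousAt)).continuousOn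
      (by
        refine cp.mul (Continuous.div (by fun_prop) h.continuous fun x => (h.pos x).ne'))
    rw [hφ0, hφT] at this
    rw [← this]
    refine intervalIntegral.integral_congr fun t _ => ?_
    simp only [(dq t).deriv, Function.comp]
    rw [mul_assoc (p (φ t)), div_mul_cancel₀ _ (h.pos _).ne']

end IsSextAngleCurve

/-! ### The cubic in s = q + p and its roots. -/

/-- `s₁ < s₂ < s₃` are the roots of `4 E - (2 - a) s² - s³`, the largest of them below `2 + a`.
This cubic is `𝒢` in the coordinate `s = q + p`. -/
structure SextRoots (a E s₁ s₂ s₃ : ℝ) : Prop where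
  lt₁₂ : s₁ < s₂
  lt₂₃ : s₂ < s₃
  lt₃₄ : s₃ < 2 + a
  sum : s₁ + s₂ + s₃ = a - 2
  pairs : s₁ * s₂ + s₁ * s₃ + s₂ * s₃ = 0
  prod : s₁ * s₂ * s₃ = 4 * E

namespace SextRoots

variable {a E s₁ s₂ s₃ : ℝ}

theorem cubic_eq (h : SextRoots a E s₁ s₂ s₃) (x : ℝ) :
    4 * E - (2 - a) * x ^ 2 - x ^ 3 = (x - s₁) * (x - s₂) * (s₃ - x) := by
  linear_combination -h.prod + x * h.pairs - x ^ 2 * h.sum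

/-- If s₂ ≥ 0, then s₃ > 0, and s₁ = a − 2 − s₂ − s₃ makes the sum of the pairwise products negative
instead of zero. -/
theorem neg₂ (h : SextRoots a E s₁ s₂ s₃) (ha : a < 2) : s₂ < 0 := by
  by_contra! h2
  have h3 : 0 < s₃ := h2.trans_lt h.lt₂₃
  have e : s₁ = a - 2 - s₂ - s₃ := by linarith [h.sum]
  have := h.pairs
  rw [e] at this
  nlinarith [mul_nonneg h2 h3.le, mul_pos h3 h3, mul_pos (sub_pos.2 ha) h3]

theorem pos₃ (h : SextRoots a E s₁ s₂ s₃) (ha : a < 2) : 0 < s₃ := by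
  by_contra! h3
  have h2 := h.neg₂ ha
  have h1 : s₁ < 0 := h.lt₁₂.trans h2
  nlinarith [mul_pos_of_neg_of_neg h1 h2, mul_nonneg_of_nonpos_of_nonpos h1.le h3,
    mul_nonneg_of_nonpos_of_nonpos h2.le h3, h.pairs]

theorem neg₁ (h : SextRoots a E s₁ s₂ s₃) (ha : a < 2) : s₁ < 0 := h.lt₁₂.trans (h.neg₂ ha)

theorem sum₂₃_neg (h : SextRoots a E s₁ s₂ s₃) (ha : a < 2) : s₂ + s₃ < 0 := by
  by_contra! hs
  nlinarith [h.pairs, mul_nonneg (neg_nonneg.2 (h.neg₁ ha).le) hs, h.neg₁ ha,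
    mul_neg_of_neg_of_pos (h.neg₂ ha) (h.pos₃ ha)]

/-- The middle root lies to the right of the local minimum of the cubic. -/
theorem critical_lt₂ (h : SextRoots a E s₁ s₂ s₃) (ha : a < 2) : 0 < 3 * s₂ + 2 * (2 - a) := by
  -- Both sides are the derivative of the cubic at `s₂`.
  have h1 : (s₂ - s₁) * (s₃ - s₂) = -s₂ * (3 * s₂ + 2 * (2 - a)) := by
    linear_combination (2 * s₂) * h.sum - h.pairs
  have h2 := mul_pos (sub_pos.2 h.lt₁₂) (sub_pos.2 h.lt₂₃)
  rw [h1] at h2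
  exact (pos_iff_pos_of_mul_pos h2).1 (neg_pos.2 (h.neg₂ ha))

theorem lt_critical₁ (h : SextRoots a E s₁ s₂ s₃) (ha : a < 2) : 3 * s₁ + 2 * (2 - a) < 0 := by
  have h1 : (s₂ - s₁) * (s₃ - s₁) = -s₁ * -(3 * s₁ + 2 * (2 - a)) := by
    linear_combination (-2 * s₁) * h.sum + h.pairs
  have h2 := mul_pos (sub_pos.2 h.lt₁₂) (sub_pos.2 (h.lt₁₂.trans h.lt₂₃))
  rw [h1] at h2
  linarith [(pos_iff_pos_of_mul_pos h2).1 (neg_pos.2 (h.neg₁ ha))]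

theorem level_pos (h : SextRoots a E s₁ s₂ s₃) (ha : a < 2) : 0 < E := by
  have := mul_pos (mul_pos_of_neg_of_neg (h.neg₁ ha) (h.neg₂ ha)) (h.pos₃ ha)
  linarith [h.prod]

/-- The cubic is negative at its local minimum −2(2 − a)/3, where its value is 4E − 4(2 − a)³/27,
and at 2 + a beyond the last root, where its value is 4E − 4(2 + a)². -/
theorem level_lt (h : SextRoots a E s₁ s₂ s₃) (ha : a < 2) : E < sextSep a := by
  refine lt_min ?_ ?_
  · have e := h.cubic_eq (-(2 * (2 - a) / 3))
    have h1 := h.lt_critical₁ ha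
    have h2 := h.critical_lt₂ ha
    have h3 := h.lt₂₃
    have : 0 < (-(2 * (2 - a) / 3) - s₁) * -(-(2 * (2 - a) / 3) - s₂) * (s₃ - -(2 * (2 - a) / 3)) :=
      mul_pos (mul_pos (by linarith) (by linarith)) (by linarith)
    nlinarith
  · have e := h.cubic_eq (2 + a)
    have h2 := h.lt₂₃
    have h1 := h.lt₁₂
    have h3 := h.lt₃₄
    have : 0 < (2 + a - s₁) * (2 + a - s₂) * -(s₃ - (2 + a)) :=
      mul_pos (mul_pos (by linarith) (by linarith)) (by linarith)
    nlinarith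

theorem mem_Icc_of_root (h : SextRoots a E s₁ s₂ s₃) {x : ℝ}
    (hx : 4 * E - (2 - a) * x ^ 2 - x ^ 3 = 0) : s₁ ≤ x ∧ x ≤ s₃ := by
  rw [h.cubic_eq, mul_eq_zero, mul_eq_zero, sub_eq_zero, sub_eq_zero, sub_eq_zero] at hx
  have := h.lt₁₂
  have := h.lt₂₃
  rcases hx with (rfl | rfl) | rfl <;> constructor <;> linarith

theorem unique (h : SextRoots a E s₁ s₂ s₃) {u₁ u₂ u₃ : ℝ} (h' : SextRoots a E u₁ u₂ u₃) :
    u₁ = s₁ ∧ u₂ = s₂ ∧ u₃ = s₃ := by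
  have e1 : u₁ = s₁ := (h'.mem_Icc_of_root (by rw [h.cubic_eq]; ring)).1.antisymm
    (h.mem_Icc_of_root (by rw [h'.cubic_eq]; ring)).1
  have e3 : u₃ = s₃ := (h.mem_Icc_of_root (by rw [h'.cubic_eq]; ring)).2.antisymm
    (h'.mem_Icc_of_root (by rw [h.cubic_eq]; ring)).2
  exact ⟨e1, by linarith [h.sum, h'.sum], e3⟩

end SextRoots

/-- The roots of the cubic, by Viète's trigonometric formulas. -/
theorem sextRoots {a E : ℝ} (ha₁ : -2 < a) (ha₂ : a < 2) (hE : 0 < E) (hE' : E < sextSep a) :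
    SextRoots a E (Real.sqrt 2 * sextQ₁ a E) (Real.sqrt 2 * sextQ₂ a E)
      (Real.sqrt 2 * sextQ₃ a E) := by
  have hβ : 0 < 2 - a := by linarith
  have hE1 : E < (2 - a) ^ 3 / 27 := hE'.trans_le (min_le_left _ _)
  have hE2 : E < (2 + a) ^ 2 := hE'.trans_le (min_le_right _ _)
  have hw1 : 1 - 54 * E / (2 - a) ^ 3 < 1 := by
    have : 0 < 54 * E / (2 - a) ^ 3 := by positivity
    linarith
  have hw2 : -1 < 1 - 54 * E / (2 - a) ^ 3 := by
    have : 54 * E / (2 - a) ^ 3 < 2 := by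
      rw [div_lt_iff₀ (by positivity)]; linarith
    linarith
  set w := 1 - 54 * E / (2 - a) ^ 3 with hw
  -- All three formulas are rewritten with this one angle: the cosines become those of x, π/3 + x
  -- and π/3 − x, and cos 3x = w is what the product of the roots needs.
  set x := Real.arccos w / 3 with hx
  have hx0 : 0 < x := by
    have := Real.arccos_pos.2 hw1; positivity
  have hx1 : x < Real.pi / 3 := by
    have h1 : Real.arccos w < Real.pi := by
      refine lt_of_le_of_ne (Real.arccos_le_pi _) fun h => ?_
      rw [Real.arccos_eq_pi] at h; linarith
    rw [hx]; linarith
  have hcos : Real.cos (3 * x) = w := by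
    rw [hx, mul_div_cancel₀ _ (by norm_num), Real.cos_arccos hw2.le hw1.le]
  have h1 : Real.sqrt 2 * sextQ₁ a E = -((2 - a) / 3) * (1 + 2 * Real.cos x) := by
    rw [sextQ₁, ← hw, show 1 / 3 * Real.arccos w = x by rw [hx]; ring]
    field_simp
  have h2 : Real.sqrt 2 * sextQ₂ a E = -((2 - a) / 3) * (1 - 2 * Real.cos (Real.pi / 3 + x)) := by
    rw [sextQ₂, ← hw, Real.arcsin_eq_pi_div_two_sub_arccos,
      show 1 / 3 * (Real.pi / 2 - Real.arccos w) = Real.pi / 2 - (Real.pi / 3 + x) by rw [hx]; ring,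
      Real.sin_pi_div_two_sub]
    field_simp
  have h3 : Real.sqrt 2 * sextQ₃ a E = -((2 - a) / 3) * (1 - 2 * Real.cos (Real.pi / 3 - x)) := by
    rw [sextQ₃, show 54 * E / (2 - a) ^ 3 - 1 = -w by rw [hw]; ring, Real.arccos_neg,
      show 1 / 3 * (Real.pi - Real.arccos w) = Real.pi / 3 - x by rw [hx]; ring]
    field_simp
  rw [h1, h2, h3]
  have hs3 : Real.sqrt 3 ^ 2 = 3 := Real.sq_sqrt (by norm_num)
  have hcp : Real.cos (Real.pi / 3 + x) = Real.cos x / 2 - Real.sqrt 3 / 2 * Real.sin x := by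
    rw [Real.cos_add, Real.cos_pi_div_three, Real.sin_pi_div_three]; ring
  have hcm : Real.cos (Real.pi / 3 - x) = Real.cos x / 2 + Real.sqrt 3 / 2 * Real.sin x := by
    rw [Real.cos_sub, Real.cos_pi_div_three, Real.sin_pi_div_three]; ring
  have hsin : 0 < Real.sin x := Real.sin_pos_of_pos_of_lt_pi hx0 (by linarith [Real.pi_pos])
  have hsc := Real.sin_sq_add_cos_sq x
  have hcx : 0 < Real.cos x + Real.cos (Real.pi / 3 + x) := by
    have a1 : 0 < Real.cos x :=
      Real.cos_pos_of_mem_Ioo ⟨by linarith [Real.pi_pos], by linarith [Real.pi_pos]⟩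
    have a2 : Real.cos (Real.pi - x) < Real.cos (Real.pi / 3 + x) :=
      Real.cos_lt_cos_of_nonneg_of_le_pi (by linarith [Real.pi_pos]) (by linarith) (by linarith)
    rw [Real.cos_pi_sub] at a2
    linarith
  rw [Real.cos_three_mul] at hcos
  have hE3 : (2 - a) ^ 3 * (1 - w) = 54 * E := by rw [hw]; field_simp; ring
  have hsum : -((2 - a) / 3) * (1 + 2 * Real.cos x) +
      -((2 - a) / 3) * (1 - 2 * Real.cos (Real.pi / 3 + x)) +
      -((2 - a) / 3) * (1 - 2 * Real.cos (Real.pi / 3 - x)) = a - 2 := by rw [hcp, hcm]; ring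
  have hpairs : -((2 - a) / 3) * (1 + 2 * Real.cos x) *
        (-((2 - a) / 3) * (1 - 2 * Real.cos (Real.pi / 3 + x))) +
      -((2 - a) / 3) * (1 + 2 * Real.cos x) *
        (-((2 - a) / 3) * (1 - 2 * Real.cos (Real.pi / 3 - x))) +
      -((2 - a) / 3) * (1 - 2 * Real.cos (Real.pi / 3 + x)) *
        (-((2 - a) / 3) * (1 - 2 * Real.cos (Real.pi / 3 - x))) = 0 := by
    rw [hcp, hcm]
    linear_combination (-((2 - a) ^ 2 / 9) * Real.sin x ^ 2) * hs3 - ((2 - a) ^ 2 / 3) * hsc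
  have hprod : -((2 - a) / 3) * (1 + 2 * Real.cos x) *
        (-((2 - a) / 3) * (1 - 2 * Real.cos (Real.pi / 3 + x))) *
        (-((2 - a) / 3) * (1 - 2 * Real.cos (Real.pi / 3 - x))) = 4 * E := by
    rw [hcp, hcm]
    linear_combination ((2 - a) ^ 3 / 27 * (1 + 2 * Real.cos x) * Real.sin x ^ 2) * hs3 +
      ((2 - a) ^ 3 / 9 * (1 + 2 * Real.cos x)) * hsc - (2 * (2 - a) ^ 3 / 27) * hcos +
      (2 / 27) * hE3
  have h12 : -((2 - a) / 3) * (1 + 2 * Real.cos x) <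
      -((2 - a) / 3) * (1 - 2 * Real.cos (Real.pi / 3 + x)) := by
    linarith [mul_pos hβ hcx]
  have h23 : -((2 - a) / 3) * (1 - 2 * Real.cos (Real.pi / 3 + x)) <
      -((2 - a) / 3) * (1 - 2 * Real.cos (Real.pi / 3 - x)) := by
    have : 0 < Real.sqrt 3 * Real.sin x := by positivity
    have : Real.cos (Real.pi / 3 + x) < Real.cos (Real.pi / 3 - x) := by rw [hcp, hcm]; linarith
    linarith [mul_pos hβ (sub_pos.2 this)]
  refine ⟨h12, h23, ?_, hsum, hpairs, hprod⟩
  -- A root s₃ ≥ 2 + a would give 4E = s₃²(s₃ + 2 − a) ≥ 4(2 + a)².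
  by_contra! hge
  generalize -((2 - a) / 3) * (1 + 2 * Real.cos x) = s₁ at *
  generalize -((2 - a) / 3) * (1 - 2 * Real.cos (Real.pi / 3 + x)) = s₂ at *
  generalize -((2 - a) / 3) * (1 - 2 * Real.cos (Real.pi / 3 - x)) = s₃ at *
  have e : s₃ ^ 2 * (s₃ + (2 - a)) = 4 * E := by
    linear_combination hprod - s₃ * hpairs + s₃ ^ 2 * hsum
  have hσ : 0 < 2 + a := by linarith
  have : (2 + a) ^ 2 * 4 ≤ s₃ ^ 2 * (s₃ + (2 - a)) :=
    mul_le_mul (pow_le_pow_left₀ hσ.le hge 2) (by linarith) (by norm_num) (sq_nonneg _)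
  linarith

/-! ### The angle curve over the interval between the roots `s₂` and `s₃` -/

def angleS (s₂ s₃ x : ℝ) : ℝ := (s₂ + s₃) / 2 - (s₃ - s₂) / 2 * Real.cos x

/-- The angular velocity. -/
def angleω (s₁ s₂ s₃ s₄ x : ℝ) : ℝ :=
  Real.sqrt ((angleS s₂ s₃ x - s₁) * (s₄ - angleS s₂ s₃ x))

/-- The difference p − q along the curve when s₄ = 2 + a: a square root of (S − s₁)(S − s₂)(s₃ −
S)/(s₄ − S) with the sign of sin x, and so smooth through the turning points. -/
def angleD (s₁ s₂ s₃ s₄ x : ℝ) : ℝ :=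
  (s₃ - s₂) / 2 * Real.sin x * angleω s₁ s₂ s₃ s₄ x / (s₄ - angleS s₂ s₃ x)

section angle

variable {s₁ s₂ s₃ s₄ : ℝ}

theorem angleS_mem (h : s₂ < s₃) (x : ℝ) : s₂ ≤ angleS s₂ s₃ x ∧ angleS s₂ s₃ x ≤ s₃ := by
  have h1 := Real.neg_one_le_cos x
  have h2 := Real.cos_le_one x
  unfold angleS
  constructor <;> nlinarith

theorem angleS_mul (x : ℝ) : (angleS s₂ s₃ x - s₂) * (s₃ - angleS s₂ s₃ x) =
    ((s₃ - s₂) / 2 * Real.sin x) ^ 2 := by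
  unfold angleS
  linear_combination (-((s₃ - s₂) / 2) ^ 2) * Real.sin_sq_add_cos_sq x

theorem angle_pos (h12 : s₁ < s₂) (h23 : s₂ < s₃) (h34 : s₃ < s₄) (x : ℝ) :
    0 < angleS s₂ s₃ x - s₁ ∧ 0 < s₄ - angleS s₂ s₃ x := by
  have := angleS_mem h23 x
  constructor <;> linarith

theorem angleω_pos (h12 : s₁ < s₂) (h23 : s₂ < s₃) (h34 : s₃ < s₄) (x : ℝ) :
    0 < angleω s₁ s₂ s₃ s₄ x := by
  have := angle_pos h12 h23 h34 x
  exact Real.sqrt_pos.2 (mul_pos this.1 this.2)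

theorem angleω_sq (h12 : s₁ < s₂) (h23 : s₂ < s₃) (h34 : s₃ < s₄) (x : ℝ) :
    angleω s₁ s₂ s₃ s₄ x ^ 2 = (angleS s₂ s₃ x - s₁) * (s₄ - angleS s₂ s₃ x) := by
  have := angle_pos h12 h23 h34 x
  exact Real.sq_sqrt (mul_pos this.1 this.2).le

theorem hasDerivAt_angleS (x : ℝ) :
    HasDerivAt (angleS s₂ s₃) ((s₃ - s₂) / 2 * Real.sin x) x :=
  (((Real.hasDerivAt_cos x).const_mul ((s₃ - s₂) / 2)).const_sub ((s₂ + s₃) / 2)).congr_deriv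
    (by ring)

theorem hasDerivAt_angleω (h12 : s₁ < s₂) (h23 : s₂ < s₃) (h34 : s₃ < s₄) (x : ℝ) :
    HasDerivAt (angleω s₁ s₂ s₃ s₄) ((s₁ + s₄ - 2 * angleS s₂ s₃ x) *
      ((s₃ - s₂) / 2 * Real.sin x) / (2 * angleω s₁ s₂ s₃ s₄ x)) x := by
  have hp := angle_pos h12 h23 h34 x
  have hS := hasDerivAt_angleS (s₂ := s₂) (s₃ := s₃) x
  refine (((hS.sub_const s₁).mul (hS.const_sub s₄)).sqrt (mul_pos hp.1 hp.2).ne').congr_deriv ?_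
  simp only [angleω, Pi.mul_apply]
  ring

theorem angleS_periodic (x : ℝ) : angleS s₂ s₃ (x + 2 * Real.pi) = angleS s₂ s₃ x := by
  simp [angleS]

theorem angleω_periodic (x : ℝ) :
    angleω s₁ s₂ s₃ s₄ (x + 2 * Real.pi) = angleω s₁ s₂ s₃ s₄ x := by
  simp only [angleω, angleS_periodic]

theorem angleD_periodic (x : ℝ) :
    angleD s₁ s₂ s₃ s₄ (x + 2 * Real.pi) = angleD s₁ s₂ s₃ s₄ x := by
  simp only [angleD, angleS_periodic, angleω_periodic, Real.sin_add_two_pi]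

theorem angleD_sq (h12 : s₁ < s₂) (h23 : s₂ < s₃) (h34 : s₃ < s₄) (x : ℝ) :
    angleD s₁ s₂ s₃ s₄ x ^ 2 * (s₄ - angleS s₂ s₃ x) =
      (angleS s₂ s₃ x - s₁) * (angleS s₂ s₃ x - s₂) * (s₃ - angleS s₂ s₃ x) := by
  have hp := angle_pos h12 h23 h34 x
  rw [angleD, div_pow, mul_pow, angleω_sq h12 h23 h34, ← angleS_mul]
  field_simp [hp.2.ne']

theorem continuous_angleS : Continuous (angleS s₂ s₃) :=
  continuous_iff_continuousAt.2 fun x => (hasDerivAt_angleS x).continuousAt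

theorem continuous_angleω : Continuous (angleω s₁ s₂ s₃ s₄) := by
  have := continuous_angleS (s₂ := s₂) (s₃ := s₃)
  unfold angleω
  fun_prop

/-- Differentiating `angleD_sq` and dividing by 2D(s₄ − S) suggests the formula; the direct
computation also covers the turning points, where D = 0. -/
theorem hasDerivAt_angleD (h12 : s₁ < s₂) (h23 : s₂ < s₃) (h34 : s₃ < s₄) (x : ℝ) :
    HasDerivAt (angleD s₁ s₂ s₃ s₄)
      (((angleS s₂ s₃ x - s₂) * (s₃ - angleS s₂ s₃ x) +
        (angleS s₂ s₃ x - s₁) * (s₂ + s₃ - 2 * angleS s₂ s₃ x) + angleD s₁ s₂ s₃ s₄ x ^ 2) / 2 /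
        angleω s₁ s₂ s₃ s₄ x) x := by
  have hp := angle_pos h12 h23 h34 x
  have hω := angleω_pos h12 h23 h34 x
  have hω2 := angleω_sq h12 h23 h34 x
  have hS := hasDerivAt_angleS (s₂ := s₂) (s₃ := s₃) x
  have hd2 := angleD_sq h12 h23 h34 x
  have hm := angleS_mul (s₂ := s₂) (s₃ := s₃) x
  have hc : (s₃ - s₂) / 2 * Real.cos x = (s₂ + s₃) / 2 - angleS s₂ s₃ x := by
    rw [angleS]; ring
  have hd := (((Real.hasDerivAt_sin x).const_mul ((s₃ - s₂) / 2)).mul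
    (hasDerivAt_angleω h12 h23 h34 x)).div (hS.const_sub s₄) hp.2.ne'
  refine HasDerivAt.congr_deriv hd ?_
  rw [hc]
  have hd3 : angleD s₁ s₂ s₃ s₄ x ^ 2 = (angleS s₂ s₃ x - s₁) *
      ((s₃ - s₂) / 2 * Real.sin x) ^ 2 / (s₄ - angleS s₂ s₃ x) := by
    rw [eq_div_iff hp.2.ne', hd2, ← hm]; ring
  rw [hd3, hm]
  simp only [Pi.mul_apply]
  generalize (s₃ - s₂) / 2 * Real.sin x = R at *
  generalize angleω s₁ s₂ s₃ s₄ x = w at *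
  generalize angleS s₂ s₃ x = S at *
  have e4 : s₄ - S ≠ 0 := hp.2.ne'
  have ew : w ≠ 0 := hω.ne'
  field_simp
  rw [hω2]
  ring

end angle

/-- Hamilton's equations read s' = d(2 + a − s) and d' = −(3s² − d²)/2 − (2 − a)s. These are ω times
the x-derivatives of `angleS` and `angleD`. -/
theorem isSextAngleCurve {a E s₁ s₂ s₃ : ℝ} (h : SextRoots a E s₁ s₂ s₃) :
    IsSextAngleCurve a E (angleω s₁ s₂ s₃ (2 + a))
      (fun x => (angleS s₂ s₃ x - angleD s₁ s₂ s₃ (2 + a) x) / 2)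
      (fun x => (angleS s₂ s₃ x + angleD s₁ s₂ s₃ (2 + a) x) / 2) := by
  have h12 := h.lt₁₂
  have h23 := h.lt₂₃
  have h34 := h.lt₃₄
  have hS : ∀ x, HasDerivAt (angleS s₂ s₃) (angleD s₁ s₂ s₃ (2 + a) x *
      (2 + a - angleS s₂ s₃ x) / angleω s₁ s₂ s₃ (2 + a) x) x := fun x => by
    refine (hasDerivAt_angleS x).congr_deriv ?_
    have hp := (angle_pos h12 h23 h34 x).2.ne'
    have hω := (angleω_pos h12 h23 h34 x).ne'
    rw [angleD]
    field_simp
  have hD := fun x => hasDerivAt_angleD h12 h23 h34 x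
  have key : ∀ S, (S - s₂) * (s₃ - S) + (S - s₁) * (s₂ + s₃ - 2 * S) =
      -(2 * (2 - a) * S + 3 * S ^ 2) := fun S => by
    linear_combination 2 * S * h.sum - h.pairs
  refine ⟨continuous_angleω, angleω_pos h12 h23 h34, angleω_periodic, fun x => ?_, fun x => ?_,
    fun x => ?_, fun x => ?_, fun x => ?_, fun x hx hx' he => ?_⟩
  · refine (((hS x).sub (hD x)).div_const 2).congr_deriv ?_
    rw [key, ← sub_div, div_div, mul_comm _ (2:ℝ), ← div_div]
    congr 1
    ring
  · refine (((hS x).add (hD x)).div_const 2).congr_deriv ?_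
    rw [key, ← add_div, div_div, mul_comm _ (2:ℝ), ← div_div]
    congr 1
    ring
  · have h1 := angleD_sq h12 h23 h34 x
    rw [← h.cubic_eq] at h1
    rw [sextInv]
    linear_combination h1 / 4
  · simp only [angleS_periodic, angleD_periodic]
  · simp only [angleS_periodic, angleD_periodic]
  · rw [Prod.mk.injEq] at he
    have : angleS s₂ s₃ x = angleS s₂ s₃ 0 := by linarith [he.1, he.2]
    rw [angleS, angleS, Real.cos_zero] at this
    have hc : Real.cos x = 1 := by nlinarith
    rw [Real.cos_eq_one_iff_of_lt_of_lt (by linarith [Real.pi_pos]) hx'] at hc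
    linarith

/-- The curve stays to the right of the pole of the map. -/
theorem SextRoots.neg_one_lt {a E s₁ s₂ s₃ : ℝ} (h : SextRoots a E s₁ s₂ s₃) (ha₁ : -2 < a)
    (ha₂ : a < 2) (x : ℝ) :
    -1 < (angleS s₂ s₃ x + angleD s₁ s₂ s₃ (2 + a) x) / 2 := by
  have h12 := h.lt₁₂
  have h23 := h.lt₂₃
  have h34 := h.lt₃₄
  have hE : E < (2 + a) ^ 2 := (h.level_lt ha₂).trans_le (min_le_right _ _)
  -- For a ≥ −1 the position of the local minimum suffices. For a < −1 the cubic at −2 equals 4(E +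
  -- a), which is negative because E < (2 + a)², so −2 cannot lie between s₂ and s₃.
  have hs2 : -2 < s₂ := by
    rcases le_or_gt (-1) a with h1 | h1
    · linarith [h.critical_lt₂ ha₂]
    · by_contra! hle
      have e := h.cubic_eq (-2)
      have : 0 ≤ (-2 - s₁) * (-2 - s₂) * (s₃ - -2) :=
        mul_nonneg (mul_nonneg (by linarith) (by linarith)) (by linarith [h.pos₃ ha₂])
      nlinarith
  -- The claim p > −1 follows from |d| < s + 2. The difference ((s + 2)² − d²)(2 + a − s) is affine
  -- in s, so it is enough to know its sign at s₂ and s₃, where d = 0.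
  have hL : ∀ S, (S + 2) ^ 2 * (2 + a - S) - (S - s₁) * (S - s₂) * (s₃ - S) =
      4 * ((1 + a) * S + 2 + a - E) := fun S => by rw [← h.cubic_eq]; ring
  have hL2 : 0 < (1 + a) * s₂ + 2 + a - E := by
    have := hL s₂
    have : 0 < (s₂ + 2) ^ 2 * (2 + a - s₂) := mul_pos (by nlinarith) (by linarith)
    linarith
  have hL3 : 0 < (1 + a) * s₃ + 2 + a - E := by
    have := hL s₃
    have : 0 < (s₃ + 2) ^ 2 * (2 + a - s₃) := mul_pos (by nlinarith) (by linarith)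
    linarith
  obtain ⟨hS2, hS3⟩ := angleS_mem h23 x
  have hp := angle_pos h12 h23 h34 x
  have hd := angleD_sq h12 h23 h34 x
  have := hL (angleS s₂ s₃ x)
  rw [← hd] at this
  have hLS : 0 < (1 + a) * angleS s₂ s₃ x + 2 + a - E := by
    have : 0 < (s₃ - s₂) * ((1 + a) * angleS s₂ s₃ x + 2 + a - E) := by
      rcases hS2.lt_or_eq with h0 | h0
      · nlinarith [mul_pos (sub_pos.2 h0) hL3, mul_nonneg (sub_nonneg.2 hS3) hL2.le]
      · rw [← h0]; exact mul_pos (sub_pos.2 h23) hL2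
    exact (pos_iff_pos_of_mul_pos this).1 (sub_pos.2 h23)
  have h5 : 0 < ((angleS s₂ s₃ x + 2) ^ 2 - angleD s₁ s₂ s₃ (2 + a) x ^ 2) *
      (2 + a - angleS s₂ s₃ x) := by linarith
  have h6 := (pos_iff_pos_of_mul_pos h5).2 hp.2
  have := (abs_lt_of_sq_lt_sq (a := angleD s₁ s₂ s₃ (2 + a) x) (b := angleS s₂ s₃ x + 2)
    (by linarith) (by linarith))
  linarith [(abs_lt.1 this).1]

/-! ### Classification of the closed curves -/

/-- At the maximum v and the minimum u of s = q + p along the orbit one has d = 0, so u and v are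
roots of the cubic. They differ, since a constant s would mean an equilibrium, and their sum
determines the third root. It cannot exceed u, because the cubic is nonnegative between u and v, and
it cannot equal u, because the lowest point would then be an equilibrium. -/
theorem IsSextClosedCurve.exists_roots {a E T : ℝ} {q p : ℝ → ℝ} (ha₁ : -2 < a) (ha₂ : a < 2)
    (h : IsSextClosedCurve a E q p T) :
    ∃ s₁ s₂ s₃ t, SextRoots a E s₁ s₂ s₃ ∧ q t = s₃ / 2 ∧ p t = s₃ / 2 := by
  have ho := h.orbit
  have cq := ho.continuous_left
  have cp := ho.continuous_right
  have hT := h.period_pos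
  have hs : ∀ t, HasDerivAt (fun t => q t + p t) ((p t - q t) * (2 + a - (q t + p t))) t :=
    fun t => ((ho t).1.add (ho t).2).congr_deriv (by ring)
  have hd : ∀ t, HasDerivAt (fun t => p t - q t)
      (-((3 * (q t + p t) ^ 2 - (p t - q t) ^ 2) / 2 + (2 - a) * (q t + p t))) t :=
    fun t => ((ho t).2.sub (ho t).1).congr_deriv (by ring)
  have hlev : ∀ t, (p t - q t) ^ 2 * (2 + a - (q t + p t)) =
      4 * E - (2 - a) * (q t + p t) ^ 2 - (q t + p t) ^ 3 := fun t => by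
    rw [← h.level t, sextInv]; ring
  have heq : ∀ t, (p t - q t) * (2 + a - (q t + p t)) = 0 →
      (3 * (q t + p t) ^ 2 - (p t - q t) ^ 2) / 2 + (2 - a) * (q t + p t) = 0 → False :=
    fun t h1 h2 => h.not_equilibrium t (by linarith) (by linarith)
  -- a continuous periodic function attains its extrema
  have hext : ∀ f : ℝ → ℝ, Continuous f → (∀ t, f (t + T) = f t) → ∃ t₀, ∀ t, f t ≤ f t₀ := by
    intro f hf hper
    obtain ⟨t₀, -, h0⟩ := (isCompact_Icc (a := (0:ℝ)) (b := T)).exists_isMaxOn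
      (Set.nonempty_Icc.2 hT.le) hf.continuousOn
    refine ⟨t₀, fun t => ?_⟩
    obtain ⟨y, hy, hfy⟩ := Function.Periodic.exists_mem_Ico₀ (f := f) hper hT t
    rw [hfy]
    exact h0 ⟨hy.1, hy.2.le⟩
  have hper := h.periodic
  have hcrit : ∀ {f : ℝ → ℝ} {f' t₀ : ℝ}, HasDerivAt f f' t₀ → (∀ t, f t ≤ f t₀) → f' = 0 :=
    fun hf hmax => IsLocalMax.hasDerivAt_eq_zero (Eventually.of_forall hmax) hf
  -- the line `q + p = 2 + a` is invariant
  have hD : ∀ t, HasDerivAt (fun t => ∫ u in (0:ℝ)..t, (p u - q u)) (p t - q t) t := fun t =>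
    ((cp.sub cq).integral_hasStrictDerivAt 0 t).hasDerivAt
  set D := fun t => ∫ u in (0:ℝ)..t, (p u - q u)
  have hz : ∀ t, (2 + a - (q t + p t)) * Real.exp (D t) = (2 + a - (q 0 + p 0)) * Real.exp (D 0) :=
      by
    intro t
    have hder : ∀ t, HasDerivAt (fun t => (2 + a - (q t + p t)) * Real.exp (D t)) 0 t := fun t => by
      refine (((hs t).const_sub (2 + a)).mul (hD t).exp).congr_deriv ?_
      ring
    exact is_const_of_deriv_eq_zero (fun t => (hder t).differentiableAt) (fun t => (hder t).deriv) t
        0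
  have hexp : ∀ t, 0 < Real.exp (D t) := fun t => Real.exp_pos _
  obtain ⟨t₁, ht₁⟩ := hext (fun t => q t + p t) (cq.add cp) (fun t => by simp [hper])
  obtain ⟨t₂, ht₂⟩ := hext (fun t => -(q t + p t)) (cq.add cp).neg (fun t => by simp [hper])
  have e₁ := hcrit (hs t₁) ht₁
  have e₂ := hcrit (hs t₂).neg ht₂
  simp only [neg_le_neg_iff, neg_eq_zero] at ht₂ e₂
  rcases eq_or_ne (2 + a - (q 0 + p 0)) 0 with h0 | h0
  · exfalso
    have hs4 : ∀ t, 2 + a - (q t + p t) = 0 := fun t => by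
      have := hz t
      rw [h0, zero_mul] at this
      exact (mul_eq_zero.1 this).resolve_right (hexp t).ne'
    obtain ⟨t₃, ht₃⟩ := hext (fun t => p t - q t) (cp.sub cq) (fun t => by simp [hper])
    exact heq t₃ (by rw [hs4, mul_zero]) (neg_eq_zero.1 (hcrit (hd t₃) ht₃))
  have hne : ∀ t, 2 + a - (q t + p t) ≠ 0 := fun t h1 => by
    have := hz t
    rw [h1, zero_mul] at this
    exact mul_ne_zero h0 (hexp 0).ne' this.symm
  have d₁ := (mul_eq_zero.1 e₁).resolve_right (hne t₁)
  have d₂ := (mul_eq_zero.1 e₂).resolve_right (hne t₂)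
  have g₁ := hlev t₁
  have g₂ := hlev t₂
  rw [d₁] at g₁
  rw [d₂] at g₂
  have n₁ := heq t₁ e₁
  have n₂ := heq t₂ e₂
  rw [d₁] at n₁
  rw [d₂] at n₂
  have hIVT : ∀ x, q t₂ + p t₂ ≤ x → x ≤ q t₁ + p t₁ → ∃ t, q t + p t = x := fun x hx hx' => by
    obtain ⟨t, -, ht⟩ := intermediate_value_uIcc (a := t₂) (b := t₁) (f := fun t => q t + p t)
      (cq.add cp).continuousOn ⟨by simpa using Or.inl hx, by simpa using Or.inr hx'⟩
    exact ⟨t, ht⟩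
  have hlt : q t₂ + p t₂ < q t₁ + p t₁ := by
    refine lt_of_le_of_ne (ht₂ t₁) fun he => ?_
    have hc : ∀ t, q t + p t = q t₁ + p t₁ := fun t =>
      (ht₁ t).antisymm (he ▸ ht₂ t)
    have hcs : ∀ t, (p t - q t) * (2 + a - (q t + p t)) = 0 := fun t =>
      (hs t).unique ((hasDerivAt_const t (q t₁ + p t₁)).congr_of_eventuallyEq
        (Eventually.of_forall hc))
    have hc2 : ∀ t, p t - q t = 0 := fun t => (mul_eq_zero.1 (hcs t)).resolve_right (hne t)
    have := (hd t₁).unique ((hasDerivAt_const t₁ (0:ℝ)).congr_of_eventuallyEq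
        (Eventually.of_forall hc2))
    rw [d₁] at this
    exact n₁ (by linarith)
  have hq₁ : q t₁ = (q t₁ + p t₁) / 2 := by linarith
  have hp₁ : p t₁ = (q t₁ + p t₁) / 2 := by linarith
  refine ⟨a - 2 - (q t₂ + p t₂) - (q t₁ + p t₁), q t₂ + p t₂, q t₁ + p t₁, t₁, ?_, hq₁, hp₁⟩
  have hsgn : ∀ t, 0 < (2 + a - (q t + p t)) * (2 + a - (q t₁ + p t₁)) := fun t => by
    have e1 : (2 + a - (q t + p t)) * (2 + a - (q t₁ + p t₁)) * (Real.exp (D t) * Real.exp (D t₁)) =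
      ((2 + a - (q 0 + p 0)) * Real.exp (D 0)) ^ 2 := by
      have h1 := hz t; have h2 := hz t₁
      rw [sq]; nth_rw 1 [← h1]; rw [← h2]; ring
    have e2 : 0 < ((2 + a - (q 0 + p 0)) * Real.exp (D 0)) ^ 2 :=
      sq_pos_of_ne_zero (mul_ne_zero h0 (hexp 0).ne')
    rw [← e1] at e2
    exact (pos_iff_pos_of_mul_pos e2).2 (mul_pos (hexp _) (hexp _))
  clear_value D
  clear hz hexp hD e₁ e₂ hext hcrit hper hq₁ hp₁ d₁ d₂ heq hd hs
  generalize q t₁ + p t₁ = v at *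
  generalize q t₂ + p t₂ = u at *
  -- The difference of the two root equations, divided by v − u.
  have hpair : u ^ 2 + u * v + v ^ 2 + (2 - a) * (u + v) = 0 := by
    refine (mul_eq_zero.1 (?_ : (v - u) * _ = 0)).resolve_left (sub_pos.2 hlt).ne'
    linear_combination g₁ - g₂
  -- If v ≥ 2 + a, the constant sign of 2 + a − s puts u above 2 + a as well; both are then
  -- positive, against `hpair`.
  have h34 : v < 2 + a := by
    by_contra! hge
    have hu : 2 + a - u < 0 := by
      have := hsgn t₂
      obtain ⟨t, ht⟩ := hIVT u le_rfl hlt.le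
      have := hsgn t
      rw [ht] at this
      by_contra! h1
      nlinarith [mul_nonneg h1 (sub_nonneg.2 hge)]
    nlinarith [mul_pos (show 0 < u by linarith) (show 0 < v by linarith),
      mul_pos (sub_pos.2 ha₂) (show 0 < u + v by linarith)]
  -- Every value between u and v is attained by s, and there the cubic equals d²(2 + a − s) ≥ 0.
  have hle : ∀ x, u < x → x < v → a - 2 - u - v ≤ x := fun x hx hx' => by
    obtain ⟨t, ht⟩ := hIVT x hx.le hx'.le
    have h1 := hlev t
    rw [ht] at h1
    have h2 : 4 * E - (2 - a) * x ^ 2 - x ^ 3 = (x - (a - 2 - u - v)) * ((x - u) * (v - x)) := by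
      linear_combination (-x) * hpair - g₂ + u * hpair
    have h3 : 0 ≤ (x - (a - 2 - u - v)) * ((x - u) * (v - x)) := by
      rw [← h2, ← h1]
      exact mul_nonneg (sq_nonneg _) (by linarith)
    have h4 := mul_pos (sub_pos.2 hx) (sub_pos.2 hx')
    by_contra! h5
    nlinarith [mul_pos (sub_pos.2 h5) h4]
  refine ⟨lt_of_le_of_ne ?_ fun he => n₂ ?_, hlt, h34, by ring, ?_, ?_⟩
  · by_contra! h1
    have h2 := hle (min ((u + (a - 2 - u - v)) / 2) ((u + v) / 2)) (lt_min (by linarith) (by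
        linarith))
      ((min_le_right _ _).trans_lt (by linarith))
    have h3 := min_le_left ((u + (a - 2 - u - v)) / 2) ((u + v) / 2)
    linarith
  · have e : v = a - 2 - 2 * u := by linarith
    rw [e] at hpair
    linear_combination hpair / 2
  · linear_combination -hpair
  · linear_combination -u * hpair + g₂

/-! ### Action, period and rotation number as integrals over the angle -/

def angleAction (s₁ s₂ s₃ s₄ : ℝ) : ℝ :=
  1 / (4 * Real.pi) * ∫ x in (0:ℝ)..2 * Real.pi,
    angleD s₁ s₂ s₃ s₄ x * ((s₃ - s₂) / 2 * Real.sin x)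

def anglePeriod (s₁ s₂ s₃ s₄ : ℝ) : ℝ := ∫ x in (0:ℝ)..2 * Real.pi, 1 / angleω s₁ s₂ s₃ s₄ x

/-- The cosine of the angle by which the map turns the point `(s₃ / 2, s₃ / 2)`. -/
def stepCos (a s₂ s₃ : ℝ) : ℝ :=
  (s₃ / 2 * (a - s₃ / 2) / (1 + s₃ / 2) - (s₂ + s₃) / 2) / ((s₃ - s₂) / 2)

/-- The time in which the flow realizes one step of the map. -/
def angleStep (a s₁ s₂ s₃ : ℝ) : ℝ :=
  ∫ x in Real.pi..Real.pi + Real.arccos (stepCos a s₂ s₃), 1 / angleω s₁ s₂ s₃ (2 + a) x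

/-- p dq − (p − q)/2 · d(q + p) is the differential of qp/2 − (p² − q²)/4, so both forms have the
same integral over a closed curve. This explains the factor 1/(4π) in `angleAction`. -/
theorem IsSextAngleCurve.integral_action {a E : ℝ} {ω q p : ℝ → ℝ}
    (h : IsSextAngleCurve a E ω q p) {s : ℝ → ℝ} (hs : ∀ x, HasDerivAt (fun x => q x + p x) (s x) x)
        :
    ∫ x in (0:ℝ)..2 * Real.pi, p x * ((2 * q x * p x + q x ^ 2 + 2 * p x - a * q x) / ω x) =
      ∫ x in (0:ℝ)..2 * Real.pi, (p x - q x) / 2 * s x := by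
  have hq := h.hasDerivAt_q
  have hp := h.hasDerivAt_p
  have cq : Continuous q := continuous_iff_continuousAt.2 fun x => (hq x).continuousAt
  have cp : Continuous p := continuous_iff_continuousAt.2 fun x => (hp x).continuousAt
  have hs' := fun x => (hs x).unique ((hq x).add (hp x))
  have c1 : Continuous fun x => p x * ((2 * q x * p x + q x ^ 2 + 2 * p x - a * q x) / ω x) :=
    cp.mul (Continuous.div (by fun_prop) h.continuous fun x => (h.pos x).ne')
  have c2 : Continuous fun x => (p x - q x) / 2 * s x := by
    simp only [hs']
    exact ((cp.sub cq).div_const _).mul ((Continuous.div (by fun_prop) h.continuous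
      fun x => (h.pos x).ne').add (Continuous.div (by fun_prop) h.continuous fun x => (h.pos
      x).ne'))
  have e3 : ∀ x, HasDerivAt (fun x => q x * p x / 2 - (p x ^ 2 - q x ^ 2) / 4)
      (p x * ((2 * q x * p x + q x ^ 2 + 2 * p x - a * q x) / ω x) - (p x - q x) / 2 * s x) x :=
    fun x => by
    have := (((hq x).mul (hp x)).div_const 2).sub
      ((((hp x).pow 2).sub ((hq x).pow 2)).div_const 4)
    refine HasDerivAt.congr_deriv this ?_
    rw [hs']
    push_cast
    ring
  have := intervalIntegral.integral_eq_sub_of_hasDerivAt (a := 0) (b := 2 * Real.pi)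
    (fun x _ => e3 x) ((c1.sub c2).intervalIntegrable _ _)
  rw [intervalIntegral.integral_sub (c1.intervalIntegrable _ _) (c2.intervalIntegrable _ _)] at this
  have h1 := h.periodic_q 0
  have h2 := h.periodic_p 0
  rw [zero_add] at h1 h2
  rw [h1, h2, sub_self] at this
  linarith

/-- The map turns an orbit into an orbit. -/
theorem IsSextOrbit.map {a : ℝ} {q p : ℝ → ℝ} (h : IsSextOrbit a q p) (hp : ∀ t, p t + 1 ≠ 0) :
    IsSextOrbit a p (fun t => -q t - p t * (p t - a) / (p t + 1)) := by
  intro t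
  have h1 := (h t).1
  have h2 := (h t).2
  have hne := hp t
  -- The conceptual reason is that the map is symplectic and preserves the Hamiltonian; here both
  -- equations are checked directly.
  refine ⟨h2.congr_deriv ?_, HasDerivAt.congr_deriv
    (h1.neg.sub ((h2.mul (h2.sub_const a)).div (h2.add_const 1) hne)) ?_⟩
  · field_simp
    ring
  · simp only [Pi.mul_apply]
    field_simp
    ring

namespace SextRoots

variable {a E s₁ s₂ s₃ : ℝ}

/-- The image of (s₃/2, s₃/2) has sum of coordinates S = f(s₃/2) and difference S − s₃. The equation
says that it lies on the same level; with s₁ < S < s₃ it forces s₂ ≤ S. -/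
theorem stepCos_mem (h : SextRoots a E s₁ s₂ s₃) (ha₂ : a < 2) :
    s₂ ≤ s₃ / 2 * (a - s₃ / 2) / (1 + s₃ / 2) ∧ s₃ / 2 * (a - s₃ / 2) / (1 + s₃ / 2) < s₃ ∧
    (s₃ / 2 * (a - s₃ / 2) / (1 + s₃ / 2) - s₃) ^ 2 *
      (2 + a - s₃ / 2 * (a - s₃ / 2) / (1 + s₃ / 2)) =
      (s₃ / 2 * (a - s₃ / 2) / (1 + s₃ / 2) - s₁) * (s₃ / 2 * (a - s₃ / 2) / (1 + s₃ / 2) - s₂) *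
      (s₃ - s₃ / 2 * (a - s₃ / 2) / (1 + s₃ / 2)) := by
  have h3 := h.pos₃ ha₂
  have h34 := h.lt₃₄
  have hE : 4 * E = (2 - a) * s₃ ^ 2 + s₃ ^ 3 := by linarith [h.cubic_eq s₃]
  have hq : 0 < 1 + s₃ / 2 := by linarith
  set S := s₃ / 2 * (a - s₃ / 2) / (1 + s₃ / 2) with hS
  have e : S * (1 + s₃ / 2) = s₃ / 2 * (a - s₃ / 2) := by rw [hS]; field_simp
  have hS3 : S < s₃ := by
    rw [hS, div_lt_iff₀ hq]; nlinarith
  have hS1 : s₁ < S := by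
    have : 0 < 3 * S + 2 * (2 - a) := by
      have h0 : (1 + s₃ / 2) * (3 * S + 2 * (2 - a)) = (2 - s₃ / 2) * (3 * (s₃ / 2) + (2 - a)) := by
        linear_combination 3 * e
      have h1 : 0 < (2 - s₃ / 2) * (3 * (s₃ / 2) + (2 - a)) :=
        mul_pos (by linarith) (by linarith)
      rw [← h0] at h1
      exact (pos_iff_pos_of_mul_pos h1).1 hq
    linarith [h.lt_critical₁ ha₂]
  have key : (S - s₃) ^ 2 * (2 + a - S) = (S - s₁) * (S - s₂) * (s₃ - S) := by
    rw [← h.cubic_eq, hE]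
    linear_combination (4 * (S - s₃)) * e
  refine ⟨?_, hS3, key⟩
  have h5 : 0 < (S - s₁) * (S - s₂) * (s₃ - S) := by
    rw [← key]
    exact mul_pos (sq_pos_of_ne_zero (sub_neg.2 hS3).ne) (by linarith)
  have h6 := (pos_iff_pos_of_mul_pos h5).2 (sub_pos.2 hS3)
  have h7 := (pos_iff_pos_of_mul_pos h6).1 (sub_pos.2 hS1)
  linarith

theorem stepCos_bounds (h : SextRoots a E s₁ s₂ s₃) (ha₂ : a < 2) :
    -1 ≤ stepCos a s₂ s₃ ∧ stepCos a s₂ s₃ < 1 := by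
  obtain ⟨h1, h2, -⟩ := h.stepCos_mem ha₂
  have hr : 0 < (s₃ - s₂) / 2 := by linarith [h.lt₂₃]
  unfold stepCos
  rw [le_div_iff₀ hr, div_lt_iff₀ hr]
  constructor <;> linarith

/-- The image has d = S − s₃ < 0, so its angle lies in the second half of the turn: hence π + arccos
and not π − arccos. -/
theorem sextMap_angle (h : SextRoots a E s₁ s₂ s₃) (ha₂ : a < 2) :
    sextMap a (s₃ / 2, s₃ / 2) =
      ((angleS s₂ s₃ (Real.pi + Real.arccos (stepCos a s₂ s₃)) -
          angleD s₁ s₂ s₃ (2 + a) (Real.pi + Real.arccos (stepCos a s₂ s₃))) / 2,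
        (angleS s₂ s₃ (Real.pi + Real.arccos (stepCos a s₂ s₃)) +
          angleD s₁ s₂ s₃ (2 + a) (Real.pi + Real.arccos (stepCos a s₂ s₃))) / 2) := by
  obtain ⟨h1, h2, h3⟩ := h.stepCos_mem ha₂
  obtain ⟨b1, b2⟩ := h.stepCos_bounds ha₂
  have hr : 0 < (s₃ - s₂) / 2 := by linarith [h.lt₂₃]
  set θ := Real.arccos (stepCos a s₂ s₃) with hθ
  have hcos : Real.cos θ = stepCos a s₂ s₃ := Real.cos_arccos b1 b2.le
  have hS : angleS s₂ s₃ (Real.pi + θ) = s₃ / 2 * (a - s₃ / 2) / (1 + s₃ / 2) := by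
    rw [angleS, add_comm Real.pi, Real.cos_add_pi, hcos, stepCos, mul_neg, mul_div_cancel₀ _ hr.ne']
    ring
  have hsq := angleD_sq h.lt₁₂ h.lt₂₃ h.lt₃₄ (Real.pi + θ)
  rw [hS, ← h3] at hsq
  have hpos := (angle_pos h.lt₁₂ h.lt₂₃ h.lt₃₄ (Real.pi + θ)).2
  rw [hS] at hpos
  have hsq' := mul_right_cancel₀ hpos.ne' hsq
  have hle : angleD s₁ s₂ s₃ (2 + a) (Real.pi + θ) ≤ 0 := by
    rw [angleD, hS, add_comm Real.pi, Real.sin_add_pi]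
    have hsin : 0 ≤ Real.sin θ := Real.sin_nonneg_of_nonneg_of_le_pi (Real.arccos_nonneg _)
      (Real.arccos_le_pi _)
    have := angleω_pos h.lt₁₂ h.lt₂₃ h.lt₃₄ (θ + Real.pi)
    rw [div_nonpos_iff]
    right
    refine ⟨?_, hpos.le⟩
    have := mul_nonneg (mul_nonneg hr.le hsin) this.le
    linarith
  have hD : angleD s₁ s₂ s₃ (2 + a) (Real.pi + θ) =
      s₃ / 2 * (a - s₃ / 2) / (1 + s₃ / 2) - s₃ := by
    rcases sq_eq_sq_iff_eq_or_eq_neg.1 hsq' with h0 | h0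
    · exact h0
    · linarith
  rw [hS, hD, sextMap]
  have hq : 1 + s₃ / 2 ≠ 0 := by linarith [h.pos₃ ha₂]
  have hq' : s₃ / 2 + 1 ≠ 0 := by linarith [h.pos₃ ha₂]
  ext
  · simp only; ring
  · simp only
    rw [add_comm (s₃ / 2) 1]
    ring

/-- The curve meets the model curve at (s₃/2, s₃/2), the point of angle π, and is therefore a shift
of it. Its image under the map is an orbit through a point of the same curve, so it is a shift as
well, by the time the angle takes from π to the angle of the image. -/
theorem closedCurve_spec (h : SextRoots a E s₁ s₂ s₃) (ha₁ : -2 < a) (ha₂ : a < 2)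
    {q p : ℝ → ℝ} {T : ℝ} (hc : IsSextClosedCurve a E q p T) :
    canonicalAction q p T = angleAction s₁ s₂ s₃ (2 + a) ∧ T = anglePeriod s₁ s₂ s₃ (2 + a) ∧
      0 < angleStep a s₁ s₂ s₃ ∧ angleStep a s₁ s₂ s₃ < T ∧
      ∀ t, sextMap a (q t, p t) = (q (t + angleStep a s₁ s₂ s₃), p (t + angleStep a s₁ s₂ s₃)) := by
  obtain ⟨u₁, u₂, u₃, t₁, hu, hq₁, hp₁⟩ := hc.exists_roots ha₁ ha₂
  obtain ⟨rfl, rfl, rfl⟩ := h.unique hu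
  have hA := isSextAngleCurve hu
  have hne : ∀ x, (angleS u₂ u₃ x + angleD u₁ u₂ u₃ (2 + a) x) / 2 + 1 ≠ 0 := fun x => by
    linarith [hu.neg_one_lt ha₁ ha₂ x]
  have hii : ∀ u v, IntervalIntegrable (fun x => 1 / angleω u₁ u₂ u₃ (2 + a) x)
      MeasureTheory.volume u v := fun u v => hA.continuous_inv.intervalIntegrable u v
  have hipos : ∀ x, 0 < 1 / angleω u₁ u₂ u₃ (2 + a) x := fun x => one_div_pos.2 (hA.pos x)
  obtain ⟨φ, hφ1, hφ2, hcc, hact⟩ := hA.exists_closedCurve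
  set τ := ∫ x in (0:ℝ)..Real.pi, 1 / angleω u₁ u₂ u₃ (2 + a) x with hτ
  have hφτ : φ τ = Real.pi := hφ2 _
  have hSπ : angleS u₂ u₃ Real.pi = u₃ := by rw [angleS, Real.cos_pi]; ring
  have hDπ : angleD u₁ u₂ u₃ (2 + a) Real.pi = 0 := by rw [angleD, Real.sin_pi]; simp
  have h0 : (q t₁, p t₁) = ((angleS u₂ u₃ (φ τ) - angleD u₁ u₂ u₃ (2 + a) (φ τ)) / 2,
      (angleS u₂ u₃ (φ τ) + angleD u₁ u₂ u₃ (2 + a) (φ τ)) / 2) := by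
    rw [hφτ, hSπ, hDπ, hq₁, hp₁]; simp
  have hT : T = anglePeriod u₁ u₂ u₃ (2 + a) := hc.period_eq hcc h0
  have hsh := hc.shift_eq hcc h0
  obtain ⟨b1, b2⟩ := hu.stepCos_bounds ha₂
  have hθ0 : 0 < Real.arccos (stepCos a u₂ u₃) := Real.arccos_pos.2 b2
  have hθ1 := Real.arccos_le_pi (stepCos a u₂ u₃)
  have hstep : φ (τ + angleStep a u₁ u₂ u₃) = Real.pi + Real.arccos (stepCos a u₂ u₃) := by
    rw [hτ, angleStep, intervalIntegral.integral_add_adjacent_intervals (hii _ _) (hii _ _), hφ2]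
  refine ⟨?_, hT, ?_, ?_, fun t => ?_⟩
  · rw [hc.canonicalAction_eq hcc h0, hact, hA.integral_action (s := fun x =>
      (u₃ - u₂) / 2 * Real.sin x), angleAction]
    · rw [show (1:ℝ) / (2 * Real.pi) = 1 / (4 * Real.pi) * 2 by field_simp; norm_num, mul_assoc,
        ← intervalIntegral.integral_const_mul]
      congr 2
      ext x
      ring
    · intro x
      refine (hasDerivAt_angleS (s₂ := u₂) (s₃ := u₃) x).congr_of_eventuallyEq
        (Eventually.of_forall fun y => ?_)
      ring
  · exact intervalIntegral.intervalIntegral_pos_of_pos (hii _ _) hipos (by linarith)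
  · have e1 : 0 < ∫ x in (0:ℝ)..Real.pi, 1 / angleω u₁ u₂ u₃ (2 + a) x :=
      intervalIntegral.intervalIntegral_pos_of_pos (hii _ _) hipos Real.pi_pos
    have e2 : 0 ≤ ∫ x in (Real.pi + Real.arccos (stepCos a u₂ u₃))..2 * Real.pi,
        1 / angleω u₁ u₂ u₃ (2 + a) x :=
      intervalIntegral.integral_nonneg (by linarith) fun x _ => (hipos x).le
    have e3 := intervalIntegral.integral_add_adjacent_intervals (hii 0 Real.pi)
      (hii Real.pi (Real.pi + Real.arccos (stepCos a u₂ u₃)))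
    have e4 := intervalIntegral.integral_add_adjacent_intervals
      (hii 0 (Real.pi + Real.arccos (stepCos a u₂ u₃))) (hii _ (2 * Real.pi))
    rw [hT, angleStep, anglePeriod]
    linarith
  · -- both sides are orbits through the image of the point of the angle `π`
    have hmap := hcc.orbit.map (fun t => hne (φ t))
    have hb : Bornology.IsBounded (Set.range fun t =>
        sextMap a ((angleS u₂ u₃ (φ t) - angleD u₁ u₂ u₃ (2 + a) (φ t)) / 2,
          (angleS u₂ u₃ (φ t) + angleD u₁ u₂ u₃ (2 + a) (φ t)) / 2)) := by
      refine Function.Periodic.isBounded_of_continuous (c := anglePeriod u₁ u₂ u₃ (2 + a))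
        (fun t => ?_) hcc.period_pos.ne' (hmap.continuous_left.prodMk hmap.continuous_right)
      have := hcc.periodic t
      simp only [anglePeriod, this.1, this.2]
    have key := hmap.eq_of_bounded (hcc.orbit.comp_add (angleStep a u₁ u₂ u₃)) hb
      (hcc.isBounded.subset (by rintro _ ⟨t, rfl⟩; exact ⟨_, rfl⟩)) (t₀ := τ) (by
        have e := hu.sextMap_angle ha₂
        rw [sextMap] at e
        simp only [hstep, ← e]
        rw [hφτ, hSπ, hDπ]
        simp) (t + (τ - t₁))
    rw [(hsh t).1, (hsh t).2, (hsh (t + _)).1, (hsh (t + _)).2]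
    rw [sextMap, show t + angleStep a u₁ u₂ u₃ + (τ - t₁) = t + (τ - t₁) + angleStep a u₁ u₂ u₃ by
        ring]
    exact key

end SextRoots

/-! ### The action as an integral between the roots -/

theorem integral_two_pi_eq {f : ℝ → ℝ} (hf : Continuous f) (hs : ∀ x, f (2 * Real.pi - x) = f x) :
    ∫ x in (0:ℝ)..2 * Real.pi, f x = 2 * ∫ x in (0:ℝ)..Real.pi, f x := by
  have h1 := intervalIntegral.integral_comp_sub_left f (2 * Real.pi) (a := 0) (b := Real.pi)
  simp only [hs, sub_zero] at h1
  rw [show 2 * Real.pi - Real.pi = Real.pi by ring] at h1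
  rw [← intervalIntegral.integral_add_adjacent_intervals (hf.intervalIntegrable 0 Real.pi)
    (hf.intervalIntegrable _ _), ← h1]
  ring

theorem integral_angleS {s₂ s₃ : ℝ} (h : s₂ < s₃) {f : ℝ → ℝ} (hf : ContinuousOn f (Set.Icc s₂ s₃))
    (u v : ℝ) : ∫ x in u..v, f (angleS s₂ s₃ x) * ((s₃ - s₂) / 2 * Real.sin x) =
      ∫ y in angleS s₂ s₃ u..angleS s₂ s₃ v, f y :=
  intervalIntegral.integral_comp_mul_deriv' (fun x _ => hasDerivAt_angleS x)
    (by fun_prop) (hf.mono (by rintro _ ⟨x, -, rfl⟩; exact angleS_mem h x))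

theorem angleS_zero {s₂ s₃ : ℝ} : angleS s₂ s₃ 0 = s₂ := by rw [angleS, Real.cos_zero]; ring

theorem angleS_pi {s₂ s₃ : ℝ} : angleS s₂ s₃ Real.pi = s₃ := by rw [angleS, Real.cos_pi]; ring

theorem angleS_reflect {s₂ s₃ : ℝ} (x : ℝ) :
    angleS s₂ s₃ (2 * Real.pi - x) = angleS s₂ s₃ x := by
  rw [angleS, Real.cos_two_pi_sub, angleS]

theorem angleω_reflect {s₁ s₂ s₃ s₄ : ℝ} (x : ℝ) :
    angleω s₁ s₂ s₃ s₄ (2 * Real.pi - x) = angleω s₁ s₂ s₃ s₄ x := by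
  rw [angleω, angleS_reflect, angleω]

theorem angleAction_eq_half {s₁ s₂ s₃ s₄ : ℝ} (h12 : s₁ < s₂) (h23 : s₂ < s₃) (h34 : s₃ < s₄) :
    angleAction s₁ s₂ s₃ s₄ = 1 / (2 * Real.pi) * ∫ x in (0:ℝ)..Real.pi,
      angleD s₁ s₂ s₃ s₄ x * ((s₃ - s₂) / 2 * Real.sin x) := by
  have c : Continuous fun x => angleD s₁ s₂ s₃ s₄ x * ((s₃ - s₂) / 2 * Real.sin x) :=
    (continuous_iff_continuousAt.2 fun x => (hasDerivAt_angleD h12 h23 h34 x).continuousAt).mul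
      (by fun_prop)
  rw [angleAction, integral_two_pi_eq c fun x => ?_]
  · rw [← mul_assoc]
    congr 1
    field_simp
    norm_num
  · simp only [angleD, angleω_reflect, angleS_reflect, Real.sin_two_pi_sub]
    ring

theorem angleAction_eq_integral {s₁ s₂ s₃ s₄ : ℝ} (h12 : s₁ < s₂) (h23 : s₂ < s₃) (h34 : s₃ < s₄) :
    angleAction s₁ s₂ s₃ s₄ = 1 / (2 * Real.pi) * ∫ y in s₂..s₃,
      Real.sqrt ((y - s₁) * (y - s₂) * (s₃ - y) / (s₄ - y)) := by
  rw [angleAction_eq_half h12 h23 h34]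
  have hf : ContinuousOn (fun y => Real.sqrt ((y - s₁) * (y - s₂) * (s₃ - y) / (s₄ - y)))
      (Set.Icc s₂ s₃) := by
    refine (ContinuousOn.div (by fun_prop) (by fun_prop) fun y hy => ?_).sqrt
    have := hy.2
    exact (by linarith : 0 < s₄ - y).ne'
  have := integral_angleS h23 hf 0 Real.pi
  rw [angleS_zero, angleS_pi] at this
  rw [← this]
  congr 1
  refine intervalIntegral.integral_congr fun x hx => ?_
  rw [Set.uIcc_of_le Real.pi_pos.le] at hx
  have hsin := Real.sin_nonneg_of_mem_Icc hx
  have hp := (angle_pos h12 h23 h34 x).2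
  have hD : 0 ≤ angleD s₁ s₂ s₃ s₄ x :=
    div_nonneg (mul_nonneg (mul_nonneg (by linarith) hsin) (angleω_pos h12 h23 h34 x).le) hp.le
  rw [← angleD_sq h12 h23 h34, mul_div_assoc, div_self hp.ne', mul_one, Real.sqrt_sq hD]

/-! ### The roots of the quartic polynomial -/

/-- Sign changes: 𝒫 is nonnegative at −1, positive at 0 and far to the right, and negative somewhere
in (−1, 0) and in (0, ∞). Since 𝒫(−1) = (1 + a)², the root q₁ may equal −1 when a = −1, which is why
−1 ≤ q₁ is not strict. -/
theorem exists_quartic_roots {a E : ℝ} (ha₁ : -2 < a) (ha₂ : a < 2) (hE : 0 < E)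
    (hE' : E < sextSep a) : ∃ q₁ q₂ q₃ q₄ : ℝ, -1 ≤ q₁ ∧ q₁ < q₂ ∧ q₂ < q₃ ∧ q₃ < q₄ ∧
      q₁ + q₂ + q₃ + q₄ = 2 * (2 + a) ∧
      q₁ * q₂ + q₁ * q₃ + q₁ * q₄ + q₂ * q₃ + q₂ * q₄ + q₃ * q₄ = a ^ 2 - 4 ∧
      q₁ * q₂ * q₃ + q₁ * q₂ * q₄ + q₁ * q₃ * q₄ + q₂ * q₃ * q₄ = -(4 * E) ∧
      q₁ * q₂ * q₃ * q₄ = 4 * E := by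
  have hσ : 0 < 2 + a := by linarith
  have hE1 : E < (2 - a) ^ 3 / 27 := hE'.trans_le (min_le_left _ _)
  have hE2 : E < (2 + a) ^ 2 := hE'.trans_le (min_le_right _ _)
  have hc : Continuous (sextP a E) := by unfold sextP; fun_prop
  -- A square minus a positive multiple of x + 1: 𝒫 is negative at every zero of the square to the
  -- right of −1.
  have hsq : ∀ x, sextP a E x = (x ^ 2 - (2 + a) * x - 2 * (2 + a)) ^ 2 -
      4 * ((2 + a) ^ 2 - E) * (x + 1) := fun x => by rw [sextP]; ring
  have hm1 : 0 ≤ sextP a E (-1) := by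
    rw [show sextP a E (-1) = (1 + a) ^ 2 by rw [sextP]; ring]; positivity
  have h0 : 0 < sextP a E 0 := by rw [sextP]; linarith
  -- the roots of the square in `hsq`
  set w := Real.sqrt ((2 + a) * (10 + a)) with hw
  have hw2 : w ^ 2 = (2 + a) * (10 + a) := Real.sq_sqrt (by nlinarith)
  have hwσ : 2 + a < w := Real.lt_sqrt_of_sq_lt (by nlinarith)
  have hneg : ∀ x, x ^ 2 - (2 + a) * x - 2 * (2 + a) = 0 → -1 < x → sextP a E x < 0 := by
    intro x hx hx1
    rw [hsq, hx]
    nlinarith [mul_pos (sub_pos.2 hE2) (show 0 < x + 1 by linarith)]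
  have hp : sextP a E ((2 + a + w) / 2) < 0 :=
    hneg _ (by linear_combination hw2 / 4) (by linarith)
  -- For a < −1 the smaller zero of the square works. For a = −1 that zero is −1 itself and a small
  -- step to the right is taken. For a > −1 the point is the coordinate (a − 2)/3 of a critical
  -- point of the invariant.
  obtain ⟨x₀, hx1, hx0, hxn⟩ : ∃ x, -1 < x ∧ x < 0 ∧ sextP a E x < 0 := by
    rcases lt_trichotomy a (-1) with h1 | h1 | h1
    · have : w < 4 + a := by
        rw [hw, Real.sqrt_lt' (by linarith)]; nlinarith
      exact ⟨(2 + a - w) / 2, by linarith, by linarith,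
        hneg _ (by linear_combination hw2 / 4) (by linarith)⟩
    · subst h1
      have hE3 : E < 1 := by linarith
      refine ⟨-1 + (1 - E) / 3, by linarith, by linarith, ?_⟩
      have e : sextP (-1) E (-1 + (1 - E) / 3) = -((1 - E) / 3) ^ 2 *
          (3 + 6 * ((1 - E) / 3) - ((1 - E) / 3) ^ 2) := by rw [sextP]; ring
      rw [e]
      have : 0 < (1 - E) / 3 := by linarith
      have h2 : 0 < 3 + 6 * ((1 - E) / 3) - ((1 - E) / 3) ^ 2 := by nlinarith
      have := mul_pos (pow_pos this 2) h2
      linarith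
    · refine ⟨(a - 2) / 3, by linarith, by linarith, ?_⟩
      rw [show sextP a E ((a - 2) / 3) = 4 / 3 * ((1 + a) * (E - (2 - a) ^ 3 / 27)) by
        rw [sextP]; ring]
      have := mul_pos (show 0 < 1 + a by linarith) (sub_pos.2 hE1)
      nlinarith
  have hxp : 0 < (2 + a + w) / 2 := by linarith
  have hbig : ∃ x, (2 + a + w) / 2 < x ∧ 0 < sextP a E x := by
    refine ⟨2 * (2 + a) + 2 + (2 + a + w) / 2, by linarith, ?_⟩
    have hy : 2 * (2 + a) + 2 < 2 * (2 + a) + 2 + (2 + a + w) / 2 := by linarith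
    generalize 2 * (2 + a) + 2 + (2 + a + w) / 2 = y at hy
    have e : sextP a E y = y ^ 2 * (y * (y - 2 * (2 + a)) + (2 + a) * (a - 2)) + 4 * E * (y + 1) :=
        by
      rw [sextP]; ring
    rw [e]
    have h3 : 0 < y := by linarith
    have h4 : 0 < y * (y - 2 * (2 + a)) + (2 + a) * (a - 2) := by nlinarith
    positivity
  obtain ⟨x₁, hxx, hx1p⟩ := hbig
  obtain ⟨q₁, ⟨hq1, hq1'⟩, e1⟩ := intermediate_value_Ico' hx1.le hc.continuousOn ⟨hxn, hm1⟩
  obtain ⟨q₂, ⟨hq2, hq2'⟩, e2⟩ := intermediate_value_Ioo hx0.le hc.continuousOn ⟨hxn, h0⟩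
  obtain ⟨q₃, ⟨hq3, hq3'⟩, e3⟩ := intermediate_value_Ioo' hxp.le hc.continuousOn ⟨hp, h0⟩
  obtain ⟨q₄, ⟨hq4, hq4'⟩, e4⟩ := intermediate_value_Ioo hxx.le hc.continuousOn ⟨hp, hx1p⟩
  have h12 : q₁ < q₂ := hq1'.trans hq2
  have h23 : q₂ < q₃ := hq2'.trans hq3
  have h34 : q₃ < q₄ := hq3'.trans hq4
  refine ⟨q₁, q₂, q₃, q₄, hq1, h12, h23, h34, ?_⟩
  rw [sextP] at e1 e2 e3 e4
  -- divided differences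
  have d12 : q₁ ^ 3 + q₁ ^ 2 * q₂ + q₁ * q₂ ^ 2 + q₂ ^ 3 - 2 * (2 + a) * (q₁ ^ 2 + q₁ * q₂ + q₂ ^ 2)
      + (a ^ 2 - 4) * (q₁ + q₂) + 4 * E = 0 :=
    (mul_eq_zero.1 (show (q₂ - q₁) * _ = 0 by linear_combination e2 - e1)).resolve_left
      (sub_pos.2 h12).ne'
  have d13 : q₁ ^ 3 + q₁ ^ 2 * q₃ + q₁ * q₃ ^ 2 + q₃ ^ 3 - 2 * (2 + a) * (q₁ ^ 2 + q₁ * q₃ + q₃ ^ 2)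
      + (a ^ 2 - 4) * (q₁ + q₃) + 4 * E = 0 :=
    (mul_eq_zero.1 (show (q₃ - q₁) * _ = 0 by linear_combination e3 - e1)).resolve_left
      (sub_pos.2 (h12.trans h23)).ne'
  have d14 : q₁ ^ 3 + q₁ ^ 2 * q₄ + q₁ * q₄ ^ 2 + q₄ ^ 3 - 2 * (2 + a) * (q₁ ^ 2 + q₁ * q₄ + q₄ ^ 2)
      + (a ^ 2 - 4) * (q₁ + q₄) + 4 * E = 0 :=
    (mul_eq_zero.1 (show (q₄ - q₁) * _ = 0 by linear_combination e4 - e1)).resolve_left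
      (sub_pos.2 (h12.trans (h23.trans h34))).ne'
  have d123 : q₁ ^ 2 + q₂ ^ 2 + q₃ ^ 2 + q₁ * q₂ + q₁ * q₃ + q₂ * q₃
      - 2 * (2 + a) * (q₁ + q₂ + q₃) + (a ^ 2 - 4) = 0 :=
    (mul_eq_zero.1 (show (q₃ - q₂) * _ = 0 by linear_combination d13 - d12)).resolve_left
      (sub_pos.2 h23).ne'
  have d124 : q₁ ^ 2 + q₂ ^ 2 + q₄ ^ 2 + q₁ * q₂ + q₁ * q₄ + q₂ * q₄
      - 2 * (2 + a) * (q₁ + q₂ + q₄) + (a ^ 2 - 4) = 0 :=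
    (mul_eq_zero.1 (show (q₄ - q₂) * _ = 0 by linear_combination d14 - d12)).resolve_left
      (sub_pos.2 (h23.trans h34)).ne'
  have s1 : q₁ + q₂ + q₃ + q₄ - 2 * (2 + a) = 0 :=
    (mul_eq_zero.1 (show (q₄ - q₃) * _ = 0 by linear_combination d124 - d123)).resolve_left
      (sub_pos.2 h34).ne'
  have s2 : q₁ * q₂ + q₁ * q₃ + q₁ * q₄ + q₂ * q₃ + q₂ * q₄ + q₃ * q₄ = a ^ 2 - 4 := by
    linear_combination (q₁ + q₂ + q₃) * s1 - d123
  have s3 : q₁ * q₂ * q₃ + q₁ * q₂ * q₄ + q₁ * q₃ * q₄ + q₂ * q₃ * q₄ = -(4 * E) := by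
    linear_combination d12 + (q₁ + q₂) * s2 - (q₁ ^ 2 + q₁ * q₂ + q₂ ^ 2) * s1
  have s4 : q₁ * q₂ * q₃ * q₄ = 4 * E := by
    linear_combination e1 * (-1) + q₁ * s3 - q₁ ^ 2 * s2 + q₁ ^ 3 * s1
  exact ⟨by linarith, s2, s3, s4⟩

/-- The upper and lower halves of the curve over the coordinate `q`, `σ = ∂H/∂p` being
`± √𝒫(q)`. -/
theorem isSextAngleCurve_quartic {a E q₁ q₂ q₃ q₄ : ℝ} (h1 : -1 ≤ q₁) (h12 : q₁ < q₂) (h23 : q₂ <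
      q₃)
    (h34 : q₃ < q₄) (hP : ∀ x, sextP a E x = (x - q₁) * (x - q₂) * (x - q₃) * (x - q₄)) :
    IsSextAngleCurve a E (angleω q₁ q₂ q₃ q₄) (angleS q₂ q₃)
      (fun x => (-(angleS q₂ q₃ x ^ 2 - a * angleS q₂ q₃ x) +
        (q₃ - q₂) / 2 * Real.sin x * angleω q₁ q₂ q₃ q₄ x) / (2 * (angleS q₂ q₃ x + 1))) := by
  have hpos : ∀ x, 0 < angleS q₂ q₃ x + 1 := fun x => by linarith [(angleS_mem h23 x).1]
  have hω := angleω_pos h12 h23 h34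
  have hω2 := angleω_sq h12 h23 h34
  have hσ2 : ∀ x, ((q₃ - q₂) / 2 * Real.sin x * angleω q₁ q₂ q₃ q₄ x) ^ 2 =
      sextP a E (angleS q₂ q₃ x) := fun x => by
    rw [mul_pow, hω2, ← angleS_mul, hP]; ring
  have hS := hasDerivAt_angleS (s₂ := q₂) (s₃ := q₃)
  -- Two forms of the derivative of 𝒫, from its coefficients and from its factors.
  have hP' : ∀ x, 4 * x ^ 3 - 6 * (2 + a) * x ^ 2 + 2 * (a ^ 2 - 4) * x + 4 * E =
      (x - q₂) * (x - q₃) * (2 * x - q₁ - q₄) + (x - q₁) * (x - q₄) * (2 * x - q₂ - q₃) := fun x =>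
      by
    have d1 : HasDerivAt (sextP a E)
        (4 * x ^ 3 - 6 * (2 + a) * x ^ 2 + 2 * (a ^ 2 - 4) * x + 4 * E) x := by
      have := ((((hasDerivAt_id x).pow 4).sub (((hasDerivAt_id x).pow 3).const_mul (2 * (2 +
      a)))).add
        (((hasDerivAt_id x).pow 2).const_mul (a ^ 2 - 4))).add
        ((hasDerivAt_id x).const_mul (4 * E)) |>.add_const (4 * E)
      refine HasDerivAt.congr_deriv this ?_
      simp only [id]
      push_cast
      ring
    have d2 : HasDerivAt (sextP a E) ((x - q₂) * (x - q₃) * (2 * x - q₁ - q₄) +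
        (x - q₁) * (x - q₄) * (2 * x - q₂ - q₃)) x := by
      rw [funext hP]
      have := ((((hasDerivAt_id x).sub_const q₁).mul ((hasDerivAt_id x).sub_const q₂)).mul
        ((hasDerivAt_id x).sub_const q₃)).mul ((hasDerivAt_id x).sub_const q₄)
      refine HasDerivAt.congr_deriv this ?_
      simp only [id, Pi.mul_apply]
      ring
    exact d1.unique d2
  have hσ : ∀ x, HasDerivAt (fun x => (q₃ - q₂) / 2 * Real.sin x * angleω q₁ q₂ q₃ q₄ x)
      ((4 * angleS q₂ q₃ x ^ 3 - 6 * (2 + a) * angleS q₂ q₃ x ^ 2 + 2 * (a ^ 2 - 4) * angleS q₂ q₃ x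
      +
        4 * E) / (2 * angleω q₁ q₂ q₃ q₄ x)) x := fun x => by
    refine HasDerivAt.congr_deriv (((Real.hasDerivAt_sin x).const_mul ((q₃ - q₂) / 2)).mul
      (hasDerivAt_angleω h12 h23 h34 x)) ?_
    have hc : (q₃ - q₂) / 2 * Real.cos x = (q₂ + q₃) / 2 - angleS q₂ q₃ x := by rw [angleS]; ring
    have hm := angleS_mul (s₂ := q₂) (s₃ := q₃) x
    have h2 := hω2 x
    rw [hc, hP']
    generalize (q₃ - q₂) / 2 * Real.sin x = R at *
    have hw := (hω x).ne'
    generalize angleω q₁ q₂ q₃ q₄ x = w at *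
    generalize angleS q₂ q₃ x = S at *
    field_simp
    rw [h2]
    linear_combination (2 * S - q₁ - q₄) * hm
  refine ⟨continuous_angleω, hω, angleω_periodic, fun x => ?_, fun x => ?_, fun x => ?_, fun x =>
      ?_,
    fun x => ?_, fun x hx hx' he => ?_⟩
  · refine (hS x).congr_deriv ?_
    have h0 := (hpos x).ne'
    have hw := (hω x).ne'
    field_simp
    ring
  · have h0 := (hpos x).ne'
    refine HasDerivAt.congr_deriv (((((hS x).pow 2).sub ((hS x).const_mul a)).neg.add (hσ x)).div
      (((hS x).add_const 1).const_mul 2) (mul_ne_zero two_ne_zero h0)) ?_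
    have h2 := hσ2 x
    rw [sextP] at h2
    have hw := (hω x).ne'
    simp only [Pi.add_apply, Pi.sub_apply, Pi.neg_apply, Pi.pow_apply]
    generalize (q₃ - q₂) / 2 * Real.sin x = R at *
    generalize angleω q₁ q₂ q₃ q₄ x = w at *
    generalize angleS q₂ q₃ x = S at *
    field_simp
    push_cast
    linear_combination -h2
  · have h0 := (hpos x).ne'
    have h2 := hσ2 x
    rw [sextP] at h2
    rw [sextInv]
    generalize (q₃ - q₂) / 2 * Real.sin x * angleω q₁ q₂ q₃ q₄ x = R at *
    generalize angleS q₂ q₃ x = S at *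
    field_simp
    linear_combination (S + 1) * h2
  · exact angleS_periodic x
  · simp only [angleS_periodic, angleω_periodic, Real.sin_add_two_pi]
  · rw [Prod.mk.injEq] at he
    have := he.1
    rw [angleS, angleS, Real.cos_zero] at this
    have hc : Real.cos x = 1 := by nlinarith
    rw [Real.cos_eq_one_iff_of_lt_of_lt (by linarith [Real.pi_pos]) hx'] at hc
    linarith

/-- On the two halves of the curve p = (−(q² − aq) ± √𝒫)/(2(q + 1)). In ∮ p dq the first summand
depends on q alone and integrates to zero; the second contributes equally on both halves. -/
theorem integral_quartic_action {a E q₁ q₂ q₃ q₄ : ℝ} (h1 : -1 ≤ q₁) (h12 : q₁ < q₂) (h23 : q₂ < q₃)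
    (h34 : q₃ < q₄) (hP : ∀ x, sextP a E x = (x - q₁) * (x - q₂) * (x - q₃) * (x - q₄)) :
    ∃ q p T, IsSextClosedCurve a E q p T ∧ canonicalAction q p T =
      1 / (2 * Real.pi) * ∫ x in q₂..q₃, Real.sqrt (sextP a E x) / (x + 1) := by
  have hA := isSextAngleCurve_quartic h1 h12 h23 h34 hP
  obtain ⟨φ, -, -, hcc, hact⟩ := hA.exists_closedCurve
  refine ⟨_, _, _, hcc, ?_⟩
  rw [hact]
  congr 1
  have hpos : ∀ x, 0 < angleS q₂ q₃ x + 1 := fun x => by linarith [(angleS_mem h23 x).1]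
  have hω := angleω_pos h12 h23 h34
  have hω2 := angleω_sq h12 h23 h34
  have hcS := continuous_angleS (s₂ := q₂) (s₃ := q₃)
  have hcω := continuous_angleω (s₁ := q₁) (s₂ := q₂) (s₃ := q₃) (s₄ := q₄)
  set f : ℝ → ℝ := fun y => -(y ^ 2 - a * y) / (2 * (y + 1)) with hf
  set g : ℝ → ℝ := fun x => ((q₃ - q₂) / 2 * Real.sin x) ^ 2 * angleω q₁ q₂ q₃ q₄ x /
    (2 * (angleS q₂ q₃ x + 1)) with hg
  have cf : ContinuousOn f (Set.Icc q₂ q₃) := ContinuousOn.div (by fun_prop) (by fun_prop)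
    fun y hy => by have := hy.1; exact (by linarith : 0 < 2 * (y + 1)).ne'
  have cg : Continuous g := Continuous.div (by fun_prop) (by fun_prop)
    fun x => (mul_pos two_pos (hpos x)).ne'
  have cfS : Continuous fun x => f (angleS q₂ q₃ x) * ((q₃ - q₂) / 2 * Real.sin x) :=
    (cf.comp_continuous hcS (angleS_mem h23)).mul (by fun_prop)
  have e1 : ∫ x in (0:ℝ)..2 * Real.pi, f (angleS q₂ q₃ x) * ((q₃ - q₂) / 2 * Real.sin x) = 0 := by
    rw [integral_angleS h23 cf]
    have := angleS_periodic (s₂ := q₂) (s₃ := q₃) 0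
    rw [zero_add] at this
    rw [this, intervalIntegral.integral_same]
  have e2 : ∫ x in (0:ℝ)..2 * Real.pi, g x = 2 * ∫ x in (0:ℝ)..Real.pi, g x :=
    integral_two_pi_eq cg fun x => by
      simp only [hg, angleω_reflect, angleS_reflect, Real.sin_two_pi_sub]; ring
  have cF : ContinuousOn (fun x => Real.sqrt (sextP a E x) / (x + 1)) (Set.Icc q₂ q₃) := by
    unfold sextP
    exact ContinuousOn.div (by fun_prop) (by fun_prop)
      fun y hy => by have := hy.1; exact (by linarith : 0 < y + 1).ne'
  have e3 := integral_angleS h23 cF 0 Real.pi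
  rw [angleS_zero, angleS_pi] at e3
  rw [← e3]
  calc _ = ∫ x in (0:ℝ)..2 * Real.pi,
        (f (angleS q₂ q₃ x) * ((q₃ - q₂) / 2 * Real.sin x) + g x) := by
        refine intervalIntegral.integral_congr fun x _ => ?_
        have h0 := (hpos x).ne'
        have hw := (hω x).ne'
        simp only [hf, hg]
        field_simp
        ring
    _ = 2 * ∫ x in (0:ℝ)..Real.pi, g x := by
        rw [intervalIntegral.integral_add (cfS.intervalIntegrable _ _) (cg.intervalIntegrable _ _),
          e1, zero_add, e2]
    _ = _ := by
        rw [← intervalIntegral.integral_const_mul]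
        refine intervalIntegral.integral_congr fun x hx => ?_
        rw [Set.uIcc_of_le Real.pi_pos.le] at hx
        have hsin := Real.sin_nonneg_of_mem_Icc hx
        have hsq : Real.sqrt (sextP a E (angleS q₂ q₃ x)) =
            (q₃ - q₂) / 2 * Real.sin x * angleω q₁ q₂ q₃ q₄ x := by
          rw [← Real.sqrt_sq (mul_nonneg (mul_nonneg (by linarith) hsin) (hω x).le), mul_pow, hω2,
            ← angleS_mul, hP]
          congr 1
          ring
        simp only [hg]
        rw [hsq]
        have h0 := (hpos x).ne'
        field_simp

/-! ### Reduction to complete elliptic integrals -/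

/-- The substitution which maps `[0, π / 2]` to the interval between the second and third root. -/
def legendreSub (x₁ x₂ x₃ θ : ℝ) : ℝ :=
  x₁ + (x₂ - x₁) / (1 - (x₃ - x₂) / (x₃ - x₁) * Real.sin θ ^ 2)

/-- Put R = (x − x₂)(x − x₃)(x − x₄) and W = √((x − x₁)R). The left side is W times the derivative
of c₂W + c₁W/(x − x₁), written in S = sin²θ; the right side has the form in which the derivative of
the primitive Φ of `integral_legendre` appears. -/
theorem legendre_identity {α β δ S c₁ c₂ : ℝ} (hα : 0 < α) (hβ : 0 < β) (hδ : 0 < δ)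
    (hS : 0 < 1 - β / (α + β) * S) {n K k2 w R R' : ℝ} (hn : n = β / (α + β))
    (hk : k2 = β * (α + δ) / ((α + β) * δ)) (hw : w = 1 - n * S) (hK : K = 1 - k2 * S)
    (hR : R = n * S * α / w * (-(β * (1 - S) / w)) * (-(δ * K / w)))
    (hR' : R' = -(β * (1 - S) / w) * (-(δ * K / w)) + n * S * α / w * (-(δ * K / w)) +
      n * S * α / w * (-(β * (1 - S) / w))) :
    c₂ / 2 * (R + α / w * R') + c₁ / 2 * (R' - R / (α / w)) =
      c₂ * α * β * δ / 2 * (((1 - 2 * S) * K - k2 * S * (1 - S)) / w ^ 2 +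
        4 * n * S * (1 - S) * K / w ^ 3) +
      c₁ * β * δ / 2 * (((1 - 2 * S) * K - k2 * S * (1 - S)) / w +
        2 * n * S * (1 - S) * K / w ^ 2) := by
  have hw0 : w ≠ 0 := by rw [hw, hn]; exact hS.ne'
  have e1 : n * α = β * (1 - n) := by rw [hn]; field_simp; ring
  have e2 : n * α = δ * (k2 - n) := by rw [hk, hn]; field_simp; ring
  have key : R' = β * δ *
      (((1 - 2 * S) * K - k2 * S * (1 - S)) / w + 3 * n * S * (1 - S) * K / w ^ 2) := by
    have h1 : R' = ((1 - S) * K * β * δ - S * K * δ * (n * α) - S * (1 - S) * β * (n * α)) / w ^ 2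
        := by
      rw [hR']; field_simp; ring
    rw [h1]
    nth_rw 1 [e1]
    rw [e2]
    field_simp
    rw [hw, hK]
    ring
  rw [hR, key]
  field_simp
  ring

/-- The substitution turns dx/√(quartic) into 2/√((x₃ − x₁)(x₄ − x₂)) · dθ/Δ with Δ² = 1 − κ² sin²θ.
It turns (x₄ − x)/(x − x₁) into a multiple of Δ², and x − x₁ and (x − x₁)/(x − e) into multiples of
1/(1 − n sin²θ), each with its own n. The terms in c₁ and c₂ are an exact derivative whose primitive
vanishes at both ends. -/
theorem integral_legendre {x₁ x₂ x₃ x₄ e A B C D c₁ c₂ : ℝ} (h12 : x₁ < x₂) (h23 : x₂ < x₃)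
    (h34 : x₃ < x₄) (he : e < x₂) {g : ℝ → ℝ} (hgc : ContinuousOn g (Set.Icc x₂ x₃))
    (hg : ∀ x ∈ Set.Icc x₂ x₃, g x * Real.sqrt ((x - x₁) * (x - x₂) * (x - x₃) * (x - x₄)) =
      A + B * ((x₄ - x) / (x - x₁)) + C * (x - x₁) + D * ((x - x₁) / (x - e)) +
      c₂ / 2 * ((x - x₂) * (x - x₃) * (x - x₄) + (x - x₁) *
        ((x - x₃) * (x - x₄) + (x - x₂) * (x - x₄) + (x - x₂) * (x - x₃))) +
      c₁ / 2 * (((x - x₃) * (x - x₄) + (x - x₂) * (x - x₄) + (x - x₂) * (x - x₃)) -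
        (x - x₂) * (x - x₃) * (x - x₄) / (x - x₁))) :
    ∫ x in x₂..x₃, g x = 2 / Real.sqrt ((x₃ - x₁) * (x₄ - x₂)) *
      (A * ellipticK (rootModulus x₁ x₂ x₃ x₄) +
        B * ((x₄ - x₂) / (x₂ - x₁)) * ellipticE (rootModulus x₁ x₂ x₃ x₄) +
        C * (x₂ - x₁) * ellipticPi ((x₃ - x₂) / (x₃ - x₁)) (rootModulus x₁ x₂ x₃ x₄) +
        D * ((x₂ - x₁) / (x₂ - e)) * ellipticPi ((x₁ - e) / (x₂ - e) * ((x₃ - x₂) / (x₃ - x₁)))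
          (rootModulus x₁ x₂ x₃ x₄)) := by
  obtain ⟨α, hα⟩ : ∃ α, α = x₂ - x₁ := ⟨_, rfl⟩
  obtain ⟨β, hβ⟩ : ∃ β, β = x₃ - x₂ := ⟨_, rfl⟩
  obtain ⟨δ, hδ⟩ : ∃ δ, δ = x₄ - x₂ := ⟨_, rfl⟩
  obtain ⟨ε, hε⟩ : ∃ ε, ε = x₂ - e := ⟨_, rfl⟩
  have α0 : 0 < α := by linarith
  have β0 : 0 < β := by linarith
  have δ0 : β < δ := by linarith
  have δ00 : 0 < δ := by linarith
  have ε0 : 0 < ε := by linarith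
  have h31 : x₃ - x₁ = α + β := by linarith
  have h41 : x₄ - x₁ = α + δ := by linarith
  obtain ⟨n, hn⟩ : ∃ n, n = β / (α + β) := ⟨_, rfl⟩
  obtain ⟨k2, hk2⟩ : ∃ k2, k2 = β * (α + δ) / ((α + β) * δ) := ⟨_, rfl⟩
  obtain ⟨n2, hn2⟩ : ∃ n2, n2 = (x₁ - e) / ε * n := ⟨_, rfl⟩
  have hn0 : 0 < n := by rw [hn]; positivity
  have hn1 : n < 1 := by rw [hn, div_lt_one (by positivity)]; linarith
  have hk0 : 0 < k2 := by rw [hk2]; positivity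
  have hk1 : k2 < 1 := by
    rw [hk2, div_lt_one (by positivity)]; nlinarith
  have hkk : rootModulus x₁ x₂ x₃ x₄ ^ 2 = k2 := by
    rw [rootModulus, ← hβ, ← hδ, h31, h41, ← hk2, Real.sq_sqrt hk0.le]
  have hsin : ∀ θ : ℝ, 0 ≤ Real.sin θ ^ 2 ∧ Real.sin θ ^ 2 ≤ 1 :=
    fun θ => ⟨sq_nonneg _, Real.sin_sq_le_one θ⟩
  have hw : ∀ θ : ℝ, 0 < 1 - n * Real.sin θ ^ 2 := fun θ => by nlinarith [hsin θ]
  have hK : ∀ θ : ℝ, 0 < 1 - k2 * Real.sin θ ^ 2 := fun θ => by nlinarith [hsin θ]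
  -- Only e < x₂ is assumed, so n2 may be negative; this rewriting shows positivity wherever e lies
  -- relative to x₁.
  have hN : ∀ θ : ℝ, 0 < 1 - n2 * Real.sin θ ^ 2 := fun θ => by
    have h1 : ε * (1 - n2 * Real.sin θ ^ 2) =
        ε * (1 - n * Real.sin θ ^ 2) + n * α * Real.sin θ ^ 2 := by
      rw [hn2, show x₁ - e = ε - α by linarith]; field_simp; ring
    have h2 : 0 < ε * (1 - n2 * Real.sin θ ^ 2) := by
      rw [h1]
      have := mul_pos ε0 (hw θ)
      have : 0 ≤ n * α * Real.sin θ ^ 2 := by positivity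
      linarith
    exact (pos_iff_pos_of_mul_pos h2).1 ε0
  set X := legendreSub x₁ x₂ x₃ with hX
  have hX1 : ∀ θ, X θ - x₁ = α / (1 - n * Real.sin θ ^ 2) := fun θ => by
    simp only [hX, legendreSub]; rw [h31, ← hβ, ← hα, ← hn]; ring
  have hX2 : ∀ θ, X θ - x₂ = n * Real.sin θ ^ 2 * α / (1 - n * Real.sin θ ^ 2) := fun θ => by
    have := (hw θ).ne'
    rw [show X θ - x₂ = X θ - x₁ - α by rw [hα]; ring, hX1]
    field_simp
    ring
  have hX3 : ∀ θ, X θ - x₃ = -(β * (1 - Real.sin θ ^ 2) / (1 - n * Real.sin θ ^ 2)) := fun θ => by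
    have := (hw θ).ne'
    have e1 : (α + β) * n = β := by rw [hn]; field_simp
    rw [show X θ - x₃ = X θ - x₁ - (α + β) by rw [hα, hβ]; ring, hX1]
    field_simp
    linear_combination Real.sin θ ^ 2 * e1
  have hX4 : ∀ θ, X θ - x₄ = -(δ * (1 - k2 * Real.sin θ ^ 2) / (1 - n * Real.sin θ ^ 2)) :=
    fun θ => by
    have := (hw θ).ne'
    have e1 : (α + β) * n = β := by rw [hn]; field_simp
    have e2 : δ * k2 = n * (α + δ) := by rw [hk2, hn]; field_simp
    rw [show X θ - x₄ = X θ - x₁ - (α + δ) by rw [hα, hδ]; ring, hX1]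
    field_simp
    linear_combination -Real.sin θ ^ 2 * e2
  have hXe : ∀ θ, X θ - e = ε * (1 - n2 * Real.sin θ ^ 2) / (1 - n * Real.sin θ ^ 2) := fun θ => by
    have := (hw θ).ne'
    rw [show X θ - e = X θ - x₁ + (x₁ - e) by ring, hX1, hn2, show x₁ - e = ε - α by linarith]
    field_simp
    ring
  have hXmem : ∀ θ, X θ ∈ Set.Icc x₂ x₃ := fun θ => by
    have h2 := hX2 θ
    have h3 := hX3 θ
    have := hw θ
    have : 0 ≤ n * Real.sin θ ^ 2 * α / (1 - n * Real.sin θ ^ 2) := by positivity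
    have : 0 ≤ β * (1 - Real.sin θ ^ 2) / (1 - n * Real.sin θ ^ 2) :=
      div_nonneg (mul_nonneg β0.le (by linarith [(hsin θ).2])) (hw θ).le
    constructor <;> linarith
  have hsq : ∀ θ, HasDerivAt (fun θ => Real.sin θ ^ 2) (2 * Real.sin θ * Real.cos θ) θ := fun θ =>
    ((Real.hasDerivAt_sin θ).pow 2).congr_deriv (by ring)
  have hwd : ∀ θ, HasDerivAt (fun θ => 1 - n * Real.sin θ ^ 2)
      (-(n * (2 * Real.sin θ * Real.cos θ))) θ := fun θ => ((hsq θ).const_mul n).const_sub 1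
  have hKd : ∀ θ, HasDerivAt (fun θ => Real.sqrt (1 - k2 * Real.sin θ ^ 2))
      (-(k2 * (2 * Real.sin θ * Real.cos θ)) / (2 * Real.sqrt (1 - k2 * Real.sin θ ^ 2))) θ :=
    fun θ => (((hsq θ).const_mul k2).const_sub 1).sqrt (hK θ).ne'
  have hΔ : ∀ θ : ℝ, 0 < Real.sqrt (1 - k2 * Real.sin θ ^ 2) := fun θ => Real.sqrt_pos.2 (hK θ)
  have hΔ2 : ∀ θ : ℝ, Real.sqrt (1 - k2 * Real.sin θ ^ 2) ^ 2 = 1 - k2 * Real.sin θ ^ 2 :=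
    fun θ => Real.sq_sqrt (hK θ).le
  have hXd : ∀ θ, HasDerivAt X (α * (2 * n * Real.sin θ * Real.cos θ) /
      (1 - n * Real.sin θ ^ 2) ^ 2) θ := fun θ => by
    have h0 : X = fun θ => x₁ + α / (1 - n * Real.sin θ ^ 2) := by
      ext θ; linarith [hX1 θ]
    rw [h0]
    refine HasDerivAt.congr_deriv (((hasDerivAt_const θ α).div (hwd θ) (hw θ).ne').const_add x₁) ?_
    have := (hw θ).ne'
    field_simp
    ring
  have cS : Continuous fun θ : ℝ => 1 - n * Real.sin θ ^ 2 := by fun_prop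
  have cΔ : Continuous fun θ : ℝ => Real.sqrt (1 - k2 * Real.sin θ ^ 2) := by fun_prop
  have cN : Continuous fun θ : ℝ => 1 - n2 * Real.sin θ ^ 2 := by fun_prop
  set M := Real.sqrt ((x₃ - x₁) * (x₄ - x₂)) with hM
  have hM0 : 0 < M := Real.sqrt_pos.2 (mul_pos (by linarith) (by linarith))
  have hM2 : M ^ 2 = (α + β) * δ := by
    rw [hM, Real.sq_sqrt (mul_pos (by linarith) (by linarith)).le, h31, hδ]
  -- the exact part
  set Φ : ℝ → ℝ := fun θ => Real.sin θ * Real.cos θ * Real.sqrt (1 - k2 * Real.sin θ ^ 2) *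
    (c₂ * α * β * δ / 2 / (1 - n * Real.sin θ ^ 2) ^ 2 + c₁ * β * δ / 2 / (1 - n * Real.sin θ ^ 2))
    with hΦ
  set φ : ℝ → ℝ := fun θ =>
      (c₂ * α * β * δ / 2 * (((1 - 2 * Real.sin θ ^ 2) * (1 - k2 * Real.sin θ ^ 2) -
        k2 * Real.sin θ ^ 2 * (1 - Real.sin θ ^ 2)) / (1 - n * Real.sin θ ^ 2) ^ 2 +
        4 * n * Real.sin θ ^ 2 * (1 - Real.sin θ ^ 2) * (1 - k2 * Real.sin θ ^ 2) /
          (1 - n * Real.sin θ ^ 2) ^ 3) +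
      c₁ * β * δ / 2 * (((1 - 2 * Real.sin θ ^ 2) * (1 - k2 * Real.sin θ ^ 2) -
        k2 * Real.sin θ ^ 2 * (1 - Real.sin θ ^ 2)) / (1 - n * Real.sin θ ^ 2) +
        2 * n * Real.sin θ ^ 2 * (1 - Real.sin θ ^ 2) * (1 - k2 * Real.sin θ ^ 2) /
          (1 - n * Real.sin θ ^ 2) ^ 2)) / Real.sqrt (1 - k2 * Real.sin θ ^ 2) with hφ
  have hΦd : ∀ θ, HasDerivAt Φ (φ θ) θ := fun θ => by
    have h0 := (hw θ).ne'
    have d1 := ((Real.hasDerivAt_sin θ).mul (Real.hasDerivAt_cos θ)).mul (hKd θ)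
    have d2 := (((hasDerivAt_const θ (c₂ * α * β * δ / 2)).div ((hwd θ).pow 2) (pow_ne_zero 2
        h0)).add
      ((hasDerivAt_const θ (c₁ * β * δ / 2)).div (hwd θ) h0))
    refine HasDerivAt.congr_deriv (d1.mul d2) ?_
    have e1 := hΔ2 θ
    have e2 := Real.sin_sq_add_cos_sq θ
    have e3 := (hΔ θ).ne'
    have e4 : Real.cos θ ^ 2 = 1 - Real.sin θ ^ 2 := by linarith
    simp only [hφ, Pi.mul_apply, Pi.pow_apply]
    push_cast
    generalize Real.sqrt (1 - k2 * Real.sin θ ^ 2) = Δ at *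
    rw [← e1, ← e4]
    rw [show 1 - 2 * Real.sin θ ^ 2 = Real.cos θ ^ 2 - Real.sin θ ^ 2 by linarith]
    generalize 1 - n * Real.sin θ ^ 2 = w at *
    generalize Real.cos θ = c at *
    generalize Real.sin θ = s at *
    field_simp
    ring
  have cφ : Continuous φ := by
    refine Continuous.div ?_ cΔ fun θ => (hΔ θ).ne'
    refine (continuous_const.mul ((Continuous.div (by fun_prop) (cS.pow 2) fun θ =>
      (pow_pos (hw θ) 2).ne').add (Continuous.div (by fun_prop) (cS.pow 3) fun θ =>
      (pow_pos (hw θ) 3).ne'))).add (continuous_const.mul ((Continuous.div (by fun_prop) cS fun θ =>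
      (hw θ).ne').add (Continuous.div (by fun_prop) (cS.pow 2) fun θ => (pow_pos (hw θ) 2).ne')))
  have hφ0 : ∫ θ in (0:ℝ)..Real.pi / 2, φ θ = 0 := by
    rw [intervalIntegral.integral_eq_sub_of_hasDerivAt (fun θ _ => hΦd θ)
      (cφ.intervalIntegrable _ _)]
    simp [hΦ]
  have h0 : X 0 = x₂ := by
    have := hX2 0
    rw [Real.sin_zero] at this
    simp at this
    linarith
  have h1 : X (Real.pi / 2) = x₃ := by
    have := hX3 (Real.pi / 2)
    rw [Real.sin_pi_div_two] at this
    simp at this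
    linarith
  have hsub := intervalIntegral.integral_comp_mul_deriv' (a := 0) (b := Real.pi / 2) (f := X) (g :=
      g)
    (fun θ _ => hXd θ) (Continuous.continuousOn (Continuous.div (by fun_prop) (cS.pow 2) fun θ =>
      (pow_pos (hw θ) 2).ne')) (hgc.mono (by rintro _ ⟨θ, -, rfl⟩; exact hXmem θ))
  rw [h0, h1] at hsub
  have hnn : (x₁ - e) / (x₂ - e) * ((x₃ - x₂) / (x₃ - x₁)) = n2 := by
    rw [hn2, ← hε, ← hβ, h31, hn]
  rw [← hsub, ellipticK, ellipticE, ellipticPi, ellipticPi, hkk, hnn, ← hβ, h31, ← hn, ← hδ, ← hα, ←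
      hε]
  have cK : Continuous fun θ : ℝ => 1 / Real.sqrt (1 - k2 * Real.sin θ ^ 2) :=
    continuous_const.div cΔ fun θ => (hΔ θ).ne'
  have cPi : Continuous fun θ : ℝ => 1 / ((1 - n * Real.sin θ ^ 2) *
      Real.sqrt (1 - k2 * Real.sin θ ^ 2)) :=
    continuous_const.div (cS.mul cΔ) fun θ => (mul_pos (hw θ) (hΔ θ)).ne'
  have cPi2 : Continuous fun θ : ℝ => 1 / ((1 - n2 * Real.sin θ ^ 2) *
      Real.sqrt (1 - k2 * Real.sin θ ^ 2)) :=
    continuous_const.div (cN.mul cΔ) fun θ => (mul_pos (hN θ) (hΔ θ)).ne'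
  have hpt : ∀ θ ∈ Set.uIcc (0:ℝ) (Real.pi / 2), (g ∘ X) θ * (α * (2 * n * Real.sin θ * Real.cos θ)
      /
      (1 - n * Real.sin θ ^ 2) ^ 2) = 2 / M * (A * (1 / Real.sqrt (1 - k2 * Real.sin θ ^ 2)) +
      B * (δ / α) * Real.sqrt (1 - k2 * Real.sin θ ^ 2) +
      C * α * (1 / ((1 - n * Real.sin θ ^ 2) * Real.sqrt (1 - k2 * Real.sin θ ^ 2))) +
      D * (α / ε) * (1 / ((1 - n2 * Real.sin θ ^ 2) * Real.sqrt (1 - k2 * Real.sin θ ^ 2))) + φ θ)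
      := by
    intro θ hθ
    rw [Set.uIcc_of_le (by positivity)] at hθ
    have hs0 : 0 ≤ Real.sin θ := Real.sin_nonneg_of_nonneg_of_le_pi hθ.1 (by linarith [hθ.2,
        Real.pi_pos])
    have hc0 : 0 ≤ Real.cos θ := Real.cos_nonneg_of_mem_Icc ⟨by linarith [hθ.1, Real.pi_pos], hθ.2⟩
    have e4 : 1 - Real.sin θ ^ 2 = Real.cos θ ^ 2 := by linarith [Real.sin_sq_add_cos_sq θ]
    have w0 := hw θ
    have hW : Real.sqrt ((X θ - x₁) * (X θ - x₂) * (X θ - x₃) * (X θ - x₄)) =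
        α * n * M * (Real.sin θ * Real.cos θ * Real.sqrt (1 - k2 * Real.sin θ ^ 2)) /
          (1 - n * Real.sin θ ^ 2) ^ 2 := by
      rw [← Real.sqrt_sq (show 0 ≤ α * n * M * (Real.sin θ * Real.cos θ *
        Real.sqrt (1 - k2 * Real.sin θ ^ 2)) / (1 - n * Real.sin θ ^ 2) ^ 2 by positivity)]
      congr 1
      have en : (α + β) * n = β := by rw [hn]; field_simp
      rw [hX1, hX2, hX3, hX4, div_pow, mul_pow, mul_pow, mul_pow, mul_pow, mul_pow, hM2, hΔ2, e4]
      field_simp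
      linear_combination
        -(Real.sin θ ^ 2 * Real.cos θ ^ 2 * (1 - k2 * Real.sin θ ^ 2)) * en
    have hmain := hg (X θ) (hXmem θ)
    have hl := legendre_identity (c₁ := c₁) (c₂ := c₂) α0 β0 δ00
      (by rw [← hn]; exact hw θ) hn hk2 rfl rfl rfl rfl
    rw [hW, ← neg_sub (X θ) x₄, hXe, hX1, hX2, hX3, hX4, add_assoc _ (c₂ / 2 * _), hl] at hmain
    have w1 := w0.ne'
    have N1 := (hN θ).ne'
    have Δ1 := (hΔ θ).ne'
    have hΔ2' := hΔ2 θ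
    simp only [Function.comp, hφ]
    generalize c₂ * α * β * δ / 2 * _ + c₁ * β * δ / 2 * _ = Z at hmain ⊢
    generalize Real.sqrt (1 - k2 * Real.sin θ ^ 2) = Δ at hmain hΔ2' Δ1 ⊢
    rw [show g (X θ) * (α * (2 * n * Real.sin θ * Real.cos θ) / (1 - n * Real.sin θ ^ 2) ^ 2) =
      2 / (M * Δ) * (g (X θ) * (α * n * M * (Real.sin θ * Real.cos θ * Δ) /
        (1 - n * Real.sin θ ^ 2) ^ 2)) by field_simp, hmain, ← hΔ2']
    generalize 1 - n * Real.sin θ ^ 2 = w at *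
    generalize 1 - n2 * Real.sin θ ^ 2 = N at *
    field_simp
  rw [intervalIntegral.integral_congr hpt, intervalIntegral.integral_const_mul]
  congr 1
  rw [intervalIntegral.integral_add (by apply Continuous.intervalIntegrable; fun_prop)
      (cφ.intervalIntegrable _ _), hφ0,
    intervalIntegral.integral_add (by apply Continuous.intervalIntegrable; fun_prop)
      (by apply Continuous.intervalIntegrable; fun_prop),
    intervalIntegral.integral_add (by apply Continuous.intervalIntegrable; fun_prop)
      (by apply Continuous.intervalIntegrable; fun_prop),
    intervalIntegral.integral_add (by apply Continuous.intervalIntegrable; fun_prop)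
      (by apply Continuous.intervalIntegrable; fun_prop), add_zero]
  simp only [intervalIntegral.integral_const_mul]

/-! ### The closed forms of the action -/

/-- Partial fractions of 𝒫/(x + 1): the residue at −1 gives the coefficient of (x − q₁)/(x + 1), the
poles at q₁ of the second and of the last term cancel, and the polynomial parts agree by Vieta. -/
theorem quartic_legendre_identity {a q₁ q₂ q₃ q₄ x : ℝ} (s1 : q₁ + q₂ + q₃ + q₄ = 2 * (2 + a))
    (s2 : q₁ * q₂ + q₁ * q₃ + q₁ * q₄ + q₂ * q₃ + q₂ * q₄ + q₃ * q₄ = a ^ 2 - 4)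
    (h1 : x - q₁ ≠ 0) (h2 : x + 1 ≠ 0) :
    (x - q₁) * (x - q₂) * (x - q₃) * (x - q₄) / (x + 1) =
      (q₂ - q₁) * (q₃ - q₁) * ((a + 4 + q₄ - q₁) / 4) +
      (q₂ - q₁) * (q₃ - q₁) * ((a + 4) / 4) * ((q₄ - x) / (x - q₁)) + -(a + 1) * (x - q₁) +
      -((1 + q₂) * (1 + q₃) * (1 + q₄)) * ((x - q₁) / (x - -1)) +
      1 / 2 / 2 * ((x - q₂) * (x - q₃) * (x - q₄) + (x - q₁) *
        ((x - q₃) * (x - q₄) + (x - q₂) * (x - q₄) + (x - q₂) * (x - q₃))) +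
      -((a + 4) / 2) / 2 * (((x - q₃) * (x - q₄) + (x - q₂) * (x - q₄) + (x - q₂) * (x - q₃)) -
        (x - q₂) * (x - q₃) * (x - q₄) / (x - q₁)) := by
  have ha : a = (q₁ + q₂ + q₃ + q₄) / 2 - 2 := by linarith
  rw [sub_neg_eq_add]
  have hp : (x - q₂) * (x - q₃) * (x - q₄) / (x - q₁) =
      ((x - q₁) ^ 2 + (3 * q₁ - q₂ - q₃ - q₄) * (x - q₁) +
        ((q₁ - q₃) * (q₁ - q₄) + (q₁ - q₂) * (q₁ - q₄) + (q₁ - q₂) * (q₁ - q₃))) +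
        (q₁ - q₂) * (q₁ - q₃) * (q₁ - q₄) / (x - q₁) := by
    field_simp; ring
  have hq : (q₄ - x) / (x - q₁) = (q₄ - q₁) / (x - q₁) - 1 := by field_simp; ring
  have hr : (x - q₁) * (x - q₂) * (x - q₃) * (x - q₄) / (x + 1) =
      (x - q₁) * (((x + 1) ^ 2 - (3 + q₂ + q₃ + q₄) * (x + 1) +
        ((1 + q₂) * (1 + q₃) + (1 + q₂) * (1 + q₄) + (1 + q₃) * (1 + q₄)))) -
        ((1 + q₂) * (1 + q₃) * (1 + q₄)) * ((x - q₁) / (x + 1)) := by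
    field_simp; ring
  rw [hp, hq, hr]
  have e : (q₂ - q₁) * (q₃ - q₁) * ((a + 4) / 4) * ((q₄ - q₁) / (x - q₁) - 1) =
      -((a + 4) / 4 * ((q₁ - q₂) * (q₁ - q₃) * (q₁ - q₄) / (x - q₁))) -
      (q₂ - q₁) * (q₃ - q₁) * ((a + 4) / 4) := by ring
  rw [e]
  generalize (q₁ - q₂) * (q₁ - q₃) * (q₁ - q₄) / (x - q₁) = u
  generalize (x - q₁) / (x + 1) = v
  rw [ha] at s2 ⊢
  linear_combination ((x - q₁) / 2) * s2

theorem integral_quartic_eq {a E q₁ q₂ q₃ q₄ : ℝ} (h1 : -1 ≤ q₁) (h12 : q₁ < q₂) (h23 : q₂ < q₃)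
    (h34 : q₃ < q₄) (hP : ∀ x, sextP a E x = (x - q₁) * (x - q₂) * (x - q₃) * (x - q₄))
    (s1 : q₁ + q₂ + q₃ + q₄ = 2 * (2 + a))
    (s2 : q₁ * q₂ + q₁ * q₃ + q₁ * q₄ + q₂ * q₃ + q₂ * q₄ + q₃ * q₄ = a ^ 2 - 4) :
    1 / (2 * Real.pi) * (∫ x in q₂..q₃, Real.sqrt (sextP a E x) / (x + 1)) =
      sextActionRoots a q₁ q₂ q₃ q₄ := by
  have hc : ContinuousOn (fun x => Real.sqrt (sextP a E x) / (x + 1)) (Set.Icc q₂ q₃) := by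
    unfold sextP
    exact ContinuousOn.div (by fun_prop) (by fun_prop)
      fun y hy => by have := hy.1; exact (by linarith : 0 < y + 1).ne'
  rw [integral_legendre (e := -1) (A := (q₂ - q₁) * (q₃ - q₁) * ((a + 4 + q₄ - q₁) / 4))
    (B := (q₂ - q₁) * (q₃ - q₁) * ((a + 4) / 4)) (C := -(a + 1))
    (D := -((1 + q₂) * (1 + q₃) * (1 + q₄))) (c₂ := 1 / 2) (c₁ := -((a + 4) / 2)) h12 h23 h34
    (by linarith) hc]
  · have h31 : 0 < q₃ - q₁ := by linarith
    have h42 : 0 < q₄ - q₂ := by linarith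
    have h41 : 0 < q₄ - q₁ := by linarith
    have h21 : 0 < q₂ - q₁ := by linarith
    have h20 : 0 < 1 + q₂ := by linarith
    have hk : rootModulus q₁ q₂ q₃ q₄ ^ 2 = (q₃ - q₂) * (q₄ - q₁) / ((q₃ - q₁) * (q₄ - q₂)) := by
      rw [rootModulus, Real.sq_sqrt]
      have : 0 < q₃ - q₂ := by linarith
      positivity
    rw [sextActionRoots]
    have e1 : (q₄ - q₂) / (q₄ - q₁) * rootModulus q₁ q₂ q₃ q₄ ^ 2 = (q₃ - q₂) / (q₃ - q₁) := by
      rw [hk]; field_simp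
    have e2 : (1 + q₁) / (1 + q₂) * ((q₄ - q₂) / (q₄ - q₁)) * rootModulus q₁ q₂ q₃ q₄ ^ 2 =
        (q₁ - -1) / (q₂ - -1) * ((q₃ - q₂) / (q₃ - q₁)) := by
      rw [mul_assoc, e1]; congr 1; ring
    rw [e1, e2, sub_neg_eq_add, sub_neg_eq_add, add_comm q₂ 1, Real.sqrt_mul h31.le,
      Real.sqrt_div h31.le]
    have m1 := (Real.sqrt_pos.2 h31).ne'
    have m2 := (Real.sqrt_pos.2 h42).ne'
    have m3 := Real.sq_sqrt h31.le
    generalize Real.sqrt (q₃ - q₁) = m at *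
    generalize Real.sqrt (q₄ - q₂) = m' at *
    generalize ellipticK _ = K
    generalize ellipticE _ = L
    generalize ellipticPi _ _ = F
    generalize ellipticPi _ _ = G
    rw [← m3]
    field_simp
    rw [m3]
    ring
  · intro x hx
    have hx1 := hx.1
    have hx2 := hx.2
    rw [← quartic_legendre_identity s1 s2 (by linarith) (by linarith), ← hP, div_mul_eq_mul_div,
      Real.mul_self_sqrt]
    rw [hP]
    have := mul_nonneg (mul_nonneg (mul_nonneg (show 0 ≤ x - q₁ by linarith)
      (show 0 ≤ x - q₂ by linarith)) (show 0 ≤ q₃ - x by linarith)) (show 0 ≤ q₄ - x by linarith)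
    linarith

/-- Used with r = √2, x = −Q, S = Q₁ + Q₂ + Q₃ and P = Q₁Q₂Q₃. Then 2r + S = Q₄, 4 + rS = 2 + a,
rP/2 = E, and the left side is 𝒢. -/
theorem rotated_legendre_identity {r S P x : ℝ} (hr : r ^ 2 = 2) (hx : x + (2 * r + S) ≠ 0) :
    x ^ 3 + S * x ^ 2 + P = ((4 + r * S) ^ 2 - r * P / 2) / 4 *
        ((6 + r * S) / (x + (2 * r + S)) - 3 * r) + (3 + r * S) * (x + (2 * r + S)) +
      1 / 2 / 2 * (x ^ 3 + S * x ^ 2 + P + (x + (2 * r + S)) * (3 * x ^ 2 + 2 * S * x)) +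
      -((6 + r * S) * r / 4) / 2 * (3 * x ^ 2 + 2 * S * x -
        (x ^ 3 + S * x ^ 2 + P) / (x + (2 * r + S))) := by
  have hd : (x ^ 3 + S * x ^ 2 + P) / (x + (2 * r + S)) = x ^ 2 - 2 * r * x +
      2 * r * (2 * r + S) + (P - 2 * r * (2 * r + S) ^ 2) * (x + (2 * r + S))⁻¹ := by
    field_simp; ring
  rw [hd, div_eq_mul_inv (6 + r * S)]
  generalize (x + (2 * r + S))⁻¹ = u
  have hr3 : r ^ 3 = 2 * r := by rw [pow_succ, hr]
  have hr4 : r ^ 4 = 4 := by rw [show r ^ 4 = (r ^ 2) ^ 2 by ring, hr]; norm_num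
  have hr5 : r ^ 5 = 4 * r := by rw [pow_succ, hr4]
  ring_nf
  simp only [hr, hr3, hr4, hr5]
  ring

theorem sextG_roots {a E : ℝ} (h : SextRoots a E (Real.sqrt 2 * sextQ₁ a E) (Real.sqrt 2 * sextQ₂ a
      E)
      (Real.sqrt 2 * sextQ₃ a E)) :
    sextQ₁ a E < sextQ₂ a E ∧ sextQ₂ a E < sextQ₃ a E ∧ sextQ₃ a E < sextQ₄ a ∧
      a = 2 + Real.sqrt 2 * (sextQ₁ a E + sextQ₂ a E + sextQ₃ a E) ∧
      sextQ₁ a E * sextQ₂ a E + sextQ₁ a E * sextQ₃ a E + sextQ₂ a E * sextQ₃ a E = 0 ∧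
      E = Real.sqrt 2 * (sextQ₁ a E * sextQ₂ a E * sextQ₃ a E) / 2 ∧
      sextQ₄ a = 2 * Real.sqrt 2 + (sextQ₁ a E + sextQ₂ a E + sextQ₃ a E) := by
  have h0 : 0 < Real.sqrt 2 := by positivity
  have h2 : Real.sqrt 2 ^ 2 = 2 := Real.sq_sqrt (by norm_num)
  have hs := h.sum
  have hp := h.pairs
  have hq := h.prod
  have h34 := h.lt₃₄
  refine ⟨(mul_lt_mul_iff_right₀ h0).1 h.lt₁₂, (mul_lt_mul_iff_right₀ h0).1 h.lt₂₃, ?_,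
    by linarith, ?_, ?_, ?_⟩
  · rw [sextQ₄, lt_div_iff₀ h0, mul_comm]; exact h34
  · linear_combination (1 / 2) * hp - (sextQ₁ a E * sextQ₂ a E + sextQ₁ a E * sextQ₃ a E +
      sextQ₂ a E * sextQ₃ a E) / 2 * h2
  · linear_combination (-1 / 4) * hq + (Real.sqrt 2 * (sextQ₁ a E * sextQ₂ a E * sextQ₃ a E)) / 4 *
      h2
  · rw [sextQ₄, div_eq_iff h0.ne']
    linear_combination -hs - 2 * h2

theorem sextG_eq {a E : ℝ} (h : SextRoots a E (Real.sqrt 2 * sextQ₁ a E) (Real.sqrt 2 * sextQ₂ a E)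
      (Real.sqrt 2 * sextQ₃ a E)) (Q : ℝ) :
    sextG a E Q = -((Q - sextQ₁ a E) * (Q - sextQ₂ a E) * (Q - sextQ₃ a E)) := by
  obtain ⟨-, -, -, ha, hp, hE, -⟩ := sextG_roots h
  have h0 : Real.sqrt 2 ≠ 0 := by positivity
  have h2 : Real.sqrt 2 ^ 2 = 2 := Real.sq_sqrt (by norm_num)
  have e1 : (2 - a) / Real.sqrt 2 = -(sextQ₁ a E + sextQ₂ a E + sextQ₃ a E) := by
    rw [div_eq_iff h0]; linarith
  have e2 : Real.sqrt 2 * E = sextQ₁ a E * sextQ₂ a E * sextQ₃ a E := by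
    linear_combination Real.sqrt 2 * hE + (sextQ₁ a E * sextQ₂ a E * sextQ₃ a E) / 2 * h2
  rw [sextG, e1, e2]
  linear_combination Q * hp

/-- The action as an integral over the coordinate `Q`. -/
theorem angleAction_rotated {a E : ℝ} (h : SextRoots a E (Real.sqrt 2 * sextQ₁ a E)
      (Real.sqrt 2 * sextQ₂ a E) (Real.sqrt 2 * sextQ₃ a E)) :
    angleAction (Real.sqrt 2 * sextQ₁ a E) (Real.sqrt 2 * sextQ₂ a E) (Real.sqrt 2 * sextQ₃ a E)
      (2 + a) = 1 / Real.pi *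
      ∫ Q in (sextQ₂ a E)..(sextQ₃ a E), Real.sqrt (sextG a E Q / (sextQ₄ a - Q)) := by
  have h0 : 0 < Real.sqrt 2 := by positivity
  have h2 : Real.sqrt 2 ^ 2 = 2 := Real.sq_sqrt (by norm_num)
  rw [angleAction_eq_integral h.lt₁₂ h.lt₂₃ h.lt₃₄]
  have := intervalIntegral.mul_integral_comp_mul_left (a := sextQ₂ a E) (b := sextQ₃ a E)
    (c := Real.sqrt 2) (f := fun y => Real.sqrt ((y - Real.sqrt 2 * sextQ₁ a E) *
      (y - Real.sqrt 2 * sextQ₂ a E) * (Real.sqrt 2 * sextQ₃ a E - y) / (2 + a - y)))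
  rw [← this]
  have e : ∀ Q, Real.sqrt ((Real.sqrt 2 * Q - Real.sqrt 2 * sextQ₁ a E) *
      (Real.sqrt 2 * Q - Real.sqrt 2 * sextQ₂ a E) * (Real.sqrt 2 * sextQ₃ a E - Real.sqrt 2 * Q) /
      (2 + a - Real.sqrt 2 * Q)) = Real.sqrt 2 * Real.sqrt (sextG a E Q / (sextQ₄ a - Q)) := fun Q
      => by
    rw [← Real.sqrt_mul (by norm_num : (0:ℝ) ≤ 2), sextG_eq h, sextQ₄]
    congr 1
    rw [show 2 + a - Real.sqrt 2 * Q = Real.sqrt 2 * ((2 + a) / Real.sqrt 2 - Q) by field_simp]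
    rw [div_mul_eq_div_div]
    rw [← mul_div_assoc]
    congr 1
    rw [div_eq_iff h0.ne']
    linear_combination ((Q - sextQ₁ a E) * (Q - sextQ₂ a E) * (sextQ₃ a E - Q) * Real.sqrt 2) * h2
  simp only [e]
  rw [intervalIntegral.integral_const_mul, ← mul_assoc, ← mul_assoc]
  congr 1
  field_simp
  rw [h2]

/-- The reflection Q ↦ −Q makes Q₄ the smallest of the four points, the distinguished one in
`integral_legendre`, and keeps the modulus. The product of √(𝒢/(Q₄ − Q)) with the square root of the
quartic is 𝒢 itself, so no pole remains and D = 0. -/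
theorem integral_rotated_eq {a E : ℝ} (h : SextRoots a E (Real.sqrt 2 * sextQ₁ a E)
      (Real.sqrt 2 * sextQ₂ a E) (Real.sqrt 2 * sextQ₃ a E)) :
    1 / Real.pi * (∫ Q in (sextQ₂ a E)..(sextQ₃ a E), Real.sqrt (sextG a E Q / (sextQ₄ a - Q))) =
      sextActionRotated a E := by
  obtain ⟨h12, h23, h34, ha, hp, hE, hQ4⟩ := sextG_roots h
  have hG := sextG_eq h
  have h2 : Real.sqrt 2 ^ 2 = 2 := Real.sq_sqrt (by norm_num)
  rw [sextActionRotated]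
  simp only [sextModulus]
  generalize sextQ₁ a E = Q₁ at *
  generalize sextQ₂ a E = Q₂ at *
  generalize sextQ₃ a E = Q₃ at *
  generalize sextQ₄ a = Q₄ at *
  have hc : ContinuousOn (fun x => Real.sqrt (sextG a E (-x) / (Q₄ - -x))) (Set.Icc (-Q₃) (-Q₂)) :=
      by
    unfold sextG
    refine (ContinuousOn.div (by fun_prop) (by fun_prop) fun x hx => ?_).sqrt
    have := hx.1
    exact (by linarith : 0 < Q₄ - -x).ne'
  have hneg := intervalIntegral.integral_comp_neg (a := -Q₃) (b := -Q₂)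
    (fun Q => Real.sqrt (sextG a E Q / (Q₄ - Q)))
  rw [neg_neg, neg_neg] at hneg
  rw [← hneg, integral_legendre (x₁ := -Q₄) (x₂ := -Q₃) (x₃ := -Q₂) (x₄ := -Q₁) (e := -Q₄)
    (A := ((2 + a) ^ 2 - E) / 4 * ((4 + a) / (Q₄ - Q₁) - 3 * Real.sqrt 2))
    (B := ((2 + a) ^ 2 - E) / 4 * ((4 + a) / (Q₄ - Q₁))) (C := 1 + a) (D := 0) (c₂ := 1 / 2)
    (c₁ := -((4 + a) * Real.sqrt 2 / 4))
    (by linarith) (by linarith) (by linarith) (by linarith) hc]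
  · have h41 : 0 < Q₄ - Q₁ := by linarith
    have h43 : 0 < Q₄ - Q₃ := by linarith
    have h31 : 0 < Q₃ - Q₁ := by linarith
    have h42 : 0 < Q₄ - Q₂ := by linarith
    have ek : rootModulus (-Q₄) (-Q₃) (-Q₂) (-Q₁) = rootModulus Q₁ Q₂ Q₃ Q₄ := by
      rw [rootModulus, rootModulus]
      congr 1
      congr 1 <;> ring
    rw [ek, show (-Q₂ - -Q₄) * (-Q₁ - -Q₃) = (Q₄ - Q₂) * (Q₃ - Q₁) by ring,
      show (-Q₂ - -Q₃) / (-Q₂ - -Q₄) = (Q₃ - Q₂) / (Q₄ - Q₂) by congr 1 <;> ring,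
      show (-Q₁ - -Q₃) / (-Q₃ - -Q₄) = (Q₃ - Q₁) / (Q₄ - Q₃) by congr 1 <;> ring,
      show -Q₃ - -Q₄ = Q₄ - Q₃ by ring]
    have hm : Real.sqrt ((Q₄ - Q₂) * (Q₃ - Q₁)) ≠ 0 := (Real.sqrt_pos.2 (mul_pos h42 h31)).ne'
    generalize Real.sqrt ((Q₄ - Q₂) * (Q₃ - Q₁)) = m at *
    generalize ellipticK _ = K
    generalize ellipticE _ = L
    generalize ellipticPi _ _ = F
    generalize ellipticPi _ _ = G
    field_simp
    ring
  · intro x hx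
    have hx1 := hx.1
    have hx2 := hx.2
    have h41 : 0 < Q₄ - Q₁ := by linarith
    have y0 : 0 < x + Q₄ := by linarith
    have hR : (x + Q₁) * (x + Q₂) * (x + Q₃) =
        x ^ 3 + (Q₁ + Q₂ + Q₃) * x ^ 2 + Q₁ * Q₂ * Q₃ := by linear_combination x * hp
    have hR' : (x + Q₁) * (x + Q₂) + (x + Q₁) * (x + Q₃) + (x + Q₂) * (x + Q₃) =
        3 * x ^ 2 + 2 * (Q₁ + Q₂ + Q₃) * x := by linear_combination hp
    have hGR : sextG a E (-x) = (x + Q₁) * (x + Q₂) * (x + Q₃) := by rw [hG]; ring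
    have hG0 : 0 ≤ sextG a E (-x) := by
      rw [hG]
      have := mul_nonneg (mul_nonneg (show 0 ≤ -x - Q₁ by linarith) (show 0 ≤ -x - Q₂ by linarith))
        (show 0 ≤ Q₃ + x by linarith)
      linarith
    have hl : Real.sqrt (sextG a E (-x) / (Q₄ - -x)) *
        Real.sqrt ((x - -Q₄) * (x - -Q₃) * (x - -Q₂) * (x - -Q₁)) = sextG a E (-x) := by
      rw [← Real.sqrt_mul (div_nonneg hG0 (by linarith)), show sextG a E (-x) / (Q₄ - -x) *
        ((x - -Q₄) * (x - -Q₃) * (x - -Q₂) * (x - -Q₁)) = sextG a E (-x) ^ 2 by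
          rw [sub_neg_eq_add, add_comm Q₄ x]
          field_simp
          rw [hGR]
          ring, Real.sqrt_sq hG0]
    rw [hl, hGR, hR]
    have hid := rotated_legendre_identity (S := Q₁ + Q₂ + Q₃) (P := Q₁ * Q₂ * Q₃) h2
      (x := x) (by rw [← hQ4]; exact y0.ne')
    rw [← hQ4] at hid
    have e1 : (4 + Real.sqrt 2 * (Q₁ + Q₂ + Q₃)) = 2 + a := by linarith
    have e2 : (6 + Real.sqrt 2 * (Q₁ + Q₂ + Q₃)) = 4 + a := by linarith
    have e3 : (3 + Real.sqrt 2 * (Q₁ + Q₂ + Q₃)) = 1 + a := by linarith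
    rw [e1, e2, e3, ← hE] at hid
    have e4 : ∀ A : ℝ, A * ((4 + a) / (Q₄ - Q₁) - 3 * Real.sqrt 2) +
        A * ((4 + a) / (Q₄ - Q₁)) * ((-Q₁ - x) / (x - -Q₄)) =
        A * ((4 + a) / (x + Q₄) - 3 * Real.sqrt 2) := fun A => by
      rw [sub_neg_eq_add]; field_simp; ring
    rw [e4, show (x - -Q₂) * (x - -Q₁) + (x - -Q₃) * (x - -Q₁) + (x - -Q₃) * (x - -Q₂) =
      3 * x ^ 2 + 2 * (Q₁ + Q₂ + Q₃) * x by rw [← hR']; ring,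
      show (x - -Q₃) * (x - -Q₂) * (x - -Q₁) = x ^ 3 + (Q₁ + Q₂ + Q₃) * x ^ 2 + Q₁ * Q₂ * Q₃ by
        rw [← hR]; ring, sub_neg_eq_add, zero_mul, add_zero]
    exact hid

/-! ### Positivity and strict monotonicity of the action in the level. -/

namespace SextRoots

variable {a E s₁ s₂ s₃ : ℝ}

theorem continuousOn_integrand (h : SextRoots a E s₁ s₂ s₃) :
    ContinuousOn (fun y => Real.sqrt ((y - s₁) * (y - s₂) * (s₃ - y) / (2 + a - y)))
      (Set.Icc s₂ s₃) := by
  refine (ContinuousOn.div (by fun_prop) (by fun_prop) fun y hy => ?_).sqrt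
  have := hy.2
  have := h.lt₃₄
  exact (by linarith : 0 < 2 + a - y).ne'

theorem angleAction_pos (h : SextRoots a E s₁ s₂ s₃) : 0 < angleAction s₁ s₂ s₃ (2 + a) := by
  rw [angleAction_eq_integral h.lt₁₂ h.lt₂₃ h.lt₃₄]
  refine mul_pos (by positivity) ?_
  refine intervalIntegral.intervalIntegral_pos_of_pos_on
    (h.continuousOn_integrand.intervalIntegrable_of_Icc h.lt₂₃.le) (fun y hy => ?_) h.lt₂₃
  have h1 := h.lt₁₂
  have h4 := h.lt₃₄
  exact Real.sqrt_pos.2 (div_pos (mul_pos (mul_pos (by linarith [hy.1]) (by linarith [hy.1]))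
    (by linarith [hy.2])) (by linarith [hy.2]))

/-- Raising E adds a positive constant to the cubic, so the interval between the roots grows and so
does the integrand. As a consequence the action determines the level. -/
theorem angleAction_lt (h : SextRoots a E s₁ s₂ s₃) {E' u₁ u₂ u₃ : ℝ}
    (h' : SextRoots a E' u₁ u₂ u₃) (ha : a < 2) (hE : E < E') :
    angleAction s₁ s₂ s₃ (2 + a) < angleAction u₁ u₂ u₃ (2 + a) := by
  have hlt : ∀ y, (y - s₁) * (y - s₂) * (s₃ - y) < (y - u₁) * (y - u₂) * (u₃ - y) := fun y => by
    rw [← h.cubic_eq, ← h'.cubic_eq]; linarith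
  have h2 : u₂ < s₂ := by
    have h0 := hlt s₂
    rw [sub_self, mul_zero, zero_mul] at h0
    have h3 := (pos_iff_pos_of_mul_pos h0).2 (by linarith [h.neg₂ ha, h'.pos₃ ha])
    have h4 := (pos_iff_pos_of_mul_pos h3).1 (by linarith [h.critical_lt₂ ha, h'.lt_critical₁ ha])
    linarith
  have h3 : s₃ < u₃ := by
    have h0 := hlt s₃
    rw [sub_self, mul_zero] at h0
    have h3 := (pos_iff_pos_of_mul_pos h0).1 (mul_pos (by linarith [h.pos₃ ha, h'.neg₁ ha])
      (by linarith [h.pos₃ ha, h'.neg₂ ha]))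
    linarith
  have h23 := h.lt₂₃
  have h12 := h.lt₁₂
  have h34' := h'.lt₃₄
  rw [angleAction_eq_integral h.lt₁₂ h.lt₂₃ h.lt₃₄, angleAction_eq_integral h'.lt₁₂ h'.lt₂₃ h'.lt₃₄]
  refine mul_lt_mul_of_pos_left ?_ (by positivity)
  have hle : ∀ y ∈ Set.Icc s₂ s₃, Real.sqrt ((y - s₁) * (y - s₂) * (s₃ - y) / (2 + a - y)) <
      Real.sqrt ((y - u₁) * (y - u₂) * (u₃ - y) / (2 + a - y)) := fun y hy => by
    have h0 : 0 < 2 + a - y := by linarith [hy.2]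
    refine Real.sqrt_lt_sqrt (div_nonneg (mul_nonneg (mul_nonneg (by linarith [hy.1])
      (by linarith [hy.1])) (by linarith [hy.2])) h0.le) ?_
    exact div_lt_div_of_pos_right (hlt y) h0
  have hmono : Set.Icc s₂ s₃ ⊆ Set.Icc u₂ u₃ := Set.Icc_subset_Icc h2.le h3.le
  calc _ < ∫ y in s₂..s₃, Real.sqrt ((y - u₁) * (y - u₂) * (u₃ - y) / (2 + a - y)) :=
        intervalIntegral.integral_lt_integral_of_continuousOn_of_le_of_exists_lt h23
          h.continuousOn_integrand (h'.continuousOn_integrand.mono hmono)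
          (fun y hy => (hle y ⟨hy.1.le, hy.2⟩).le) ⟨s₂, ⟨le_rfl, h23.le⟩, hle s₂ ⟨le_rfl, h23.le⟩⟩
    _ ≤ _ := intervalIntegral.integral_mono_interval h2.le h23.le h3.le
        (Eventually.of_forall fun y => Real.sqrt_nonneg _)
        (h'.continuousOn_integrand.intervalIntegrable_of_Icc h'.lt₂₃.le)

end SextRoots

/-! ### Truncated power series -/

/-- `f = c₀ + c₁ x + c₂ x² + c₃ x³ + O(x⁴)`. -/
def Tay4 {α : Type*} (l : Filter α) (x f : α → ℝ) (c₀ c₁ c₂ c₃ : ℝ) : Prop :=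
  (fun t => f t - (c₀ + c₁ * x t + c₂ * x t ^ 2 + c₃ * x t ^ 3)) =O[l] fun t => x t ^ 4

/-- `f = c₀ + c₁ x + c₂ x² + c₃ x³ + c₄ x⁴ + c₅ x⁵ + O(x⁶)`. -/
def Tay6 {α : Type*} (l : Filter α) (x f : α → ℝ) (c₀ c₁ c₂ c₃ c₄ c₅ : ℝ) : Prop :=
  (fun t => f t - (c₀ + c₁ * x t + c₂ * x t ^ 2 + c₃ * x t ^ 3 + c₄ * x t ^ 4 + c₅ * x t ^ 5))
    =O[l] fun t => x t ^ 6

section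

variable {α : Type*} {l : Filter α} {x f g : α → ℝ}

theorem isBigO_mul_pow {n : ℕ} (h : (fun t => f t) =O[l] fun t => x t ^ n)
    (hg : g =O[l] fun _ => (1:ℝ)) : (fun t => f t * g t) =O[l] fun t => x t ^ n := by
  simpa using h.mul hg

namespace Tay6

variable {c₀ c₁ c₂ c₃ c₄ c₅ d₀ d₁ d₂ d₃ d₄ d₅ : ℝ}

theorem poly (c₀ c₁ c₂ c₃ c₄ c₅ : ℝ) : Tay6 l x (fun t => c₀ + c₁ * x t + c₂ * x t ^ 2 +
    c₃ * x t ^ 3 + c₄ * x t ^ 4 + c₅ * x t ^ 5) c₀ c₁ c₂ c₃ c₄ c₅ := by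
  simp only [Tay6, sub_self]
  exact isBigO_zero _ _

theorem tendsto (h : Tay6 l x f c₀ c₁ c₂ c₃ c₄ c₅) (hx : Tendsto x l (𝓝 0)) :
    Tendsto f l (𝓝 c₀) := by
  have h1 : Tendsto (fun t => x t ^ 6) l (𝓝 0) := by simpa using hx.pow 6
  have h2 := h.trans_tendsto h1
  have h3 : Tendsto (fun t => c₀ + c₁ * x t + c₂ * x t ^ 2 + c₃ * x t ^ 3 + c₄ * x t ^ 4 +
      c₅ * x t ^ 5) l (𝓝 c₀) := by
    have : Tendsto (fun y : ℝ => c₀ + c₁ * y + c₂ * y ^ 2 + c₃ * y ^ 3 + c₄ * y ^ 4 + c₅ * y ^ 5)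
        (𝓝 0) (𝓝 c₀) := by
      have hc : Continuous fun y : ℝ => c₀ + c₁ * y + c₂ * y ^ 2 + c₃ * y ^ 3 + c₄ * y ^ 4 +
        c₅ * y ^ 5 := by fun_prop
      simpa using hc.tendsto 0
    exact this.comp hx
  simpa using h2.add h3

theorem isBigO_one (h : Tay6 l x f c₀ c₁ c₂ c₃ c₄ c₅) (hx : Tendsto x l (𝓝 0)) :
    f =O[l] fun _ => (1:ℝ) := (h.tendsto hx).isBigO_one ℝ

theorem congr (h : Tay6 l x f c₀ c₁ c₂ c₃ c₄ c₅) (h0 : c₀ = d₀) (h1 : c₁ = d₁) (h2 : c₂ = d₂)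
    (h3 : c₃ = d₃) (h4 : c₄ = d₄) (h5 : c₅ = d₅) : Tay6 l x f d₀ d₁ d₂ d₃ d₄ d₅ := by
  subst h0 h1 h2 h3 h4 h5; exact h

theorem congr_fun (h : Tay6 l x f c₀ c₁ c₂ c₃ c₄ c₅) (hfg : ∀ᶠ t in l, g t = f t) :
    Tay6 l x g c₀ c₁ c₂ c₃ c₄ c₅ :=
  IsBigO.congr' h (hfg.mono fun t ht => by simp only [ht]) EventuallyEq.rfl

theorem add_isBigO (h : Tay6 l x f c₀ c₁ c₂ c₃ c₄ c₅)
    (hg : (fun t => g t - f t) =O[l] fun t => x t ^ 6) : Tay6 l x g c₀ c₁ c₂ c₃ c₄ c₅ :=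
  (IsBigO.add hg h).congr_left fun t => by ring

theorem add (h : Tay6 l x f c₀ c₁ c₂ c₃ c₄ c₅) (h' : Tay6 l x g d₀ d₁ d₂ d₃ d₄ d₅) :
    Tay6 l x (fun t => f t + g t) (c₀ + d₀) (c₁ + d₁) (c₂ + d₂) (c₃ + d₃) (c₄ + d₄) (c₅ + d₅) :=
  (IsBigO.add h h').congr_left fun t => by ring

theorem const_mul (h : Tay6 l x f c₀ c₁ c₂ c₃ c₄ c₅) (k : ℝ) :
    Tay6 l x (fun t => k * f t) (k * c₀) (k * c₁) (k * c₂) (k * c₃) (k * c₄) (k * c₅) :=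
  (IsBigO.const_mul_left h k).congr_left fun t => by ring

theorem mul (h : Tay6 l x f c₀ c₁ c₂ c₃ c₄ c₅) (h' : Tay6 l x g d₀ d₁ d₂ d₃ d₄ d₅)
    (hx : Tendsto x l (𝓝 0)) :
    Tay6 l x (fun t => f t * g t) (c₀ * d₀) (c₀ * d₁ + c₁ * d₀) (c₀ * d₂ + c₁ * d₁ + c₂ * d₀)
      (c₀ * d₃ + c₁ * d₂ + c₂ * d₁ + c₃ * d₀) (c₀ * d₄ + c₁ * d₃ + c₂ * d₂ + c₃ * d₁ + c₄ * d₀)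
      (c₀ * d₅ + c₁ * d₄ + c₂ * d₃ + c₃ * d₂ + c₄ * d₁ + c₅ * d₀) := by
  have h1 := isBigO_mul_pow h (h'.isBigO_one hx)
  have h2 := isBigO_mul_pow h' ((poly (l := l) (x := x) c₀ c₁ c₂ c₃ c₄ c₅).isBigO_one hx)
  have hx1 : (fun t => (c₁ * d₅ + c₂ * d₄ + c₃ * d₃ + c₄ * d₂ + c₅ * d₁) +
      (c₂ * d₅ + c₃ * d₄ + c₄ * d₃ + c₅ * d₂) * x t + (c₃ * d₅ + c₄ * d₄ + c₅ * d₃) * x t ^ 2 +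
      (c₄ * d₅ + c₅ * d₄) * x t ^ 3 + c₅ * d₅ * x t ^ 4 + 0 * x t ^ 5) =O[l] fun _ => (1:ℝ) :=
    (poly _ _ _ _ _ _).isBigO_one hx
  have h3 := isBigO_mul_pow (isBigO_refl (fun t => x t ^ 6) l) hx1
  refine (IsBigO.add (IsBigO.add h1 h2) h3).congr_left fun t => ?_
  ring

/-- The product of f with the candidate polynomial is 1 + O(x⁶), and division by f, which has a
nonzero limit, keeps the order. -/
theorem inv (h : Tay6 l x f c₀ c₁ c₂ c₃ c₄ c₅) (hx : Tendsto x l (𝓝 0)) (hc : c₀ ≠ 0)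
    (h0 : c₀ * d₀ = 1) (h1 : c₀ * d₁ + c₁ * d₀ = 0) (h2 : c₀ * d₂ + c₁ * d₁ + c₂ * d₀ = 0)
    (h3 : c₀ * d₃ + c₁ * d₂ + c₂ * d₁ + c₃ * d₀ = 0)
    (h4 : c₀ * d₄ + c₁ * d₃ + c₂ * d₂ + c₃ * d₁ + c₄ * d₀ = 0)
    (h5 : c₀ * d₅ + c₁ * d₄ + c₂ * d₃ + c₃ * d₂ + c₄ * d₁ + c₅ * d₀ = 0) :
    Tay6 l x (fun t => (f t)⁻¹) d₀ d₁ d₂ d₃ d₄ d₅ := by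
  have hm := (h.mul (poly d₀ d₁ d₂ d₃ d₄ d₅) hx).congr h0 h1 h2 h3 h4 h5
  have hf := h.tendsto hx
  have hne := hf.eventually_ne hc
  have hinv : (fun t => (f t)⁻¹) =O[l] fun _ => (1:ℝ) := (hf.inv₀ hc).isBigO_one ℝ
  refine (isBigO_mul_pow hm.neg_left hinv).congr' (hne.mono fun t ht => ?_) EventuallyEq.rfl
  simp only
  field_simp
  ring

/-- The coefficients `d` of `1 / √f` satisfy `c * d * d = 1`. -/
theorem inv_sqrt (h : Tay6 l x f c₀ c₁ c₂ c₃ c₄ c₅) (hx : Tendsto x l (𝓝 0)) (hd : 0 < d₀)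
    {e₀ e₁ e₂ e₃ e₄ e₅ : ℝ}
    (i0 : d₀ * d₀ = e₀) (i1 : d₀ * d₁ + d₁ * d₀ = e₁) (i2 : d₀ * d₂ + d₁ * d₁ + d₂ * d₀ = e₂)
    (i3 : d₀ * d₃ + d₁ * d₂ + d₂ * d₁ + d₃ * d₀ = e₃)
    (i4 : d₀ * d₄ + d₁ * d₃ + d₂ * d₂ + d₃ * d₁ + d₄ * d₀ = e₄)
    (i5 : d₀ * d₅ + d₁ * d₄ + d₂ * d₃ + d₃ * d₂ + d₄ * d₁ + d₅ * d₀ = e₅)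
    (h0 : c₀ * e₀ = 1) (h1 : c₀ * e₁ + c₁ * e₀ = 0) (h2 : c₀ * e₂ + c₁ * e₁ + c₂ * e₀ = 0)
    (h3 : c₀ * e₃ + c₁ * e₂ + c₂ * e₁ + c₃ * e₀ = 0)
    (h4 : c₀ * e₄ + c₁ * e₃ + c₂ * e₂ + c₃ * e₁ + c₄ * e₀ = 0)
    (h5 : c₀ * e₅ + c₁ * e₄ + c₂ * e₃ + c₃ * e₂ + c₄ * e₁ + c₅ * e₀ = 0) :
    Tay6 l x (fun t => (Real.sqrt (f t))⁻¹) d₀ d₁ d₂ d₃ d₄ d₅ := by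
  have he : 0 < e₀ := by rw [← i0]; positivity
  have hc : 0 < c₀ := (pos_iff_pos_of_mul_pos (h0 ▸ one_pos)).2 he
  have hp := poly (l := l) (x := x) d₀ d₁ d₂ d₃ d₄ d₅
  have hm := h.inv hx hc.ne' h0 h1 h2 h3 h4 h5
  have hq := (hp.mul hp hx).congr i0 i1 i2 i3 i4 i5
  -- This difference is (f^(−1/2))² minus the square of the candidate. Dividing it by the sum of the
  -- two, whose limit is positive, leaves the difference that is wanted.
  have hdiff := IsBigO.sub hm hq
  have hf := h.tendsto hx
  have hpos := hf.eventually (lt_mem_nhds hc)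
  have hs : Tendsto (fun t => (Real.sqrt (f t))⁻¹ + (d₀ + d₁ * x t + d₂ * x t ^ 2 + d₃ * x t ^ 3 +
      d₄ * x t ^ 4 + d₅ * x t ^ 5)) l (𝓝 ((Real.sqrt c₀)⁻¹ + d₀)) :=
    ((hf.sqrt).inv₀ (Real.sqrt_pos.2 hc).ne').add (hp.tendsto hx)
  have hs0 : 0 < (Real.sqrt c₀)⁻¹ + d₀ := by positivity
  have hspos := hs.eventually (lt_mem_nhds hs0)
  have hb : (fun t => ((Real.sqrt (f t))⁻¹ + (d₀ + d₁ * x t + d₂ * x t ^ 2 + d₃ * x t ^ 3 +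
      d₄ * x t ^ 4 + d₅ * x t ^ 5))⁻¹) =O[l] fun _ => (1:ℝ) := (hs.inv₀ hs0.ne').isBigO_one ℝ
  refine (isBigO_mul_pow hdiff hb).congr' ?_ EventuallyEq.rfl
  filter_upwards [hpos, hspos] with t ht hst
  have hsq : (f t)⁻¹ = (Real.sqrt (f t))⁻¹ ^ 2 := by rw [inv_pow, Real.sq_sqrt ht.le]
  rw [← div_eq_mul_inv, div_eq_iff hst.ne', hsq]
  ring

end Tay6

namespace Tay4

variable {c₀ c₁ c₂ c₃ d₀ d₁ d₂ d₃ : ℝ}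

theorem poly (c₀ c₁ c₂ c₃ : ℝ) :
    Tay4 l x (fun t => c₀ + c₁ * x t + c₂ * x t ^ 2 + c₃ * x t ^ 3) c₀ c₁ c₂ c₃ := by
  simp only [Tay4, sub_self]
  exact isBigO_zero _ _

theorem tendsto (h : Tay4 l x f c₀ c₁ c₂ c₃) (hx : Tendsto x l (𝓝 0)) :
    Tendsto f l (𝓝 c₀) := by
  have h1 : Tendsto (fun t => x t ^ 4) l (𝓝 0) := by simpa using hx.pow 4
  have h2 := h.trans_tendsto h1
  have h3 : Tendsto (fun t => c₀ + c₁ * x t + c₂ * x t ^ 2 + c₃ * x t ^ 3) l (𝓝 c₀) := by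
    have : Tendsto (fun y : ℝ => c₀ + c₁ * y + c₂ * y ^ 2 + c₃ * y ^ 3) (𝓝 0) (𝓝 c₀) := by
      have hc : Continuous fun y : ℝ => c₀ + c₁ * y + c₂ * y ^ 2 + c₃ * y ^ 3 := by fun_prop
      simpa using hc.tendsto 0
    exact this.comp hx
  simpa using h2.add h3

theorem isBigO_one (h : Tay4 l x f c₀ c₁ c₂ c₃) (hx : Tendsto x l (𝓝 0)) :
    f =O[l] fun _ => (1:ℝ) := (h.tendsto hx).isBigO_one ℝ

theorem congr (h : Tay4 l x f c₀ c₁ c₂ c₃) (h0 : c₀ = d₀) (h1 : c₁ = d₁) (h2 : c₂ = d₂)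
    (h3 : c₃ = d₃) : Tay4 l x f d₀ d₁ d₂ d₃ := by
  subst h0 h1 h2 h3; exact h

theorem congr_fun (h : Tay4 l x f c₀ c₁ c₂ c₃) (hfg : ∀ᶠ t in l, g t = f t) :
    Tay4 l x g c₀ c₁ c₂ c₃ :=
  IsBigO.congr' h (hfg.mono fun t ht => by simp only [ht]) EventuallyEq.rfl

theorem add_isBigO (h : Tay4 l x f c₀ c₁ c₂ c₃)
    (hg : (fun t => g t - f t) =O[l] fun t => x t ^ 4) : Tay4 l x g c₀ c₁ c₂ c₃ :=
  (IsBigO.add hg h).congr_left fun t => by ring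

theorem add (h : Tay4 l x f c₀ c₁ c₂ c₃) (h' : Tay4 l x g d₀ d₁ d₂ d₃) :
    Tay4 l x (fun t => f t + g t) (c₀ + d₀) (c₁ + d₁) (c₂ + d₂) (c₃ + d₃) :=
  (IsBigO.add h h').congr_left fun t => by ring

theorem const_mul (h : Tay4 l x f c₀ c₁ c₂ c₃) (k : ℝ) :
    Tay4 l x (fun t => k * f t) (k * c₀) (k * c₁) (k * c₂) (k * c₃) :=
  (IsBigO.const_mul_left h k).congr_left fun t => by ring

theorem mul (h : Tay4 l x f c₀ c₁ c₂ c₃) (h' : Tay4 l x g d₀ d₁ d₂ d₃)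
    (hx : Tendsto x l (𝓝 0)) :
    Tay4 l x (fun t => f t * g t) (c₀ * d₀) (c₀ * d₁ + c₁ * d₀) (c₀ * d₂ + c₁ * d₁ + c₂ * d₀)
      (c₀ * d₃ + c₁ * d₂ + c₂ * d₁ + c₃ * d₀) := by
  have h1 := isBigO_mul_pow h (h'.isBigO_one hx)
  have h2 := isBigO_mul_pow h' ((poly (l := l) (x := x) c₀ c₁ c₂ c₃).isBigO_one hx)
  have hx1 : (fun t => (c₁ * d₃ + c₂ * d₂ + c₃ * d₁) + (c₂ * d₃ + c₃ * d₂) * x t +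
      c₃ * d₃ * x t ^ 2 + 0 * x t ^ 3) =O[l] fun _ => (1:ℝ) := (poly _ _ _ _).isBigO_one hx
  have h3 := isBigO_mul_pow (isBigO_refl (fun t => x t ^ 4) l) hx1
  refine (IsBigO.add (IsBigO.add h1 h2) h3).congr_left fun t => ?_
  ring

theorem inv (h : Tay4 l x f c₀ c₁ c₂ c₃) (hx : Tendsto x l (𝓝 0)) (hc : c₀ ≠ 0)
    (h0 : c₀ * d₀ = 1) (h1 : c₀ * d₁ + c₁ * d₀ = 0) (h2 : c₀ * d₂ + c₁ * d₁ + c₂ * d₀ = 0)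
    (h3 : c₀ * d₃ + c₁ * d₂ + c₂ * d₁ + c₃ * d₀ = 0) :
    Tay4 l x (fun t => (f t)⁻¹) d₀ d₁ d₂ d₃ := by
  have hm := (h.mul (poly d₀ d₁ d₂ d₃) hx).congr h0 h1 h2 h3
  have hf := h.tendsto hx
  have hne := hf.eventually_ne hc
  have hinv : (fun t => (f t)⁻¹) =O[l] fun _ => (1:ℝ) := (hf.inv₀ hc).isBigO_one ℝ
  refine (isBigO_mul_pow hm.neg_left hinv).congr' (hne.mono fun t ht => ?_) EventuallyEq.rfl
  simp only
  field_simp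
  ring

theorem inv_sqrt (h : Tay4 l x f c₀ c₁ c₂ c₃) (hx : Tendsto x l (𝓝 0)) (hd : 0 < d₀)
    {e₀ e₁ e₂ e₃ : ℝ}
    (i0 : d₀ * d₀ = e₀) (i1 : d₀ * d₁ + d₁ * d₀ = e₁) (i2 : d₀ * d₂ + d₁ * d₁ + d₂ * d₀ = e₂)
    (i3 : d₀ * d₃ + d₁ * d₂ + d₂ * d₁ + d₃ * d₀ = e₃)
    (h0 : c₀ * e₀ = 1) (h1 : c₀ * e₁ + c₁ * e₀ = 0) (h2 : c₀ * e₂ + c₁ * e₁ + c₂ * e₀ = 0)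
    (h3 : c₀ * e₃ + c₁ * e₂ + c₂ * e₁ + c₃ * e₀ = 0) :
    Tay4 l x (fun t => (Real.sqrt (f t))⁻¹) d₀ d₁ d₂ d₃ := by
  have he : 0 < e₀ := by rw [← i0]; positivity
  have hc : 0 < c₀ := (pos_iff_pos_of_mul_pos (h0 ▸ one_pos)).2 he
  have hp := poly (l := l) (x := x) d₀ d₁ d₂ d₃
  have hm := h.inv hx hc.ne' h0 h1 h2 h3
  have hq := (hp.mul hp hx).congr i0 i1 i2 i3
  have hdiff := IsBigO.sub hm hq
  have hf := h.tendsto hx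
  have hpos := hf.eventually (lt_mem_nhds hc)
  have hs : Tendsto (fun t => (Real.sqrt (f t))⁻¹ + (d₀ + d₁ * x t + d₂ * x t ^ 2 + d₃ * x t ^ 3)) l
      (𝓝 ((Real.sqrt c₀)⁻¹ + d₀)) :=
    ((hf.sqrt).inv₀ (Real.sqrt_pos.2 hc).ne').add (hp.tendsto hx)
  have hs0 : 0 < (Real.sqrt c₀)⁻¹ + d₀ := by positivity
  have hspos := hs.eventually (lt_mem_nhds hs0)
  have hb : (fun t => ((Real.sqrt (f t))⁻¹ + (d₀ + d₁ * x t + d₂ * x t ^ 2 + d₃ * x t ^ 3))⁻¹)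
      =O[l] fun _ => (1:ℝ) := (hs.inv₀ hs0.ne').isBigO_one ℝ
  refine (isBigO_mul_pow hdiff hb).congr' ?_ EventuallyEq.rfl
  filter_upwards [hpos, hspos] with t ht hst
  have hsq : (f t)⁻¹ = (Real.sqrt (f t))⁻¹ ^ 2 := by rw [inv_pow, Real.sq_sqrt ht.le]
  rw [← div_eq_mul_inv, div_eq_iff hst.ne', hsq]
  ring

/-- An expansion in `y = x²` as an expansion in `x`. -/
theorem tay6 {y : α → ℝ} (h : Tay4 l y f c₀ c₁ c₂ c₃) (hx : Tendsto x l (𝓝 0))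
    (hy : ∀ t, y t = x t ^ 2) : Tay6 l x f c₀ 0 c₁ 0 c₂ 0 := by
  have h1 : (fun t => c₃ + 0 * x t + 0 * x t ^ 2 + 0 * x t ^ 3 + 0 * x t ^ 4 + 0 * x t ^ 5)
      =O[l] fun _ => (1:ℝ) := (Tay6.poly _ _ _ _ _ _).isBigO_one hx
  have h2 := isBigO_mul_pow (isBigO_refl (fun t => x t ^ 6) l) h1
  have h3 : (fun t => y t ^ 4) =O[l] fun t => x t ^ 6 := by
    have h4 : (fun t => x t ^ 2) =O[l] fun _ => (1:ℝ) := (hx.pow 2).isBigO_one ℝ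
    refine (isBigO_mul_pow (isBigO_refl (fun t => x t ^ 6) l) h4).congr_left fun t => ?_
    rw [hy]; ring
  refine ((IsBigO.trans h h3).add h2).congr_left fun t => ?_
  simp only [hy]
  ring

end Tay4

end

/-! ### The expansion of `1 / √(1 + x t + y t²)` -/

def isq₁ (x : ℝ) : ℝ := -x / 2

def isq₂ (x y : ℝ) : ℝ := -y / 2 + 3 / 8 * x ^ 2

def isq₃ (x y : ℝ) : ℝ := 3 / 4 * x * y - 5 / 16 * x ^ 3

def isq₄ (x y : ℝ) : ℝ := 3 / 8 * y ^ 2 - 15 / 16 * x ^ 2 * y + 35 / 128 * x ^ 4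

def isq₅ (x y : ℝ) : ℝ := -15 / 16 * x * y ^ 2 + 35 / 32 * x ^ 3 * y - 63 / 256 * x ^ 5

/-- The Taylor polynomial of degree five of `1 / √(1 + x t + y t²)` in `t`. -/
def isqTaylor (x y t : ℝ) : ℝ :=
  1 + isq₁ x * t + isq₂ x y * t ^ 2 + isq₃ x y * t ^ 3 + isq₄ x y * t ^ 4 + isq₅ x y * t ^ 5

/-- The quotient by `t⁶` of the remainder of the square of the Taylor polynomial. -/
def isqRem (x y t : ℝ) : ℝ :=
  (2 * isq₁ x * isq₅ x y + 2 * isq₂ x y * isq₄ x y + isq₃ x y ^ 2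
      + x * (2 * isq₅ x y + 2 * isq₁ x * isq₄ x y + 2 * isq₂ x y * isq₃ x y)
      + y * (2 * isq₄ x y + 2 * isq₁ x * isq₃ x y + isq₂ x y ^ 2))
    + (2 * isq₂ x y * isq₅ x y + 2 * isq₃ x y * isq₄ x y
      + x * (2 * isq₁ x * isq₅ x y + 2 * isq₂ x y * isq₄ x y + isq₃ x y ^ 2)
      + y * (2 * isq₅ x y + 2 * isq₁ x * isq₄ x y + 2 * isq₂ x y * isq₃ x y)) * t
    + (2 * isq₃ x y * isq₅ x y + isq₄ x y ^ 2
      + x * (2 * isq₂ x y * isq₅ x y + 2 * isq₃ x y * isq₄ x y)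
      + y * (2 * isq₁ x * isq₅ x y + 2 * isq₂ x y * isq₄ x y + isq₃ x y ^ 2)) * t ^ 2
    + (2 * isq₄ x y * isq₅ x y + x * (2 * isq₃ x y * isq₅ x y + isq₄ x y ^ 2)
      + y * (2 * isq₂ x y * isq₅ x y + 2 * isq₃ x y * isq₄ x y)) * t ^ 3
    + (isq₅ x y ^ 2 + x * (2 * isq₄ x y * isq₅ x y)
      + y * (2 * isq₃ x y * isq₅ x y + isq₄ x y ^ 2)) * t ^ 4
    + (x * isq₅ x y ^ 2 + y * (2 * isq₄ x y * isq₅ x y)) * t ^ 5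
    + y * isq₅ x y ^ 2 * t ^ 6

theorem isqTaylor_sq (x y t : ℝ) :
    (1 + x * t + y * t ^ 2) * isqTaylor x y t ^ 2 = 1 + isqRem x y t * t ^ 6 := by
  simp only [isqTaylor, isqRem, isq₁, isq₂, isq₃, isq₄, isq₅]
  ring

/-- The bound is uniform in x and y because both will vary with the parameter. If f = 1 + xt + yt²
and P is its polynomial, then fP² = 1 + rem · t⁶ gives f^(−1/2) − P = −rem · t⁶/(√f (1 + √f P)), and
compactness bounds every factor. -/
theorem exists_inv_sqrt_expansion (M : ℝ) : ∃ C δ : ℝ, 0 ≤ C ∧ 0 < δ ∧ ∀ x y t : ℝ, |x| ≤ M →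
    |y| ≤ M → |t| ≤ δ → 0 < 1 + x * t + y * t ^ 2 ∧
      |(Real.sqrt (1 + x * t + y * t ^ 2))⁻¹ - isqTaylor x y t| ≤ C * |t| ^ 6 := by
  have hK : IsCompact (Set.Icc (-M) M ×ˢ Set.Icc (-M) M ×ˢ Set.Icc (-1:ℝ) 1) :=
    isCompact_Icc.prod (isCompact_Icc.prod isCompact_Icc)
  obtain ⟨C₁, hC₁⟩ := hK.exists_bound_of_continuousOn
    (f := fun z : ℝ × ℝ × ℝ => isqRem z.1 z.2.1 z.2.2)
    (by simp only [isqRem, isq₁, isq₂, isq₃, isq₄, isq₅]; fun_prop)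
  obtain ⟨C₂, hC₂⟩ := hK.exists_bound_of_continuousOn
    (f := fun z : ℝ × ℝ × ℝ => isq₁ z.1 + isq₂ z.1 z.2.1 * z.2.2 + isq₃ z.1 z.2.1 * z.2.2 ^ 2 +
      isq₄ z.1 z.2.1 * z.2.2 ^ 3 + isq₅ z.1 z.2.1 * z.2.2 ^ 4)
    (by simp only [isq₁, isq₂, isq₃, isq₄, isq₅]; fun_prop)
  obtain ⟨C₃, hC₃⟩ := hK.exists_bound_of_continuousOn
    (f := fun z : ℝ × ℝ × ℝ => z.1 + z.2.1 * z.2.2) (by fun_prop)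
  have key : ∀ {b B t : ℝ}, |b| ≤ B → |t| ≤ 1 / (2 * (|B| + 1)) → |b * t| ≤ 1 / 2 := by
    intro b B t hb ht
    have h1 : |b| ≤ |B| + 1 := hb.trans ((le_abs_self B).trans (by linarith))
    rw [abs_mul]
    calc |b| * |t| ≤ (|B| + 1) * (1 / (2 * (|B| + 1))) := by gcongr
      _ = 1 / 2 := by have : |B| + 1 ≠ 0 := by positivity
                      field_simp
  -- The radius keeps f − 1 and P − 1 within 1/2, so the denominator is at least 1/2; this is the
  -- factor 2.
  refine ⟨2 * |C₁|, min 1 (min (1 / (2 * (|C₂| + 1))) (1 / (2 * (|C₃| + 1)))), by positivity,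
    by positivity, fun x y t hx hy ht => ?_⟩
  obtain ⟨ht1, ht2, ht3⟩ : |t| ≤ 1 ∧ |t| ≤ 1 / (2 * (|C₂| + 1)) ∧ |t| ≤ 1 / (2 * (|C₃| + 1)) := by
    simpa only [le_min_iff] using ht
  have hz : (x, y, t) ∈ Set.Icc (-M) M ×ˢ Set.Icc (-M) M ×ˢ Set.Icc (-1:ℝ) 1 :=
    ⟨abs_le.1 hx, abs_le.1 hy, abs_le.1 ht1⟩
  have hR := hC₁ _ hz
  have hP := abs_le.1 (key (hC₂ _ hz) ht2)
  have hf := abs_le.1 (key (hC₃ _ hz) ht3)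
  simp only [Real.norm_eq_abs] at hR hP hf
  have hf0 : 1 / 2 ≤ 1 + x * t + y * t ^ 2 := by linarith [hf.1]
  have hP0 : 1 / 2 ≤ isqTaylor x y t := by simp only [isqTaylor]; linarith [hP.1]
  refine ⟨by linarith, ?_⟩
  have hsq := isqTaylor_sq x y t
  set f := 1 + x * t + y * t ^ 2
  set P := isqTaylor x y t
  have hfp : 0 < f := by linarith
  have hs : 1 / 2 ≤ Real.sqrt f := by
    refine Real.le_sqrt_of_sq_le ?_
    linarith
  have hsf := Real.sq_sqrt hfp.le
  have hs0 : 0 < Real.sqrt f := by linarith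
  have e1 : (Real.sqrt f)⁻¹ - P = -(isqRem x y t * t ^ 6) / (Real.sqrt f * (1 + Real.sqrt f * P)) :=
      by
    have : 0 < 1 + Real.sqrt f * P := by positivity
    rw [eq_div_iff (by positivity)]
    have : isqRem x y t * t ^ 6 = Real.sqrt f ^ 2 * P ^ 2 - 1 := by rw [hsf]; linarith
    rw [this]
    field_simp
    ring
  rw [e1, abs_div, abs_neg, abs_mul, abs_pow]
  have hden : 1 / 2 ≤ |Real.sqrt f * (1 + Real.sqrt f * P)| := by
    have : 0 < Real.sqrt f * P := by positivity
    rw [abs_of_pos (by positivity)]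
    nlinarith
  rw [div_le_iff₀ (by linarith)]
  calc |isqRem x y t| * |t| ^ 6 ≤ |C₁| * |t| ^ 6 := by
        exact mul_le_mul_of_nonneg_right (hR.trans (le_abs_self _)) (by positivity)
    _ = 2 * |C₁| * |t| ^ 6 * (1 / 2) := by ring
    _ ≤ _ := by gcongr

/-! ### Integrals of polynomials in the cosine -/

/-- A primitive of the polynomial `∑ pₖ cosᵏ`. -/
def cosPrim (p₀ p₁ p₂ p₃ p₄ p₅ p₆ p₇ p₈ x : ℝ) : ℝ :=
  (p₀ + p₂ / 2 + 3 * p₄ / 8 + 5 * p₆ / 16 + 35 * p₈ / 128) * x +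
    Real.sin x * (p₁ + p₂ * Real.cos x / 2 + p₃ * (2 + Real.cos x ^ 2) / 3
      + p₄ * (Real.cos x ^ 3 / 4 + 3 * Real.cos x / 8)
      + p₅ * (Real.cos x ^ 4 / 5 + 4 * Real.cos x ^ 2 / 15 + 8 / 15)
      + p₆ * (Real.cos x ^ 5 / 6 + 5 * Real.cos x ^ 3 / 24 + 5 * Real.cos x / 16)
      + p₇ * (Real.cos x ^ 6 / 7 + 6 * Real.cos x ^ 4 / 35 + 8 * Real.cos x ^ 2 / 35 + 16 / 35)
      + p₈ * (Real.cos x ^ 7 / 8 + 7 * Real.cos x ^ 5 / 48 + 35 * Real.cos x ^ 3 / 192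
        + 35 * Real.cos x / 128))

/-- Degree eight is what the action needs: sin²x (A − r cos x) times a Taylor polynomial of degree
five. -/
theorem integral_cos_poly (p₀ p₁ p₂ p₃ p₄ p₅ p₆ p₇ p₈ b c : ℝ) :
    ∫ x in b..c, (p₀ + p₁ * Real.cos x + p₂ * Real.cos x ^ 2 + p₃ * Real.cos x ^ 3
        + p₄ * Real.cos x ^ 4 + p₅ * Real.cos x ^ 5 + p₆ * Real.cos x ^ 6 + p₇ * Real.cos x ^ 7
        + p₈ * Real.cos x ^ 8) = cosPrim p₀ p₁ p₂ p₃ p₄ p₅ p₆ p₇ p₈ c -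
          cosPrim p₀ p₁ p₂ p₃ p₄ p₅ p₆ p₇ p₈ b := by
  refine intervalIntegral.integral_eq_sub_of_hasDerivAt
    (f := cosPrim p₀ p₁ p₂ p₃ p₄ p₅ p₆ p₇ p₈) (fun x _ => ?_)
    (Continuous.intervalIntegrable (by fun_prop) _ _)
  have hc := Real.hasDerivAt_cos x
  have hq : HasDerivAt (fun x : ℝ => p₁ + p₂ * x / 2 + p₃ * (2 + x ^ 2) / 3
        + p₄ * (x ^ 3 / 4 + 3 * x / 8)
        + p₅ * (x ^ 4 / 5 + 4 * x ^ 2 / 15 + 8 / 15)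
        + p₆ * (x ^ 5 / 6 + 5 * x ^ 3 / 24 + 5 * x / 16)
        + p₇ * (x ^ 6 / 7 + 6 * x ^ 4 / 35 + 8 * x ^ 2 / 35 + 16 / 35)
        + p₈ * (x ^ 7 / 8 + 7 * x ^ 5 / 48 + 35 * x ^ 3 / 192 + 35 * x / 128))
      (p₂ / 2 + p₃ * (2 * Real.cos x) / 3 + p₄ * (3 * Real.cos x ^ 2 / 4 + 3 / 8)
        + p₅ * (4 * Real.cos x ^ 3 / 5 + 8 * Real.cos x / 15)
        + p₆ * (5 * Real.cos x ^ 4 / 6 + 15 * Real.cos x ^ 2 / 24 + 5 / 16)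
        + p₇ * (6 * Real.cos x ^ 5 / 7 + 24 * Real.cos x ^ 3 / 35 + 16 * Real.cos x / 35)
        + p₈ * (7 * Real.cos x ^ 6 / 8 + 35 * Real.cos x ^ 4 / 48 + 105 * Real.cos x ^ 2 / 192
          + 35 / 128)) (Real.cos x) := by
    have i := hasDerivAt_id (Real.cos x)
    have p : ∀ n : ℕ, HasDerivAt (fun x : ℝ => x ^ n) (n * Real.cos x ^ (n - 1)) (Real.cos x) :=
      fun n => hasDerivAt_pow n _
    refine HasDerivAt.congr_deriv (((((((((i.const_mul p₂).div_const 2).const_add p₁).add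
      ((((p 2).const_add 2).const_mul p₃).div_const 3)).add
      ((((p 3).div_const 4).add ((i.const_mul 3).div_const 8)).const_mul p₄)).add
      (((((p 4).div_const 5).add (((p 2).const_mul 4).div_const 15)).add_const (8/15)).const_mul
        p₅)).add
      (((((p 5).div_const 6).add (((p 3).const_mul 5).div_const 24)).add
        ((i.const_mul 5).div_const 16)).const_mul p₆)).add
      ((((((p 6).div_const 7).add (((p 4).const_mul 6).div_const 35)).add
        (((p 2).const_mul 8).div_const 35)).add_const (16/35)).const_mul p₇)).add
      ((((((p 7).div_const 8).add (((p 5).const_mul 7).div_const 48)).add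
        (((p 3).const_mul 35).div_const 192)).add ((i.const_mul 35).div_const 128)).const_mul p₈))
      ?_
    norm_num
    ring
  have h := ((hasDerivAt_id x).const_mul (p₀ + p₂ / 2 + 3 * p₄ / 8 + 5 * p₆ / 16 +
    35 * p₈ / 128)).add ((Real.hasDerivAt_sin x).mul (hq.comp x hc))
  refine HasDerivAt.congr_deriv h ?_
  have hs : Real.sin x * -Real.sin x = Real.cos x ^ 2 - 1 := by
    linarith [Real.sin_sq_add_cos_sq x]
  simp only [Function.comp_apply]
  rw [show ∀ d s : ℝ, s * (d * -s) = d * (s * -s) from fun d s => by ring, hs]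
  ring

/-! ### The integrals over the angle -/

theorem exists_integral_expansion (M : ℝ) : ∃ C δ : ℝ, 0 ≤ C ∧ 0 < δ ∧ ∀ u v t : ℝ, |u| ≤ M →
    |v| ≤ M → |t| ≤ δ → ∀ (b c G : ℝ) (g : ℝ → ℝ), Continuous g → (∀ x, |g x| ≤ G) →
      |(∫ x in b..c, g x * (Real.sqrt (1 + u * (t * Real.cos x) + v * (t * Real.cos x) ^ 2))⁻¹) -
        ∫ x in b..c, g x * isqTaylor u v (t * Real.cos x)| ≤ G * C * |t| ^ 6 * |c - b| := by
  obtain ⟨C, δ, hC, hδ, h⟩ := exists_inv_sqrt_expansion M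
  refine ⟨C, δ, hC, hδ, fun u v t hu hv ht b c G g hg hG => ?_⟩
  have hG0 : 0 ≤ G := (abs_nonneg _).trans (hG 0)
  have htc : ∀ x, |t * Real.cos x| ≤ |t| := fun x => by
    rw [abs_mul]
    exact mul_le_of_le_one_right (abs_nonneg t) (Real.abs_cos_le_one x)
  have hx := fun x => h u v (t * Real.cos x) hu hv ((htc x).trans ht)
  have c1 : Continuous fun x => g x *
      (Real.sqrt (1 + u * (t * Real.cos x) + v * (t * Real.cos x) ^ 2))⁻¹ :=
    hg.mul (Continuous.inv₀ (by fun_prop) fun x => (Real.sqrt_pos.2 (hx x).1).ne')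
  have c2 : Continuous fun x => g x * isqTaylor u v (t * Real.cos x) := by
    unfold isqTaylor
    fun_prop
  rw [← intervalIntegral.integral_sub (c1.intervalIntegrable _ _) (c2.intervalIntegrable _ _)]
  refine intervalIntegral.norm_integral_le_of_norm_le_const (E := ℝ) fun x _ => ?_
  rw [← mul_sub, Real.norm_eq_abs, abs_mul, mul_assoc]
  refine mul_le_mul (hG x) ((hx x).2.trans ?_) (abs_nonneg _) hG0
  exact mul_le_mul_of_nonneg_left (pow_le_pow_left₀ (abs_nonneg _) (htc x) 6) hC

section angle

variable {s₁ s₂ s₃ s₄ u v t : ℝ}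

/-- The factorization of the angular velocity. -/
theorem inv_angleω_eq (h12 : s₁ < s₂) (h23 : s₂ < s₃) (h34 : s₃ < s₄)
    (hu : u * t * (((s₂ + s₃) / 2 - s₁) * (s₄ - (s₂ + s₃) / 2)) =
      (s₃ - s₂) / 2 * (((s₂ + s₃) / 2 - s₁) - (s₄ - (s₂ + s₃) / 2)))
    (hv : v * t ^ 2 * (((s₂ + s₃) / 2 - s₁) * (s₄ - (s₂ + s₃) / 2)) = -((s₃ - s₂) / 2) ^ 2)
    (x : ℝ) : Real.sqrt (((s₂ + s₃) / 2 - s₁) * (s₄ - (s₂ + s₃) / 2)) * (1 / angleω s₁ s₂ s₃ s₄ x) =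
      (Real.sqrt (1 + u * (t * Real.cos x) + v * (t * Real.cos x) ^ 2))⁻¹ := by
  have hAB : 0 < ((s₂ + s₃) / 2 - s₁) * (s₄ - (s₂ + s₃) / 2) :=
    mul_pos (by linarith) (by linarith)
  have e : (angleS s₂ s₃ x - s₁) * (s₄ - angleS s₂ s₃ x) =
      (((s₂ + s₃) / 2 - s₁) * (s₄ - (s₂ + s₃) / 2)) *
        (1 + u * (t * Real.cos x) + v * (t * Real.cos x) ^ 2) := by
    unfold angleS
    linear_combination (-Real.cos x) * hu - Real.cos x ^ 2 * hv
  have hs := (Real.sqrt_pos.2 hAB).ne'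
  rw [angleω, e, Real.sqrt_mul hAB.le, one_div, mul_inv, mul_inv_cancel_left₀ hs]

theorem cosPrim_two_pi (p₀ p₁ p₂ p₃ p₄ p₅ p₆ p₇ p₈ : ℝ) :
    cosPrim p₀ p₁ p₂ p₃ p₄ p₅ p₆ p₇ p₈ (2 * Real.pi) - cosPrim p₀ p₁ p₂ p₃ p₄ p₅ p₆ p₇ p₈ 0 =
      2 * Real.pi * (p₀ + p₂ / 2 + 3 * p₄ / 8 + 5 * p₆ / 16 + 35 * p₈ / 128) := by
  simp only [cosPrim, Real.sin_two_pi, Real.sin_zero]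
  ring

theorem integral_angleω_eq (h12 : s₁ < s₂) (h23 : s₂ < s₃) (h34 : s₃ < s₄)
    (hu : u * t * (((s₂ + s₃) / 2 - s₁) * (s₄ - (s₂ + s₃) / 2)) =
      (s₃ - s₂) / 2 * (((s₂ + s₃) / 2 - s₁) - (s₄ - (s₂ + s₃) / 2)))
    (hv : v * t ^ 2 * (((s₂ + s₃) / 2 - s₁) * (s₄ - (s₂ + s₃) / 2)) = -((s₃ - s₂) / 2) ^ 2)
    (g : ℝ → ℝ) (b c : ℝ) :
    Real.sqrt (((s₂ + s₃) / 2 - s₁) * (s₄ - (s₂ + s₃) / 2)) * ∫ x in b..c, g x * (1 / angleω s₁ s₂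
        s₃ s₄ x) =
      ∫ x in b..c, g x *
        (Real.sqrt (1 + u * (t * Real.cos x) + v * (t * Real.cos x) ^ 2))⁻¹ := by
  rw [← intervalIntegral.integral_const_mul]
  refine intervalIntegral.integral_congr fun x _ => ?_
  rw [← inv_angleω_eq h12 h23 h34 hu hv]
  ring

theorem integral_isqTaylor (b c : ℝ) :
    ∫ x in b..c, isqTaylor u v (t * Real.cos x) =
      cosPrim 1 (isq₁ u * t) (isq₂ u v * t ^ 2) (isq₃ u v * t ^ 3) (isq₄ u v * t ^ 4)
        (isq₅ u v * t ^ 5) 0 0 0 c -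
      cosPrim 1 (isq₁ u * t) (isq₂ u v * t ^ 2) (isq₃ u v * t ^ 3) (isq₄ u v * t ^ 4)
        (isq₅ u v * t ^ 5) 0 0 0 b := by
  rw [← integral_cos_poly]
  refine intervalIntegral.integral_congr fun x _ => ?_
  simp only [isqTaylor]
  ring

/-- Over a full turn only even powers of the cosine contribute, so the odd coefficients drop out. -/
theorem exists_anglePeriod_expansion (M : ℝ) : ∃ C δ : ℝ, 0 < δ ∧
    ∀ s₁ s₂ s₃ s₄ u v t : ℝ, s₁ < s₂ → s₂ < s₃ → s₃ < s₄ →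
    u * t * (((s₂ + s₃) / 2 - s₁) * (s₄ - (s₂ + s₃) / 2)) =
      (s₃ - s₂) / 2 * (((s₂ + s₃) / 2 - s₁) - (s₄ - (s₂ + s₃) / 2)) →
    v * t ^ 2 * (((s₂ + s₃) / 2 - s₁) * (s₄ - (s₂ + s₃) / 2)) = -((s₃ - s₂) / 2) ^ 2 →
    |u| ≤ M → |v| ≤ M → |t| ≤ δ →
    |Real.sqrt (((s₂ + s₃) / 2 - s₁) * (s₄ - (s₂ + s₃) / 2)) * anglePeriod s₁ s₂ s₃ s₄ -
      2 * Real.pi * (1 + isq₂ u v / 2 * t ^ 2 + 3 * isq₄ u v / 8 * t ^ 4)| ≤ C * |t| ^ 6 := by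
  obtain ⟨C, δ, hC, hδ, h⟩ := exists_integral_expansion M
  refine ⟨C * |2 * Real.pi|, δ, hδ, fun s₁ s₂ s₃ s₄ u v t h12 h23 h34 hu hv hu' hv' ht => ?_⟩
  have := h u v t hu' hv' ht 0 (2 * Real.pi) 1 (fun _ => 1) continuous_const (by simp)
  rw [← integral_angleω_eq h12 h23 h34 hu hv] at this
  simp only [one_mul, sub_zero] at this
  rw [integral_isqTaylor, cosPrim_two_pi] at this
  rw [anglePeriod]
  convert this using 1
  · congr 1
    ring
  · ring

/-- The primitive's sine terms vanish at π; at the upper end the cosine is −X and the sine −√(1 −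
X²), hence the alternating signs. -/
theorem exists_angleStep_expansion (M : ℝ) : ∃ C δ : ℝ, 0 < δ ∧
    ∀ s₁ s₂ s₃ s₄ u v t X : ℝ, s₁ < s₂ → s₂ < s₃ → s₃ < s₄ →
    u * t * (((s₂ + s₃) / 2 - s₁) * (s₄ - (s₂ + s₃) / 2)) =
      (s₃ - s₂) / 2 * (((s₂ + s₃) / 2 - s₁) - (s₄ - (s₂ + s₃) / 2)) →
    v * t ^ 2 * (((s₂ + s₃) / 2 - s₁) * (s₄ - (s₂ + s₃) / 2)) = -((s₃ - s₂) / 2) ^ 2 →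
    |u| ≤ M → |v| ≤ M → |t| ≤ δ →
    -1 ≤ X → X ≤ 1 →
    |Real.sqrt (((s₂ + s₃) / 2 - s₁) * (s₄ - (s₂ + s₃) / 2)) *
        (∫ x in Real.pi..Real.pi + Real.arccos X, 1 / angleω s₁ s₂ s₃ s₄ x) -
      (Real.arccos X * (1 + isq₂ u v / 2 * t ^ 2 + 3 * isq₄ u v / 8 * t ^ 4) +
        Real.sqrt (1 - X ^ 2) * (-(isq₁ u * t) + isq₂ u v * t ^ 2 * X / 2
          - isq₃ u v * t ^ 3 * (2 + X ^ 2) / 3 + isq₄ u v * t ^ 4 * (X ^ 3 / 4 + 3 * X / 8)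
          - isq₅ u v * t ^ 5 * (X ^ 4 / 5 + 4 * X ^ 2 / 15 + 8 / 15)))| ≤ C * |t| ^ 6 := by
  obtain ⟨C, δ, hC, hδ, h⟩ := exists_integral_expansion M
  refine ⟨C * Real.pi, δ, hδ, fun s₁ s₂ s₃ s₄ u v t X h12 h23 h34 hu hv hu' hv' ht hX hX' => ?_⟩
  have := h u v t hu' hv' ht Real.pi (Real.pi + Real.arccos X) 1 (fun _ => 1) continuous_const
    (by simp)
  rw [← integral_angleω_eq h12 h23 h34 hu hv] at this
  simp only [one_mul, add_sub_cancel_left] at this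
  rw [integral_isqTaylor, abs_of_nonneg (Real.arccos_nonneg X)] at this
  simp only [cosPrim, Real.sin_pi, add_comm Real.pi, Real.sin_add_pi, Real.cos_add_pi,
    Real.sin_arccos, Real.cos_arccos hX hX'] at this
  rw [add_comm Real.pi]
  refine le_trans (le_of_eq ?_) (this.trans ?_)
  · congr 1
    ring
  · rw [mul_right_comm]
    exact mul_le_mul_of_nonneg_right (mul_le_mul_of_nonneg_left (Real.arccos_le_pi X) hC)
      (by positivity)

/-- With A = (s₂ + s₃)/2 − s₁ and r = (s₃ − s₂)/2 the integrand is r² sin²x (A − r cos x)/ω. The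
factor r² is kept in the error: it is of order t² later and improves t⁶ to t⁸. -/
theorem exists_angleAction_expansion (M : ℝ) : ∃ C δ : ℝ, 0 < δ ∧
    ∀ s₁ s₂ s₃ s₄ u v t : ℝ, s₁ < s₂ → s₂ < s₃ → s₃ < s₄ →
    u * t * (((s₂ + s₃) / 2 - s₁) * (s₄ - (s₂ + s₃) / 2)) =
      (s₃ - s₂) / 2 * (((s₂ + s₃) / 2 - s₁) - (s₄ - (s₂ + s₃) / 2)) →
    v * t ^ 2 * (((s₂ + s₃) / 2 - s₁) * (s₄ - (s₂ + s₃) / 2)) = -((s₃ - s₂) / 2) ^ 2 →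
    |u| ≤ M → |v| ≤ M → |t| ≤ δ →
    |4 * Real.sqrt (((s₂ + s₃) / 2 - s₁) * (s₄ - (s₂ + s₃) / 2)) * angleAction s₁ s₂ s₃ s₄ -
      ((s₃ - s₂) / 2) ^ 2 * (((s₂ + s₃) / 2 - s₁) *
          (1 + isq₂ u v / 4 * t ^ 2 + isq₄ u v / 8 * t ^ 4) -
        (s₃ - s₂) / 2 * (isq₁ u / 4 * t + isq₃ u v / 8 * t ^ 3 + 5 * isq₅ u v / 64 * t ^ 5))| ≤
      C * ((s₃ - s₂) / 2) ^ 2 * ((s₂ + s₃) / 2 - s₁) * |t| ^ 6 := by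
  obtain ⟨C, δ, hC, hδ, h⟩ := exists_integral_expansion M
  refine ⟨4 * C, δ, hδ, fun s₁ s₂ s₃ s₄ u v t h12 h23 h34 hu hv hu' hv' ht => ?_⟩
  have hr : 0 < (s₃ - s₂) / 2 := by linarith
  have hrA : (s₃ - s₂) / 2 ≤ (s₂ + s₃) / 2 - s₁ := by linarith
  have := h u v t hu' hv' ht 0 (2 * Real.pi) (2 * ((s₂ + s₃) / 2 - s₁))
    (fun x => Real.sin x ^ 2 * ((s₂ + s₃) / 2 - s₁ - (s₃ - s₂) / 2 * Real.cos x)) (by fun_prop)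
    (fun x => by
      have h1 : Real.sin x ^ 2 ≤ 1 := Real.sin_sq_le_one x
      have h2 := angleS_mem h23 x
      rw [show (s₂ + s₃) / 2 - s₁ - (s₃ - s₂) / 2 * Real.cos x = angleS s₂ s₃ x - s₁ by
        unfold angleS; ring, abs_of_nonneg (mul_nonneg (sq_nonneg _) (by linarith))]
      calc _ ≤ 1 * (angleS s₂ s₃ x - s₁) := mul_le_mul_of_nonneg_right h1 (by linarith)
        _ ≤ _ := by linarith)
  rw [← integral_angleω_eq h12 h23 h34 hu hv] at this
  generalize hr' : (s₃ - s₂) / 2 = r at *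
  generalize hA' : (s₂ + s₃) / 2 - s₁ = A at *
  have e1 : angleAction s₁ s₂ s₃ s₄ = r ^ 2 / (4 * Real.pi) * ∫ x in (0:ℝ)..2 * Real.pi,
      Real.sin x ^ 2 * (A - r * Real.cos x) * (1 / angleω s₁ s₂ s₃ s₄ x) := by
    rw [angleAction, ← intervalIntegral.integral_const_mul, ← intervalIntegral.integral_const_mul]
    refine intervalIntegral.integral_congr fun x _ => ?_
    have hω := angleω_pos h12 h23 h34 x
    have hω2 := angleω_sq h12 h23 h34 x
    have hp := (angle_pos h12 h23 h34 x).2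
    have e3 : A - r * Real.cos x = angleS s₂ s₃ x - s₁ := by
      rw [← hA', ← hr', angleS]; ring
    simp only [angleD]
    rw [hr', e3]
    have : angleω s₁ s₂ s₃ s₄ x / (s₄ - angleS s₂ s₃ x) =
        (angleS s₂ s₃ x - s₁) * (1 / angleω s₁ s₂ s₃ s₄ x) := by
      rw [mul_one_div, div_eq_div_iff hp.ne' hω.ne', ← hω2]; ring
    rw [mul_div_assoc, this]
    field_simp
  have e2 : (∫ x in (0:ℝ)..2 * Real.pi, Real.sin x ^ 2 * (A - r * Real.cos x) *
      isqTaylor u v (t * Real.cos x)) = Real.pi * (A * (1 + isq₂ u v / 4 * t ^ 2 +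
        isq₄ u v / 8 * t ^ 4) - r * (isq₁ u / 4 * t + isq₃ u v / 8 * t ^ 3 +
        5 * isq₅ u v / 64 * t ^ 5)) := by
    have e3 := integral_cos_poly A (A * (isq₁ u * t) - r) (A * (isq₂ u v * t ^ 2) - r * (isq₁ u * t)
        - A)
      (A * (isq₃ u v * t ^ 3) - r * (isq₂ u v * t ^ 2) - (A * (isq₁ u * t) - r))
      (A * (isq₄ u v * t ^ 4) - r * (isq₃ u v * t ^ 3) - (A * (isq₂ u v * t ^ 2) - r * (isq₁ u *
      t)))
      (A * (isq₅ u v * t ^ 5) - r * (isq₄ u v * t ^ 4) - (A * (isq₃ u v * t ^ 3) - r * (isq₂ u v * t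
      ^ 2)))
      (-(r * (isq₅ u v * t ^ 5)) - (A * (isq₄ u v * t ^ 4) - r * (isq₃ u v * t ^ 3)))
      (-(A * (isq₅ u v * t ^ 5) - r * (isq₄ u v * t ^ 4))) (r * (isq₅ u v * t ^ 5)) 0 (2 * Real.pi)
    rw [cosPrim_two_pi] at e3
    refine Eq.trans (intervalIntegral.integral_congr fun x _ => ?_) (e3.trans ?_)
    · simp only [isqTaylor, Real.sin_sq]
      ring
    · ring
  rw [e2] at this
  rw [e1]
  have hpi := Real.pi_pos
  have e4 : ∀ s I K : ℝ, 4 * s * (r ^ 2 / (4 * Real.pi) * I) - r ^ 2 * K =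
      r ^ 2 / Real.pi * (s * I - Real.pi * K) := fun s I K => by field_simp
  rw [e4, abs_mul, abs_of_pos (by positivity : 0 < r ^ 2 / Real.pi)]
  calc _ ≤ r ^ 2 / Real.pi * (2 * A * C * |t| ^ 6 * |2 * Real.pi - 0|) := by gcongr
    _ = _ := by
      rw [sub_zero, abs_of_pos Real.two_pi_pos]
      field_simp
      ring

end angle

/-! ### A rational parametrization of the roots -/

/-- The vanishing of the sum of pairwise products is a conic in the ratios of the roots, hence
rational; t = −(s₂ + s₃)/(s₃ − s₂), and the sum of the roots fixes the scale. Replacing t by −t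
exchanges s₂ and s₃. -/
def paramS₁ (a t : ℝ) : ℝ := -((2 - a) * (1 - t ^ 2)) / (1 + 3 * t ^ 2)

def paramS₂ (a t : ℝ) : ℝ := -(2 * (2 - a) * t * (1 + t)) / (1 + 3 * t ^ 2)

def paramS₃ (a t : ℝ) : ℝ := 2 * (2 - a) * t * (1 - t) / (1 + 3 * t ^ 2)

def paramE (a t : ℝ) : ℝ := (2 - a) ^ 3 * t ^ 2 * (1 - t ^ 2) ^ 2 / (1 + 3 * t ^ 2) ^ 3

theorem paramS_sextRoots {a t : ℝ} (ha : a < 2) (ht : 0 < t) (ht' : t < 1 / 3)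
    (h4 : paramS₃ a t < 2 + a) :
    SextRoots a (paramE a t) (paramS₁ a t) (paramS₂ a t) (paramS₃ a t) := by
  have hN : 0 < 1 + 3 * t ^ 2 := by positivity
  have hβ : 0 < 2 - a := by linarith
  refine ⟨?_, ?_, h4, ?_, ?_, ?_⟩
  · unfold paramS₁ paramS₂
    refine div_lt_div_of_pos_right ?_ hN
    -- The bound t < 1/3 is what separates s₁ from s₂.
    have : 0 < (2 - a) * ((1 - 3 * t) * (1 + t)) :=
      mul_pos hβ (mul_pos (by linarith) (by linarith))
    linarith
  · unfold paramS₂ paramS₃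
    refine div_lt_div_of_pos_right ?_ hN
    have : 0 < (2 - a) * t := mul_pos hβ ht
    linarith
  · unfold paramS₁ paramS₂ paramS₃
    field_simp
    ring
  · unfold paramS₁ paramS₂ paramS₃
    field_simp
    ring
  · unfold paramS₁ paramS₂ paramS₃ paramE
    field_simp
    ring

theorem SextRoots.exists_param {a E s₁ s₂ s₃ : ℝ} (h : SextRoots a E s₁ s₂ s₃) (ha : a < 2) :
    ∃ t, 0 < t ∧ t < 1 / 3 ∧ s₁ = paramS₁ a t ∧ s₂ = paramS₂ a t ∧ s₃ = paramS₃ a t ∧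
      E = paramE a t := by
  have hd : 0 < s₃ - s₂ := sub_pos.2 h.lt₂₃
  obtain ⟨t, ht⟩ : ∃ t, t = -(s₂ + s₃) / (s₃ - s₂) := ⟨_, rfl⟩
  have hp : s₂ + s₃ = -t * (s₃ - s₂) := by rw [ht]; field_simp
  have hN : 0 < 1 + 3 * t ^ 2 := by positivity
  have ht0 : 0 < t := ht ▸ div_pos (by linarith [h.sum₂₃_neg ha]) hd
  have e1 : s₁ = -(2 - a) + t * (s₃ - s₂) := by linarith [h.sum]
  have e2 : s₂ = -(1 + t) * (s₃ - s₂) / 2 := by linarith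
  have e3 : s₃ = (1 - t) * (s₃ - s₂) / 2 := by linarith
  have hd2 : (s₃ - s₂) * (1 + 3 * t ^ 2) = 4 * (2 - a) * t := by
    have := h.pairs
    have e4 : s₁ * (s₂ + s₃) + s₂ * s₃ = 0 := by linarith
    generalize s₃ - s₂ = d at *
    rw [hp, e1, e2, e3] at e4
    refine mul_left_cancel₀ hd.ne' ?_
    linarith
  have hd3 : s₃ - s₂ = 4 * (2 - a) * t / (1 + 3 * t ^ 2) := by rw [eq_div_iff hN.ne', hd2]
  have f1 : s₁ = paramS₁ a t := by rw [e1, hd3, paramS₁]; field_simp; ring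
  have f2 : s₂ = paramS₂ a t := by rw [e2, hd3, paramS₂]; field_simp; ring
  have f3 : s₃ = paramS₃ a t := by rw [e3, hd3, paramS₃]; field_simp; ring
  refine ⟨t, ht0, ?_, f1, f2, f3, ?_⟩
  · have h1 := h.lt₁₂
    rw [f1, f2, paramS₁, paramS₂, div_lt_div_iff_of_pos_right hN] at h1
    have h2 : 0 < (2 - a) * ((1 - 3 * t) * (1 + t)) := by linarith
    have h3 := (pos_iff_pos_of_mul_pos h2).1 (by linarith)
    have h4 := (pos_iff_pos_of_mul_pos h3).2 (by linarith)
    linarith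
  · have := h.prod
    rw [f1, f2, f3] at this
    have e4 : paramS₁ a t * paramS₂ a t * paramS₃ a t = 4 * paramE a t := by
      unfold paramS₁ paramS₂ paramS₃ paramE; field_simp; ring
    linarith

/-- Gives t² = O(E): small levels have small parameters. -/
theorem le_paramE {a t : ℝ} (ha : a < 2) (ht : 0 < t) (ht' : t < 1 / 3) :
    (2 - a) ^ 3 / 3 * t ^ 2 ≤ paramE a t := by
  have hβ : 0 < (2 - a) ^ 3 := pow_pos (by linarith) 3
  have hy : t ^ 2 ≤ 1 / 9 := by nlinarith
  have h1 : (8 / 9 : ℝ) ^ 2 ≤ (1 - t ^ 2) ^ 2 := pow_le_pow_left₀ (by norm_num) (by linarith) 2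
  have h2 : (1 + 3 * t ^ 2) ^ 3 ≤ (4 / 3 : ℝ) ^ 3 :=
    pow_le_pow_left₀ (by positivity) (by linarith) 3
  rw [paramE, le_div_iff₀ (by positivity)]
  calc _ ≤ (2 - a) ^ 3 / 3 * t ^ 2 * (4 / 3) ^ 3 := by gcongr
    _ ≤ (2 - a) ^ 3 * t ^ 2 * (8 / 9) ^ 2 := by
      have := mul_pos hβ (pow_pos ht 2)
      linarith
    _ ≤ _ := by gcongr

/-- The action as a function of the parameter. -/
def paramAction (a t : ℝ) : ℝ := angleAction (paramS₁ a t) (paramS₂ a t) (paramS₃ a t) (2 + a)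

/-- The rotation number as a function of the parameter. -/
def paramRotation (a t : ℝ) : ℝ :=
  angleStep a (paramS₁ a t) (paramS₂ a t) (paramS₃ a t) /
    anglePeriod (paramS₁ a t) (paramS₂ a t) (paramS₃ a t) (2 + a)

theorem continuous_paramS (a : ℝ) :
    Continuous (paramS₁ a) ∧ Continuous (paramS₂ a) ∧ Continuous (paramS₃ a) := by
  have hN : ∀ t : ℝ, 1 + 3 * t ^ 2 ≠ 0 := fun t => by positivity
  refine ⟨Continuous.div (by fun_prop) (by fun_prop) hN,
    Continuous.div (by fun_prop) (by fun_prop) hN, Continuous.div (by fun_prop) (by fun_prop) hN⟩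

theorem continuousOn_paramAction {a : ℝ} {s : Set ℝ}
    (h : ∀ t ∈ s, SextRoots a (paramE a t) (paramS₁ a t) (paramS₂ a t) (paramS₃ a t)) :
    ContinuousOn (paramAction a) s := by
  rw [continuousOn_iff_continuous_domRestrict]
  obtain ⟨c1, c2, c3⟩ := continuous_paramS a
  unfold paramAction angleAction
  refine continuous_const.mul ?_
  refine intervalIntegral.continuous_parametric_intervalIntegral_of_continuous' ?_ _ _
  have cS : Continuous fun z : s × ℝ => angleS (paramS₂ a z.1) (paramS₃ a z.1) z.2 := by
    unfold angleS; fun_prop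
  unfold Function.uncurry angleD angleω
  simp only
  refine Continuous.mul (Continuous.div (by fun_prop) (by fun_prop) fun z => ?_) (by fun_prop)
  have h' := h z.1 z.1.2
  exact (angle_pos h'.lt₁₂ h'.lt₂₃ h'.lt₃₄ z.2).2.ne'

/-- The parameter tends to zero with the level. -/
theorem exists_sextParam {a : ℝ} (ha₁ : -2 < a) (ha₂ : a < 2) : ∃ τ : ℝ → ℝ,
    (∀ E, 0 < E → E < sextSep a → 0 < τ E ∧ τ E < 1 / 3 ∧
      Real.sqrt 2 * sextQ₁ a E = paramS₁ a (τ E) ∧ Real.sqrt 2 * sextQ₂ a E = paramS₂ a (τ E) ∧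
      Real.sqrt 2 * sextQ₃ a E = paramS₃ a (τ E) ∧ E = paramE a (τ E)) ∧
    Tendsto τ (𝓝[>] 0) (𝓝[>] 0) := by
  have h := fun E (hE : 0 < E ∧ E < sextSep a) =>
    (sextRoots ha₁ ha₂ hE.1 hE.2).exists_param ha₂
  choose! τ hτ using h
  refine ⟨τ, fun E h1 h2 => hτ E ⟨h1, h2⟩, ?_⟩
  have hsep : 0 < sextSep a :=
    lt_min (by have : 0 < (2 - a) ^ 3 := pow_pos (by linarith) 3
               positivity) (pow_pos (by linarith) 2)
  have hev : ∀ᶠ E in 𝓝[>] (0:ℝ), 0 < E ∧ E < sextSep a := Ioo_mem_nhdsGT hsep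
  have hβ : 0 < (2 - a) ^ 3 := pow_pos (by linarith) 3
  refine tendsto_nhdsWithin_iff.2 ⟨?_, hev.mono fun E hE => (hτ E hE).1⟩
  have hs : Tendsto (fun E : ℝ => Real.sqrt (3 / (2 - a) ^ 3 * E)) (𝓝[>] 0) (𝓝 0) := by
    have : Continuous fun E : ℝ => Real.sqrt (3 / (2 - a) ^ 3 * E) := by fun_prop
    simpa using (this.tendsto 0).mono_left nhdsWithin_le_nhds
  refine tendsto_of_tendsto_of_tendsto_of_le_of_le' tendsto_const_nhds hs
    (hev.mono fun E hE => (hτ E hE).1.le) (hev.mono fun E hE => ?_)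
  obtain ⟨h1, h2, -, -, -, h3⟩ := hτ E hE
  refine Real.le_sqrt_of_sq_le ?_
  have := le_paramE ha₂ h1 h2
  rw [← h3] at this
  rw [div_mul_eq_mul_div, le_div_iff₀ hβ]
  linarith

/-- The cross ratio κ² is invariant under scaling, so the Qᵢ may be replaced by √2 Qᵢ, which are
rational in t. Thus κ², unlike κ, is rational in t, and it is of first order. -/
theorem sextModulus_sq {a E t : ℝ} (h : SextRoots a E (Real.sqrt 2 * sextQ₁ a E)
      (Real.sqrt 2 * sextQ₂ a E) (Real.sqrt 2 * sextQ₃ a E)) (ha₂ : a < 2) (ht : 0 < t)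
    (ht' : t < 1 / 3)
    (h1 : Real.sqrt 2 * sextQ₁ a E = paramS₁ a t) (h2 : Real.sqrt 2 * sextQ₂ a E = paramS₂ a t)
    (h3 : Real.sqrt 2 * sextQ₃ a E = paramS₃ a t) :
    sextModulus a E ^ 2 = 16 * t * (1 + (1 + a) * t ^ 2) *
      (((1 - t) * (1 + 3 * t) * (2 + a + 2 * (2 - a) * t + (10 + a) * t ^ 2)))⁻¹ := by
  have hs : Real.sqrt 2 ^ 2 = 2 := Real.sq_sqrt (by norm_num)
  have hs0 : 0 < Real.sqrt 2 := by positivity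
  have h4 : Real.sqrt 2 * sextQ₄ a = 2 + a := by rw [sextQ₄]; field_simp
  obtain ⟨g1, g2, g3, -⟩ := sextG_roots h
  rw [sextModulus, rootModulus, Real.sq_sqrt (div_nonneg (mul_nonneg (by linarith) (by linarith))
    (mul_nonneg (by linarith) (by linarith)))]
  have e1 : (sextQ₃ a E - sextQ₂ a E) * (sextQ₄ a - sextQ₁ a E) /
      ((sextQ₃ a E - sextQ₁ a E) * (sextQ₄ a - sextQ₂ a E)) =
      ((paramS₃ a t - paramS₂ a t) * (2 + a - paramS₁ a t)) /
      ((paramS₃ a t - paramS₁ a t) * (2 + a - paramS₂ a t)) := by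
    rw [← h1, ← h2, ← h3, ← h4]
    have e0 : ∀ r x y z w : ℝ, r ≠ 0 → r * x * (r * y) / (r * z * (r * w)) = x * y / (z * w) :=
      fun r x y z w hr => by
        rw [mul_mul_mul_comm, mul_mul_mul_comm r z, mul_div_mul_left _ _ (mul_ne_zero hr hr)]
    simp only [← mul_sub]
    rw [e0 _ _ _ _ _ hs0.ne']
  have hN : 0 < 1 + 3 * t ^ 2 := by positivity
  have k1 : paramS₃ a t - paramS₂ a t = 4 * (2 - a) * t / (1 + 3 * t ^ 2) := by
    unfold paramS₂ paramS₃; field_simp; ring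
  have k2 : 2 + a - paramS₁ a t = 4 * (1 + (1 + a) * t ^ 2) / (1 + 3 * t ^ 2) := by
    unfold paramS₁; field_simp; ring
  have k3 : paramS₃ a t - paramS₁ a t = (2 - a) * ((1 - t) * (1 + 3 * t)) / (1 + 3 * t ^ 2) := by
    unfold paramS₁ paramS₃; field_simp; ring
  have k4 : 2 + a - paramS₂ a t =
      (2 + a + 2 * (2 - a) * t + (10 + a) * t ^ 2) / (1 + 3 * t ^ 2) := by
    unfold paramS₂; field_simp; ring
  have hβ : 0 < 2 - a := by linarith
  have p1 : 0 < (2 + a + 2 * (2 - a) * t + (10 + a) * t ^ 2) / (1 + 3 * t ^ 2) := by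
    rw [← k4, ← h2]
    linarith [h.lt₂₃, h.lt₃₄]
  have p2 : 2 + a + 2 * (2 - a) * t + (10 + a) * t ^ 2 ≠ 0 := fun h0 => by
    rw [h0, zero_div] at p1; exact lt_irrefl _ p1
  rw [e1, k1, k2, k3, k4]
  have p3 : 1 - t ≠ 0 := by linarith
  have p4 : 1 + 3 * t ≠ 0 := by linarith
  field_simp
  ring

/-! ### Expansions in the parameter -/

/-- With m = (s₂ + s₃)/2, (m − s₁)(2 + a − m) = (2 − a) `paramD` / (1 + 3t²)². `paramU` and `paramV`
are the coefficients for which ω² is this product times 1 + U t cos x + V t² cos² x. -/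
def paramD (a t : ℝ) : ℝ := (1 - 3 * t ^ 2) * (2 + a + (10 + a) * t ^ 2)

def paramU (a t : ℝ) : ℝ := 4 * (-a - (8 - a) * t ^ 2) * (paramD a t)⁻¹

def paramV (a t : ℝ) : ℝ := -(4 * (2 - a)) * (paramD a t)⁻¹

theorem tendsto_param : Tendsto (fun t : ℝ => t) (𝓝[>] 0) (𝓝 0) := nhdsWithin_le_nhds

theorem tendsto_sq_param : Tendsto (fun t : ℝ => t ^ 2) (𝓝[>] 0) (𝓝 0) := by
  simpa using tendsto_param.pow 2

section expansions

variable {a : ℝ}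

/-- The functions of this section are even in t, so they are expanded in t² up to its third power.
The coefficients are rational in a with powers of 2 + a as denominators; truncated series arithmetic
reduces each claim to identities between such functions. -/
theorem tay_N (ha₁ : -2 < a) (ha₂ : a < 2) :
    Tay4 (𝓝[>] (0:ℝ)) (fun t : ℝ => t ^ 2) (fun t => 1 + 3 * t ^ 2)
      1 3 0 0 := by
  have hσ : 2 + a ≠ 0 := by linarith
  have hβ : 2 - a ≠ 0 := by linarith
  refine (Tay4.congr (Tay4.poly 1 3 0 0)
    ?_ ?_ ?_ ?_).congr_fun
    (Eventually.of_forall fun t => by ring) <;>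
    ring1

theorem tay_N_inv (ha₁ : -2 < a) (ha₂ : a < 2) :
    Tay4 (𝓝[>] (0:ℝ)) (fun t : ℝ => t ^ 2) (fun t => (1 + 3 * t ^ 2)⁻¹)
      1 (-3) 9 (-27) := by
  have hσ : 2 + a ≠ 0 := by linarith
  have hβ : 2 - a ≠ 0 := by linarith
  refine Tay4.inv (tay_N ha₁ ha₂) tendsto_sq_param one_ne_zero ?_ ?_ ?_ ?_ <;>
    ring1

theorem tay_D (ha₁ : -2 < a) (ha₂ : a < 2) :
    Tay4 (𝓝[>] (0:ℝ)) (fun t : ℝ => t ^ 2) (fun t => paramD a t)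
      (2 + a) (4 - 2 * a) (-30 - 3 * a) 0 := by
  have hσ : 2 + a ≠ 0 := by linarith
  have hβ : 2 - a ≠ 0 := by linarith
  refine (Tay4.congr (Tay4.poly (2 + a) (4 - 2 * a) (-30 - 3 * a) 0)
    ?_ ?_ ?_ ?_).congr_fun
    (Eventually.of_forall fun t => by simp only [paramD]; ring) <;>
    ring1

theorem tay_D_inv (ha₁ : -2 < a) (ha₂ : a < 2) :
    Tay4 (𝓝[>] (0:ℝ)) (fun t : ℝ => t ^ 2) (fun t => (paramD a t)⁻¹)
      (1 / (2 + a)) ((-4 + 2 * a) / (2 + a) ^ 2) ((76 + 20 * a + 7 * a ^ 2) / (2 + a) ^ 3)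
      ((-544 + 48 * a + 72 * a ^ 2 + 20 * a ^ 3) / (2 + a) ^ 4) := by
  have hσ : 2 + a ≠ 0 := by linarith
  have hβ : 2 - a ≠ 0 := by linarith
  refine Tay4.inv (tay_D ha₁ ha₂) tendsto_sq_param hσ ?_ ?_ ?_ ?_ <;>
    first | ring1 | (field_simp <;> ring1)

theorem tay_U (ha₁ : -2 < a) (ha₂ : a < 2) :
    Tay4 (𝓝[>] (0:ℝ)) (fun t : ℝ => t ^ 2) (fun t => paramU a t)
      ((-4 * a) / (2 + a)) ((-64 - 8 * a - 4 * a ^ 2) / (2 + a) ^ 2)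
      ((256 - 336 * a - 144 * a ^ 2 - 20 * a ^ 3) / (2 + a) ^ 3)
      ((-4864 - 928 * a - 816 * a ^ 2 - 376 * a ^ 3 - 52 * a ^ 4) / (2 + a) ^ 4) := by
  have hσ : 2 + a ≠ 0 := by linarith
  have hβ : 2 - a ≠ 0 := by linarith
  refine (Tay4.congr (Tay4.mul (Tay4.poly (-4 * a) (-32 + 4 * a) 0 0) (tay_D_inv ha₁ ha₂)
      tendsto_sq_param)
    ?_ ?_ ?_ ?_).congr_fun
    (Eventually.of_forall fun t => by simp only [paramU]; ring) <;>
    first | ring1 | (field_simp; ring1)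

theorem tay_V (ha₁ : -2 < a) (ha₂ : a < 2) :
    Tay4 (𝓝[>] (0:ℝ)) (fun t : ℝ => t ^ 2) (fun t => paramV a t)
      ((-8 + 4 * a) / (2 + a)) ((32 - 32 * a + 8 * a ^ 2) / (2 + a) ^ 2)
      ((-608 + 144 * a + 24 * a ^ 2 + 28 * a ^ 3) / (2 + a) ^ 3)
      ((4352 - 2560 * a - 384 * a ^ 2 + 128 * a ^ 3 + 80 * a ^ 4) / (2 + a) ^ 4) := by
  have hσ : 2 + a ≠ 0 := by linarith
  have hβ : 2 - a ≠ 0 := by linarith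
  refine (Tay4.congr (Tay4.const_mul (tay_D_inv ha₁ ha₂) (-(4 * (2 - a))))
    ?_ ?_ ?_ ?_).congr_fun
    (Eventually.of_forall fun t => by rfl) <;>
    ring1

theorem tay_UU (ha₁ : -2 < a) (ha₂ : a < 2) :
    Tay4 (𝓝[>] (0:ℝ)) (fun t : ℝ => t ^ 2) (fun t => paramU a t * paramU a t)
      (16 * a ^ 2 / (2 + a) ^ 2) ((512 * a + 64 * a ^ 2 + 32 * a ^ 3) / (2 + a) ^ 3)
      ((4096 - 1024 * a + 3264 * a ^ 2 + 1216 * a ^ 3 + 176 * a ^ 4) / (2 + a) ^ 4)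
      ((-32768 + 77824 * a + 29184 * a ^ 2 + 14080 * a ^ 3 + 4480 * a ^ 4 + 576 * a ^ 5) / (2 +
        a) ^ 5) := by
  have hσ : 2 + a ≠ 0 := by linarith
  have hβ : 2 - a ≠ 0 := by linarith
  refine (Tay4.congr (Tay4.mul (tay_U ha₁ ha₂) (tay_U ha₁ ha₂) tendsto_sq_param)
    ?_ ?_ ?_ ?_) <;>
    first | ring1 | (field_simp; ring1)

theorem tay_UV (ha₁ : -2 < a) (ha₂ : a < 2) :
    Tay4 (𝓝[>] (0:ℝ)) (fun t : ℝ => t ^ 2) (fun t => paramU a t * paramV a t)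
      ((32 * a - 16 * a ^ 2) / (2 + a) ^ 2)
      ((512 - 320 * a + 128 * a ^ 2 - 48 * a ^ 3) / (2 + a) ^ 3)
      ((-4096 + 7936 * a - 1152 * a ^ 2 - 448 * a ^ 3 - 224 * a ^ 4) / (2 + a) ^ 4)
      ((86016 - 52736 * a + 20992 * a ^ 2 - 2432 * a ^ 4 - 800 * a ^ 5) / (2 + a) ^ 5) := by
  have hσ : 2 + a ≠ 0 := by linarith
  have hβ : 2 - a ≠ 0 := by linarith
  refine (Tay4.congr (Tay4.mul (tay_U ha₁ ha₂) (tay_V ha₁ ha₂) tendsto_sq_param)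
    ?_ ?_ ?_ ?_) <;>
    first | ring1 | (field_simp; ring1)

theorem tay_VV (ha₁ : -2 < a) (ha₂ : a < 2) :
    Tay4 (𝓝[>] (0:ℝ)) (fun t : ℝ => t ^ 2) (fun t => paramV a t * paramV a t)
      ((64 - 64 * a + 16 * a ^ 2) / (2 + a) ^ 2)
      ((-512 + 768 * a - 384 * a ^ 2 + 64 * a ^ 3) / (2 + a) ^ 3)
      ((10752 - 9216 * a + 2304 * a ^ 2 - 768 * a ^ 3 + 288 * a ^ 4) / (2 + a) ^ 4)
      ((-108544 + 123904 * a - 31744 * a ^ 2 - 2560 * a ^ 3 - 1664 * a ^ 4 + 1088 * a ^ 5) / (2 +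
        a) ^ 5) := by
  have hσ : 2 + a ≠ 0 := by linarith
  have hβ : 2 - a ≠ 0 := by linarith
  refine (Tay4.congr (Tay4.mul (tay_V ha₁ ha₂) (tay_V ha₁ ha₂) tendsto_sq_param)
    ?_ ?_ ?_ ?_) <;>
    first | ring1 | (field_simp; ring1)

theorem tay_isq₁ (ha₁ : -2 < a) (ha₂ : a < 2) :
    Tay4 (𝓝[>] (0:ℝ)) (fun t : ℝ => t ^ 2) (fun t => isq₁ (paramU a t))
      (2 * a / (2 + a)) ((32 + 4 * a + 2 * a ^ 2) / (2 + a) ^ 2)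
      ((-128 + 168 * a + 72 * a ^ 2 + 10 * a ^ 3) / (2 + a) ^ 3)
      ((2432 + 464 * a + 408 * a ^ 2 + 188 * a ^ 3 + 26 * a ^ 4) / (2 + a) ^ 4) := by
  have hσ : 2 + a ≠ 0 := by linarith
  have hβ : 2 - a ≠ 0 := by linarith
  refine (Tay4.congr (Tay4.const_mul (tay_U ha₁ ha₂) (-1 / 2))
    ?_ ?_ ?_ ?_).congr_fun
    (Eventually.of_forall fun t => by simp only [isq₁]; ring) <;>
    ring1

theorem tay_isq₂ (ha₁ : -2 < a) (ha₂ : a < 2) :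
    Tay4 (𝓝[>] (0:ℝ)) (fun t : ℝ => t ^ 2) (fun t => isq₂ (paramU a t) (paramV a t))
      ((8 + 4 * a ^ 2) / (2 + a) ^ 2) ((-32 + 208 * a + 32 * a ^ 2 + 8 * a ^ 3) / (2 + a) ^ 3)
      ((2144 - 224 * a + 1128 * a ^ 2 + 416 * a ^ 3 + 52 * a ^ 4) / (2 + a) ^ 4)
      ((-16640 + 29568 * a + 12608 * a ^ 2 + 5344 * a ^ 3 + 1536 * a ^ 4 + 176 * a ^ 5) / (2 +
        a) ^ 5) := by
  have hσ : 2 + a ≠ 0 := by linarith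
  have hβ : 2 - a ≠ 0 := by linarith
  refine (Tay4.congr (Tay4.add (Tay4.const_mul (tay_V ha₁ ha₂) (-1 / 2)) (Tay4.const_mul (tay_UU ha₁
      ha₂) (3 / 8)))
    ?_ ?_ ?_ ?_).congr_fun
    (Eventually.of_forall fun t => by simp only [isq₂]; ring) <;>
    first | ring1 | (field_simp; ring1)

theorem tay_isq₃ (ha₁ : -2 < a) (ha₂ : a < 2) :
    Tay4 (𝓝[>] (0:ℝ)) (fun t : ℝ => t ^ 2) (fun t => isq₃ (paramU a t) (paramV a t))
      ((48 * a + 8 * a ^ 3) / (2 + a) ^ 3)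
      ((768 - 96 * a + 912 * a ^ 2 + 144 * a ^ 3 + 24 * a ^ 4) / (2 + a) ^ 4)
      ((-6144 + 24192 * a + 4224 * a ^ 2 + 5664 * a ^ 3 + 1728 * a ^ 4 + 192 * a ^ 5) / (2 + a) ^ 5)
      ((210944 - 106752 * a + 230016 * a ^ 2 + 115264 * a ^ 3 + 38112 * a ^ 4 + 8256 * a ^ 5 +
        800 * a ^ 6) / (2 + a) ^ 6) := by
  have hσ : 2 + a ≠ 0 := by linarith
  have hβ : 2 - a ≠ 0 := by linarith
  refine (Tay4.congr (Tay4.add (Tay4.const_mul (tay_UV ha₁ ha₂) (3 / 4)) (Tay4.const_mul (Tay4.mul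
      (tay_UU ha₁ ha₂) (tay_U ha₁ ha₂) tendsto_sq_param) (-5 / 16)))
    ?_ ?_ ?_ ?_).congr_fun
    (Eventually.of_forall fun t => by simp only [isq₃]; ring) <;>
    first | ring1 | (field_simp; ring1)

theorem tay_isq₄ (ha₁ : -2 < a) (ha₂ : a < 2) :
    Tay4 (𝓝[>] (0:ℝ)) (fun t : ℝ => t ^ 2) (fun t => isq₄ (paramU a t) (paramV a t))
      ((96 + 192 * a ^ 2 + 16 * a ^ 4) / (2 + a) ^ 4)
      ((-768 + 8064 * a + 384 * a ^ 2 + 3328 * a ^ 3 + 512 * a ^ 4 + 64 * a ^ 5) / (2 + a) ^ 5)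
      ((77568 - 43776 * a + 164544 * a ^ 2 + 42368 * a ^ 3 + 24384 * a ^ 4 + 6144 * a ^ 5 +
        608 * a ^ 6) / (2 + a) ^ 6)
      ((-900096 + 3105280 * a + 158976 * a ^ 2 + 1499008 * a ^ 3 + 723840 * a ^ 4 +
        203136 * a ^ 5 + 35968 * a ^ 6 + 3008 * a ^ 7) / (2 + a) ^ 7) := by
  have hσ : 2 + a ≠ 0 := by linarith
  have hβ : 2 - a ≠ 0 := by linarith
  refine (Tay4.congr (Tay4.add (Tay4.add (Tay4.const_mul (tay_VV ha₁ ha₂) (3 / 8)) (Tay4.const_mul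
      (Tay4.mul (tay_UU ha₁ ha₂) (tay_V ha₁ ha₂) tendsto_sq_param) (-15 / 16))) (Tay4.const_mul
      (Tay4.mul (tay_UU ha₁ ha₂) (tay_UU ha₁ ha₂) tendsto_sq_param) (35 / 128)))
    ?_ ?_ ?_ ?_).congr_fun
    (Eventually.of_forall fun t => by simp only [isq₄]; ring) <;>
    first | ring1 | (field_simp; ring1)

theorem tay_isq₅ (ha₁ : -2 < a) (ha₂ : a < 2) :
    Tay4 (𝓝[>] (0:ℝ)) (fun t : ℝ => t ^ 2) (fun t => isq₅ (paramU a t) (paramV a t))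
      ((960 * a + 640 * a ^ 3 + 32 * a ^ 5) / (2 + a) ^ 5)
      ((15360 - 5760 * a + 50880 * a ^ 2 + 5120 * a ^ 3 + 10880 * a ^ 4 + 1600 * a ^ 5 +
        160 * a ^ 6) / (2 + a) ^ 6)
      ((-184320 + 1148160 * a - 65280 * a ^ 2 + 880960 * a ^ 3 + 250880 * a ^ 4 + 94080 * a ^ 5 +
        19840 * a ^ 6 + 1760 * a ^ 7) / (2 + a) ^ 7)
      ((8826880 - 10206720 * a + 27150080 * a ^ 2 + 7008640 * a ^ 3 + 8623680 * a ^ 4 +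
        3699200 * a ^ 5 + 908160 * a ^ 6 + 137280 * a ^ 7 + 10080 * a ^ 8) / (2 + a) ^ 8) := by
  have hσ : 2 + a ≠ 0 := by linarith
  have hβ : 2 - a ≠ 0 := by linarith
  refine (Tay4.congr (Tay4.add (Tay4.add (Tay4.const_mul (Tay4.mul (tay_UV ha₁ ha₂) (tay_V ha₁ ha₂)
      tendsto_sq_param) (-15 / 16)) (Tay4.const_mul (Tay4.mul (tay_UU ha₁ ha₂) (tay_UV ha₁ ha₂)
      tendsto_sq_param) (35 / 32))) (Tay4.const_mul (Tay4.mul (Tay4.mul (tay_UU ha₁ ha₂) (tay_UU ha₁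
      ha₂) tendsto_sq_param) (tay_U ha₁ ha₂) tendsto_sq_param) (-63 / 256)))
    ?_ ?_ ?_ ?_).congr_fun
    (Eventually.of_forall fun t => by simp only [isq₅]; ring) <;>
    first | ring1 | (field_simp; ring1)

theorem tay_inv_sqrt_D (ha₁ : -2 < a) (ha₂ : a < 2) :
    Tay4 (𝓝[>] (0:ℝ)) (fun t : ℝ => t ^ 2) (fun t => (Real.sqrt ((2 + a)⁻¹ * paramD a t))⁻¹)
      1 ((-2 + a) / (2 + a)) ((36 + 12 * a + 3 * a ^ 2) / (2 + a) ^ 2)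
      ((-200 + 12 * a + 30 * a ^ 2 + 7 * a ^ 3) / (2 + a) ^ 3) := by
  have hσ : 2 + a ≠ 0 := by linarith
  have hβ : 2 - a ≠ 0 := by linarith
  refine Tay4.inv_sqrt (Tay4.congr (d₀ := 1) (Tay4.const_mul (tay_D ha₁ ha₂) (2 + a)⁻¹) (by
      field_simp) rfl rfl rfl) tendsto_sq_param one_pos rfl rfl rfl rfl ?_ ?_ ?_ ?_ <;>
    first | ring1 | (field_simp; ring1)

/-- The bracket of `exists_angleAction_expansion` multiplied by 1 + 3t². The odd powers of t there
come with a factor r, itself t times an even function, so the whole is even. -/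
theorem tay_bracket (ha₁ : -2 < a) (ha₂ : a < 2) :
    Tay4 (𝓝[>] (0:ℝ)) (fun t : ℝ => t ^ 2) (fun t => (2 - a) * (1 - 3 * t ^ 2) * (1 + isq₂ (paramU a
        t) (paramV a t) / 4 * t ^ 2 +
      isq₄ (paramU a t) (paramV a t) / 8 * t ^ 4) - 2 * (2 - a) * (isq₁ (paramU a t) / 4 * t ^ 2 +
      isq₃ (paramU a t) (paramV a t) / 8 * t ^ 4 + 5 * isq₅ (paramU a t) (paramV a t) / 64 * t ^ 6))
      (2 - a) ((-20 - 18 * a + 8 * a ^ 2 + 3 * a ^ 3) / (2 + a) ^ 2)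
      ((-184 + 44 * a + 92 * a ^ 2 - 54 * a ^ 3 + 6 * a ^ 4 + 2 * a ^ 5) / (2 + a) ^ 4)
      ((1744 + 116 * a - 2758 * a ^ 2 + 952 * a ^ 3 + 150 * a ^ 4 - 44 * a ^ 5 +
        7 * a ^ 6) / (2 + a) ^ 5) := by
  have hσ : 2 + a ≠ 0 := by linarith
  have hβ : 2 - a ≠ 0 := by linarith
  refine (Tay4.congr (Tay4.add (Tay4.mul (Tay4.poly (2 - a) (-6 + 3 * a) 0 0) (Tay4.add (Tay4.poly 1
      0 0 0) (Tay4.add (Tay4.mul (tay_isq₂ ha₁ ha₂) (Tay4.poly 0 (1 / 4) 0 0) tendsto_sq_param)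
      (Tay4.mul (tay_isq₄ ha₁ ha₂) (Tay4.poly 0 0 (1 / 8) 0) tendsto_sq_param))) tendsto_sq_param)
      (Tay4.const_mul (Tay4.add (Tay4.add (Tay4.mul (tay_isq₁ ha₁ ha₂) (Tay4.poly 0 (1 / 4) 0 0)
      tendsto_sq_param) (Tay4.mul (tay_isq₃ ha₁ ha₂) (Tay4.poly 0 0 (1 / 8) 0) tendsto_sq_param))
      (Tay4.mul (tay_isq₅ ha₁ ha₂) (Tay4.poly 0 0 0 (5 / 64)) tendsto_sq_param)) (-2 * (2 - a))))
    ?_ ?_ ?_ ?_).congr_fun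
    (Eventually.of_forall fun t => by ring) <;>
    first | ring1 | (field_simp; ring1)

/-- The approximation of √((2 + a)(2 − a)) times the action: (2 − a)² t² (1 + 3t²)⁻³ is r²/4
together with the factor removed in `tay_bracket`. -/
theorem tay_main (ha₁ : -2 < a) (ha₂ : a < 2) :
    Tay4 (𝓝[>] (0:ℝ)) (fun t : ℝ => t ^ 2) (fun t => (1 + 3 * t ^ 2) * (Real.sqrt ((2 + a)⁻¹ *
        paramD a t))⁻¹ * ((2 - a) ^ 2 * t ^ 2 * ((1 + 3 * t ^ 2)⁻¹) ^ 3 * ((2 - a) * (1 - 3 * t ^ 2)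
        *
      (1 + isq₂ (paramU a t) (paramV a t) / 4 * t ^ 2 +
      isq₄ (paramU a t) (paramV a t) / 8 * t ^ 4) - 2 * (2 - a) * (isq₁ (paramU a t) / 4 * t ^ 2 +
      isq₃ (paramU a t) (paramV a t) / 8 * t ^ 4 + 5 * isq₅ (paramU a t) (paramV a t) / 64 * t ^
      6))))
      0 (8 - 12 * a + 6 * a ^ 2 - a ^ 3)
      ((-304 + 152 * a + 164 * a ^ 2 - 94 * a ^ 3 - 10 * a ^ 4 + 8 * a ^ 5) / (2 + a) ^ 2)
      ((6880 + 3760 * a - 5976 * a ^ 2 - 2492 * a ^ 3 + 1848 * a ^ 4 + 396 * a ^ 5 -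
        126 * a ^ 6 - 37 * a ^ 7) / (2 + a) ^ 4) := by
  have hσ : 2 + a ≠ 0 := by linarith
  have hβ : 2 - a ≠ 0 := by linarith
  refine (Tay4.congr (Tay4.mul (Tay4.mul (Tay4.mul (Tay4.poly 0 (4 - 4 * a + a ^ 2) 0 0) (tay_N_inv
      ha₁ ha₂) tendsto_sq_param) (Tay4.mul (tay_N_inv ha₁ ha₂) (tay_inv_sqrt_D ha₁ ha₂)
      tendsto_sq_param) tendsto_sq_param) (tay_bracket ha₁ ha₂) tendsto_sq_param)
    ?_ ?_ ?_ ?_).congr_fun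
    (Eventually.of_forall fun t => by have : (1:ℝ) + 3 * t ^ 2 ≠ 0 := by positivity
                                      field_simp; ring) <;>
    first | ring1 | (field_simp; ring1)

theorem tay_E (ha₁ : -2 < a) (ha₂ : a < 2) :
    Tay4 (𝓝[>] (0:ℝ)) (fun t : ℝ => t ^ 2) (fun t => paramE a t)
      0 (8 - 12 * a + 6 * a ^ 2 - a ^ 3) (-88 + 132 * a - 66 * a ^ 2 + 11 * a ^ 3)
      (584 - 876 * a + 438 * a ^ 2 - 73 * a ^ 3) := by
  have hσ : 2 + a ≠ 0 := by linarith
  have hβ : 2 - a ≠ 0 := by linarith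
  refine (Tay4.congr (Tay4.mul (Tay4.mul (Tay4.poly 0 (8 - 12 * a + 6 * a ^ 2 - a ^ 3) (-16 + 24 * a
      - 12 * a ^ 2 + 2 * a ^ 3) (8 - 12 * a + 6 * a ^ 2 - a ^ 3)) (tay_N_inv ha₁ ha₂)
      tendsto_sq_param) (Tay4.mul (tay_N_inv ha₁ ha₂) (tay_N_inv ha₁ ha₂) tendsto_sq_param)
      tendsto_sq_param)
    ?_ ?_ ?_ ?_).congr_fun
    (Eventually.of_forall fun t => by have : (1:ℝ) + 3 * t ^ 2 ≠ 0 := by positivity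
                                      simp only [paramE]; field_simp; ring) <;>
    ring1

end expansions

/-! ### Expansions in t itself: step angle, rotation number, elliptic modulus. -/

def stepU (a : ℝ) : ℝ := -(4 * a) / ((2 + a) * (2 - a))

/-- Chosen with `stepU` so that 1 − (a/2 + h)² = (2 + a)(2 − a)/4 · (1 + stepU h + stepV h²). -/
def stepV (a : ℝ) : ℝ := -4 / ((2 + a) * (2 - a))

/-- The deviation of `stepCos` from its value a/2 at the origin; see `stepCos_param`. -/
def paramEps (a t : ℝ) : ℝ :=
  ((1 - t) * (a * (1 + 3 * t ^ 2) - (2 - a) * t * (1 - t)) *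
    (1 + 3 * t ^ 2 + (2 - a) * t * (1 - t))⁻¹ + (2 * t - a)) / 2

/-- The square of the elliptic modulus as a function of the parameter. -/
def paramK (a t : ℝ) : ℝ :=
  16 * t * (1 + (1 + a) * t ^ 2) *
    ((1 - t) * (1 + 3 * t) * (2 + a + 2 * (2 - a) * t + (10 + a) * t ^ 2))⁻¹

section expansions

variable {a : ℝ}

theorem tay_den (ha₁ : -2 < a) (ha₂ : a < 2) :
    Tay6 (𝓝[>] (0:ℝ)) (fun t : ℝ => t) (fun t => 1 + 3 * t ^ 2 + (2 - a) * t * (1 - t))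
      1 (2 - a) (1 + a) 0 0 0 := by
  have hσ : 2 + a ≠ 0 := by linarith
  have hβ : 2 - a ≠ 0 := by linarith
  refine (Tay6.congr (Tay6.poly 1 (2 - a) (1 + a) 0 0 0)
    ?_ ?_ ?_ ?_ ?_ ?_).congr_fun
    (Eventually.of_forall fun t => by ring) <;>
    ring1

theorem tay_den_inv (ha₁ : -2 < a) (ha₂ : a < 2) :
    Tay6 (𝓝[>] (0:ℝ)) (fun t : ℝ => t) (fun t => (1 + 3 * t ^ 2 + (2 - a) * t * (1 - t))⁻¹)
      1 (-2 + a) (3 - 5 * a + a ^ 2) (-4 + 14 * a - 8 * a ^ 2 + a ^ 3)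
      (5 - 30 * a + 34 * a ^ 2 - 11 * a ^ 3 + a ^ 4)
      (-6 + 55 * a - 104 * a ^ 2 + 63 * a ^ 3 - 14 * a ^ 4 + a ^ 5) := by
  have hσ : 2 + a ≠ 0 := by linarith
  have hβ : 2 - a ≠ 0 := by linarith
  refine Tay6.inv (tay_den ha₁ ha₂) tendsto_param one_ne_zero ?_ ?_ ?_ ?_ ?_ ?_ <;>
    ring1

theorem tay_eps (ha₁ : -2 < a) (ha₂ : a < 2) :
    Tay6 (𝓝[>] (0:ℝ)) (fun t : ℝ => t) (fun t => paramEps a t)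
      0 ((-2 * a + a ^ 2) / 2) ((8 + 2 * a - 5 * a ^ 2 + a ^ 3) / 2)
      ((-16 + 6 * a + 13 * a ^ 2 - 8 * a ^ 3 + a ^ 4) / 2)
      ((24 - 38 * a - 17 * a ^ 2 + 33 * a ^ 3 - 11 * a ^ 4 + a ^ 5) / 2)
      ((-32 + 110 * a - 23 * a ^ 2 - 88 * a ^ 3 + 62 * a ^ 4 - 14 * a ^ 5 + a ^ 6) / 2) := by
  have hσ : 2 + a ≠ 0 := by linarith
  have hβ : 2 - a ≠ 0 := by linarith
  refine (Tay6.congr (Tay6.const_mul (Tay6.add (Tay6.mul (Tay6.poly a (-2) (4 + a) (-2 - 2 * a) 0 0)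
      (tay_den_inv ha₁ ha₂) tendsto_param) (Tay6.poly (-a) 2 0 0 0 0)) (1 / 2))
    ?_ ?_ ?_ ?_ ?_ ?_).congr_fun
    (Eventually.of_forall fun t => by simp only [paramEps]; ring) <;>
    ring1

theorem tay_eps_pow2 (ha₁ : -2 < a) (ha₂ : a < 2) :
    Tay6 (𝓝[>] (0:ℝ)) (fun t : ℝ => t) (fun t => paramEps a t ^ 2)
      0 0 ((4 * a ^ 2 - 4 * a ^ 3 + a ^ 4) / 4)
      ((-16 * a + 4 * a ^ 2 + 12 * a ^ 3 - 7 * a ^ 4 + a ^ 5) / 2)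
      ((64 + 96 * a - 132 * a ^ 2 - 44 * a ^ 3 + 87 * a ^ 4 - 30 * a ^ 5 + 3 * a ^ 6) / 4)
      (-64 - 16 * a + 148 * a ^ 2 - 44 * a ^ 3 - 75 * a ^ 4 + 55 * a ^ 5 - 13 * a ^ 6 + a ^ 7) := by
  have hσ : 2 + a ≠ 0 := by linarith
  have hβ : 2 - a ≠ 0 := by linarith
  refine (Tay6.congr (Tay6.mul (tay_eps ha₁ ha₂) (tay_eps ha₁ ha₂) tendsto_param)
    ?_ ?_ ?_ ?_ ?_ ?_).congr_fun
    (Eventually.of_forall fun t => by ring) <;>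
    ring1

theorem tay_eps_pow3 (ha₁ : -2 < a) (ha₂ : a < 2) :
    Tay6 (𝓝[>] (0:ℝ)) (fun t : ℝ => t) (fun t => paramEps a t ^ 3)
      0 0 0 ((-8 * a ^ 3 + 12 * a ^ 4 - 6 * a ^ 5 + a ^ 6) / 8)
      ((96 * a ^ 2 - 72 * a ^ 3 - 60 * a ^ 4 + 78 * a ^ 5 - 27 * a ^ 6 + 3 * a ^ 7) / 8)
      ((-192 * a - 96 * a ^ 2 + 408 * a ^ 3 - 84 * a ^ 4 - 210 * a ^ 5 + 147 * a ^ 6 -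
        36 * a ^ 7 + 3 * a ^ 8) / 4) := by
  have hσ : 2 + a ≠ 0 := by linarith
  have hβ : 2 - a ≠ 0 := by linarith
  refine (Tay6.congr (Tay6.mul (tay_eps_pow2 ha₁ ha₂) (tay_eps ha₁ ha₂) tendsto_param)
    ?_ ?_ ?_ ?_ ?_ ?_).congr_fun
    (Eventually.of_forall fun t => by ring) <;>
    ring1

theorem tay_eps_pow4 (ha₁ : -2 < a) (ha₂ : a < 2) :
    Tay6 (𝓝[>] (0:ℝ)) (fun t : ℝ => t) (fun t => paramEps a t ^ 4)
      0 0 0 0 ((16 * a ^ 4 - 32 * a ^ 5 + 24 * a ^ 6 - 8 * a ^ 7 + a ^ 8) / 16)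
      ((-64 * a ^ 3 + 80 * a ^ 4 + 16 * a ^ 5 - 72 * a ^ 6 + 44 * a ^ 7 - 11 * a ^ 8 + a ^ 9) / 4)
      := by
  have hσ : 2 + a ≠ 0 := by linarith
  have hβ : 2 - a ≠ 0 := by linarith
  refine (Tay6.congr (Tay6.mul (tay_eps_pow3 ha₁ ha₂) (tay_eps ha₁ ha₂) tendsto_param)
    ?_ ?_ ?_ ?_ ?_ ?_).congr_fun
    (Eventually.of_forall fun t => by ring) <;>
    ring1

theorem tay_eps_pow5 (ha₁ : -2 < a) (ha₂ : a < 2) :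
    Tay6 (𝓝[>] (0:ℝ)) (fun t : ℝ => t) (fun t => paramEps a t ^ 5)
      0 0 0 0 0 ((-32 * a ^ 5 + 80 * a ^ 6 - 80 * a ^ 7 + 40 * a ^ 8 - 10 * a ^ 9 + a ^ 10) / 32) :=
      by
  have hσ : 2 + a ≠ 0 := by linarith
  have hβ : 2 - a ≠ 0 := by linarith
  refine (Tay6.congr (Tay6.mul (tay_eps_pow4 ha₁ ha₂) (tay_eps ha₁ ha₂) tendsto_param)
    ?_ ?_ ?_ ?_ ?_ ?_).congr_fun
    (Eventually.of_forall fun t => by ring) <;>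
    ring1

/-- The polynomial of `arccos_expansion` evaluated at h = `paramEps a t`. -/
theorem tay_arc (ha₁ : -2 < a) (ha₂ : a < 2) :
    Tay6 (𝓝[>] (0:ℝ)) (fun t : ℝ => t) (fun t => paramEps a t + isq₁ (stepU a) / 2 * paramEps a t ^
        2 + isq₂ (stepU a) (stepV a) / 3 * paramEps a t ^ 3 + isq₃ (stepU a) (stepV a) / 4 *
        paramEps a t ^ 4 + isq₄ (stepU a) (stepV a) / 5 * paramEps a t ^ 5)
      0 ((-2 * a + a ^ 2) / 2) ((32 + 24 * a - 16 * a ^ 2 - 4 * a ^ 3 + a ^ 4) / (4 * (2 + a)))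
      ((-192 - 120 * a + 132 * a ^ 2 + 38 * a ^ 3 - 19 * a ^ 4 - 5 * a ^ 5 + a ^ 6) / (6 * (2 +
        a) ^ 2))
      ((768 + 192 * a - 896 * a ^ 2 - 176 * a ^ 3 + 216 * a ^ 4 + 76 * a ^ 5 - 24 * a ^ 6 -
        6 * a ^ 7 + a ^ 8) / (8 * (2 + a) ^ 3))
      ((-2560 - 160 * a + 2960 * a ^ 2 - 400 * a ^ 3 - 1640 * a ^ 4 - 462 * a ^ 5 + 431 * a ^ 6 +
        136 * a ^ 7 - 28 * a ^ 8 - 7 * a ^ 9 + a ^ 10) / (10 * (2 + a) ^ 4)) := by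
  have hσ : 2 + a ≠ 0 := by linarith
  have hβ : 2 - a ≠ 0 := by linarith
  refine (Tay6.congr (Tay6.add (Tay6.add (Tay6.add (Tay6.add (tay_eps ha₁ ha₂) (Tay6.const_mul
      (tay_eps_pow2 ha₁ ha₂) (isq₁ (stepU a) / 2))) (Tay6.const_mul (tay_eps_pow3 ha₁ ha₂) (isq₂
      (stepU a) (stepV a) / 3))) (Tay6.const_mul (tay_eps_pow4 ha₁ ha₂) (isq₃ (stepU a) (stepV a) /
      4))) (Tay6.const_mul (tay_eps_pow5 ha₁ ha₂) (isq₄ (stepU a) (stepV a) / 5)))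
    ?_ ?_ ?_ ?_ ?_ ?_) <;>
    simp only [isq₁, isq₂, isq₃, isq₄, stepU, stepV] <;> first | ring1 | (field_simp; ring1)

theorem tay_radicand (ha₁ : -2 < a) (ha₂ : a < 2) :
    Tay6 (𝓝[>] (0:ℝ)) (fun t : ℝ => t) (fun t => 1 + stepU a * paramEps a t + stepV a * paramEps a t
        ^ 2)
      1 (2 * a ^ 2 / (2 + a)) ((-8 * a - 8 * a ^ 2 + 3 * a ^ 3) / (2 + a))
      ((32 * a + 6 * a ^ 2 - 22 * a ^ 3 + 4 * a ^ 4) / (2 + a))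
      ((-32 - 88 * a + 60 * a ^ 2 + 69 * a ^ 3 - 42 * a ^ 4 + 5 * a ^ 5) / (2 + a))
      ((128 + 128 * a - 342 * a ^ 2 - 60 * a ^ 3 + 208 * a ^ 4 - 68 * a ^ 5 + 6 * a ^ 6) / (2 + a))
      := by
  have hσ : 2 + a ≠ 0 := by linarith
  have hβ : 2 - a ≠ 0 := by linarith
  refine (Tay6.congr (Tay6.add (Tay6.add (Tay6.poly 1 0 0 0 0 0) (Tay6.const_mul (tay_eps ha₁ ha₂)
      (stepU a))) (Tay6.const_mul (tay_eps_pow2 ha₁ ha₂) (stepV a)))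
    ?_ ?_ ?_ ?_ ?_ ?_).congr_fun
    (Eventually.of_forall fun t => by ring) <;>
    (try simp only [stepU, stepV]) <;> first | ring1 | (field_simp; ring1)

theorem tay_inv_sqrt_radicand (ha₁ : -2 < a) (ha₂ : a < 2) :
    Tay6 (𝓝[>] (0:ℝ)) (fun t : ℝ => t) (fun t => (Real.sqrt (1 + stepU a * paramEps a t + stepV a *
        paramEps a t ^ 2))⁻¹)
      1 ((-a ^ 2) / (2 + a)) ((8 * a + 12 * a ^ 2 + a ^ 3) / (2 + a) ^ 2)
      ((-64 * a - 76 * a ^ 2 - 8 * a ^ 3 - 3 * a ^ 4) / (2 + a) ^ 3)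
      ((128 + 544 * a + 480 * a ^ 2 + 124 * a ^ 3 + 86 * a ^ 4 + 7 * a ^ 5) / (2 + a) ^ 4)
      ((-1024 - 3072 * a - 2768 * a ^ 2 - 1856 * a ^ 3 - 1352 * a ^ 4 - 184 * a ^ 5 -
        19 * a ^ 6) / (2 + a) ^ 5) := by
  have hσ : 2 + a ≠ 0 := by linarith
  have hβ : 2 - a ≠ 0 := by linarith
  refine Tay6.inv_sqrt (tay_radicand ha₁ ha₂) tendsto_param one_pos rfl rfl rfl rfl rfl rfl ?_ ?_ ?_
      ?_ ?_ ?_ <;>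
    first | ring1 | (field_simp; ring1)

/-- The square root of f is written as f · f^(−1/2), so that expansions of inverse square roots
suffice. -/
theorem tay_sqrt_radicand (ha₁ : -2 < a) (ha₂ : a < 2) :
    Tay6 (𝓝[>] (0:ℝ)) (fun t : ℝ => t) (fun t => (1 + stepU a * paramEps a t + stepV a * paramEps a
        t ^ 2) *
      (Real.sqrt (1 + stepU a * paramEps a t + stepV a * paramEps a t ^ 2))⁻¹)
      1 (a ^ 2 / (2 + a)) ((-8 * a - 12 * a ^ 2 - a ^ 3 + a ^ 4) / (2 + a) ^ 2)
      ((64 * a + 76 * a ^ 2 - 8 * a ^ 3 - 21 * a ^ 4 - 2 * a ^ 5 + a ^ 6) / (2 + a) ^ 3)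
      ((-128 - 544 * a - 416 * a ^ 2 + 196 * a ^ 3 + 226 * a ^ 4 + 9 * a ^ 5 - 29 * a ^ 6 -
        3 * a ^ 7 + a ^ 8) / (2 + a) ^ 4)
      ((1024 + 3072 * a + 1488 * a ^ 2 - 1984 * a ^ 3 - 1496 * a ^ 4 + 312 * a ^ 5 +
        467 * a ^ 6 + 44 * a ^ 7 - 36 * a ^ 8 - 4 * a ^ 9 + a ^ 10) / (2 + a) ^ 5) := by
  have hσ : 2 + a ≠ 0 := by linarith
  have hβ : 2 - a ≠ 0 := by linarith
  refine (Tay6.congr (Tay6.mul (tay_radicand ha₁ ha₂) (tay_inv_sqrt_radicand ha₁ ha₂) tendsto_param)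
    ?_ ?_ ?_ ?_ ?_ ?_) <;>
    first | ring1 | (field_simp; ring1)

theorem tay_step_mean (ha₁ : -2 < a) (ha₂ : a < 2) :
    Tay6 (𝓝[>] (0:ℝ)) (fun t : ℝ => t) (fun t => 1 + isq₂ (paramU a t) (paramV a t) / 2 * t ^ 2 +
      3 * isq₄ (paramU a t) (paramV a t) / 8 * t ^ 4)
      1 0 ((4 + 2 * a ^ 2) / (2 + a) ^ 2) 0
      ((4 + 192 * a + 208 * a ^ 2 + 24 * a ^ 3 + 10 * a ^ 4) / (2 + a) ^ 4) 0 := by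
  have hσ : 2 + a ≠ 0 := by linarith
  have hβ : 2 - a ≠ 0 := by linarith
  refine (Tay6.congr (Tay6.add (Tay6.add (Tay6.poly 1 0 0 0 0 0) (Tay6.mul (Tay4.tay6 (tay_isq₂ ha₁
      ha₂) tendsto_param (fun _ => rfl)) (Tay6.poly 0 0 (1 / 2) 0 0 0) tendsto_param)) (Tay6.mul
      (Tay4.tay6 (tay_isq₄ ha₁ ha₂) tendsto_param (fun _ => rfl)) (Tay6.poly 0 0 0 0 (3 / 8) 0)
      tendsto_param))
    ?_ ?_ ?_ ?_ ?_ ?_).congr_fun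
    (Eventually.of_forall fun t => by ring) <;>
    first | ring1 | (field_simp; ring1)

theorem tay_step_mean_inv (ha₁ : -2 < a) (ha₂ : a < 2) :
    Tay6 (𝓝[>] (0:ℝ)) (fun t : ℝ => t) (fun t => (1 + isq₂ (paramU a t) (paramV a t) / 2 * t ^ 2 +
      3 * isq₄ (paramU a t) (paramV a t) / 8 * t ^ 4)⁻¹)
      1 0 ((-4 - 2 * a ^ 2) / (2 + a) ^ 2) 0
      ((12 - 192 * a - 192 * a ^ 2 - 24 * a ^ 3 - 6 * a ^ 4) / (2 + a) ^ 4) 0 := by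
  have hσ : 2 + a ≠ 0 := by linarith
  have hβ : 2 - a ≠ 0 := by linarith
  refine Tay6.inv (tay_step_mean ha₁ ha₂) tendsto_param one_ne_zero ?_ ?_ ?_ ?_ ?_ ?_ <;>
    first | ring1 | (field_simp; ring1)

theorem tay_X (ha₁ : -2 < a) (ha₂ : a < 2) :
    Tay6 (𝓝[>] (0:ℝ)) (fun t : ℝ => t) (fun t => a / 2 + paramEps a t)
      (a / 2) ((-2 * a + a ^ 2) / 2) ((8 + 2 * a - 5 * a ^ 2 + a ^ 3) / 2)
      ((-16 + 6 * a + 13 * a ^ 2 - 8 * a ^ 3 + a ^ 4) / 2)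
      ((24 - 38 * a - 17 * a ^ 2 + 33 * a ^ 3 - 11 * a ^ 4 + a ^ 5) / 2)
      ((-32 + 110 * a - 23 * a ^ 2 - 88 * a ^ 3 + 62 * a ^ 4 - 14 * a ^ 5 + a ^ 6) / 2) := by
  have hσ : 2 + a ≠ 0 := by linarith
  have hβ : 2 - a ≠ 0 := by linarith
  refine (Tay6.congr (Tay6.add (Tay6.poly (a / 2) 0 0 0 0 0) (tay_eps ha₁ ha₂))
    ?_ ?_ ?_ ?_ ?_ ?_).congr_fun
    (Eventually.of_forall fun t => by ring) <;>
    ring1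

theorem tay_X_pow2 (ha₁ : -2 < a) (ha₂ : a < 2) :
    Tay6 (𝓝[>] (0:ℝ)) (fun t : ℝ => t) (fun t => (a / 2 + paramEps a t) ^ 2)
      (a ^ 2 / 4) ((-2 * a ^ 2 + a ^ 3) / 2) ((16 * a + 8 * a ^ 2 - 14 * a ^ 3 + 3 * a ^ 4) / 4)
      ((-32 * a + 10 * a ^ 2 + 25 * a ^ 3 - 15 * a ^ 4 + 2 * a ^ 5) / 2)
      ((64 + 144 * a - 208 * a ^ 2 - 78 * a ^ 3 + 153 * a ^ 4 - 52 * a ^ 5 + 5 * a ^ 6) / 4)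
      ((-128 - 64 * a + 406 * a ^ 2 - 111 * a ^ 3 - 238 * a ^ 4 + 172 * a ^ 5 - 40 * a ^ 6 +
        3 * a ^ 7) / 2) := by
  have hσ : 2 + a ≠ 0 := by linarith
  have hβ : 2 - a ≠ 0 := by linarith
  refine (Tay6.congr (Tay6.mul (tay_X ha₁ ha₂) (tay_X ha₁ ha₂) tendsto_param)
    ?_ ?_ ?_ ?_ ?_ ?_).congr_fun
    (Eventually.of_forall fun t => by ring) <;>
    ring1

theorem tay_X_pow3 (ha₁ : -2 < a) (ha₂ : a < 2) :
    Tay6 (𝓝[>] (0:ℝ)) (fun t : ℝ => t) (fun t => (a / 2 + paramEps a t) ^ 3)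
      (a ^ 3 / 8) ((-6 * a ^ 3 + 3 * a ^ 4) / 8)
      ((24 * a ^ 2 + 18 * a ^ 3 - 27 * a ^ 4 + 6 * a ^ 5) / 8)
      ((-144 * a ^ 2 + 34 * a ^ 3 + 123 * a ^ 4 - 72 * a ^ 5 + 10 * a ^ 6) / 8)
      ((192 * a + 456 * a ^ 2 - 582 * a ^ 3 - 243 * a ^ 4 + 438 * a ^ 5 - 150 * a ^ 6 +
        15 * a ^ 7) / 8)
      ((-1152 * a - 480 * a ^ 2 + 2922 * a ^ 3 - 765 * a ^ 4 - 1584 * a ^ 5 + 1140 * a ^ 6 -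
        270 * a ^ 7 + 21 * a ^ 8) / 8) := by
  have hσ : 2 + a ≠ 0 := by linarith
  have hβ : 2 - a ≠ 0 := by linarith
  refine (Tay6.congr (Tay6.mul (tay_X_pow2 ha₁ ha₂) (tay_X ha₁ ha₂) tendsto_param)
    ?_ ?_ ?_ ?_ ?_ ?_).congr_fun
    (Eventually.of_forall fun t => by ring) <;>
    ring1

theorem tay_X_pow4 (ha₁ : -2 < a) (ha₂ : a < 2) :
    Tay6 (𝓝[>] (0:ℝ)) (fun t : ℝ => t) (fun t => (a / 2 + paramEps a t) ^ 4)
      (a ^ 4 / 16) ((-2 * a ^ 4 + a ^ 5) / 4)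
      ((16 * a ^ 3 + 16 * a ^ 4 - 22 * a ^ 5 + 5 * a ^ 6) / 8)
      ((-64 * a ^ 3 + 10 * a ^ 4 + 61 * a ^ 5 - 35 * a ^ 6 + 5 * a ^ 7) / 4)
      ((384 * a ^ 2 + 1056 * a ^ 3 - 1216 * a ^ 4 - 604 * a ^ 5 + 990 * a ^ 6 - 340 * a ^ 7 +
        35 * a ^ 8) / 16)
      ((-768 * a ^ 2 - 384 * a ^ 3 + 1894 * a ^ 4 - 439 * a ^ 5 - 1030 * a ^ 6 + 730 * a ^ 7 -
        175 * a ^ 8 + 14 * a ^ 9) / 4) := by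
  have hσ : 2 + a ≠ 0 := by linarith
  have hβ : 2 - a ≠ 0 := by linarith
  refine (Tay6.congr (Tay6.mul (tay_X_pow2 ha₁ ha₂) (tay_X_pow2 ha₁ ha₂) tendsto_param)
    ?_ ?_ ?_ ?_ ?_ ?_).congr_fun
    (Eventually.of_forall fun t => by ring) <;>
    ring1

theorem tay_step_sine₁ (ha₁ : -2 < a) (ha₂ : a < 2) :
    Tay6 (𝓝[>] (0:ℝ)) (fun t : ℝ => t) (fun t => -(isq₁ (paramU a t) * t))
      0 ((-2 * a) / (2 + a)) 0 ((-32 - 4 * a - 2 * a ^ 2) / (2 + a) ^ 2) 0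
      ((128 - 168 * a - 72 * a ^ 2 - 10 * a ^ 3) / (2 + a) ^ 3) := by
  have hσ : 2 + a ≠ 0 := by linarith
  have hβ : 2 - a ≠ 0 := by linarith
  refine (Tay6.congr (Tay6.mul (Tay4.tay6 (tay_isq₁ ha₁ ha₂) tendsto_param (fun _ => rfl))
      (Tay6.poly 0 (-1) 0 0 0 0) tendsto_param)
    ?_ ?_ ?_ ?_ ?_ ?_).congr_fun
    (Eventually.of_forall fun t => by ring) <;>
    ring1

theorem tay_step_sine₂ (ha₁ : -2 < a) (ha₂ : a < 2) :
    Tay6 (𝓝[>] (0:ℝ)) (fun t : ℝ => t) (fun t => isq₂ (paramU a t) (paramV a t) * t ^ 2 * (a / 2 +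
        paramEps a t) / 2)
      0 0 ((2 * a + a ^ 3) / (2 + a) ^ 2) ((-4 * a + 2 * a ^ 2 - 2 * a ^ 3 + a ^ 4) / (2 + a) ^ 2)
      ((32 + 16 * a + 52 * a ^ 2 + 14 * a ^ 3 - 4 * a ^ 4 - 3 * a ^ 5 + a ^ 6) / (2 + a) ^ 3)
      ((-64 + 8 * a - 80 * a ^ 2 + 26 * a ^ 3 + 24 * a ^ 4 + a ^ 5 - 6 * a ^ 6 + a ^ 7) / (2 +
        a) ^ 3) := by
  have hσ : 2 + a ≠ 0 := by linarith
  have hβ : 2 - a ≠ 0 := by linarith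
  refine (Tay6.congr (Tay6.mul (Tay6.mul (Tay4.tay6 (tay_isq₂ ha₁ ha₂) tendsto_param (fun _ => rfl))
      (Tay6.poly 0 0 (1 / 2) 0 0 0) tendsto_param) (tay_X ha₁ ha₂) tendsto_param)
    ?_ ?_ ?_ ?_ ?_ ?_).congr_fun
    (Eventually.of_forall fun t => by ring) <;>
    first | ring1 | (field_simp; ring1)

theorem tay_step_sine₃ (ha₁ : -2 < a) (ha₂ : a < 2) :
    Tay6 (𝓝[>] (0:ℝ)) (fun t : ℝ => t) (fun t => isq₃ (paramU a t) (paramV a t) * t ^ 3 * (2 + (a /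
        2 + paramEps a t) ^ 2) / 3)
      0 0 0 ((96 * a + 28 * a ^ 3 + 2 * a ^ 5) / (3 * (2 + a) ^ 3))
      ((-48 * a ^ 3 + 24 * a ^ 4 - 8 * a ^ 5 + 4 * a ^ 6) / (3 * (2 + a) ^ 3))
      ((1536 - 192 * a + 2400 * a ^ 2 + 648 * a ^ 3 + 100 * a ^ 4 + 4 * a ^ 5 + 2 * a ^ 6 -
        16 * a ^ 7 + 6 * a ^ 8) / (3 * (2 + a) ^ 4)) := by
  have hσ : 2 + a ≠ 0 := by linarith
  have hβ : 2 - a ≠ 0 := by linarith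
  refine (Tay6.congr (Tay6.mul (Tay6.mul (Tay4.tay6 (tay_isq₃ ha₁ ha₂) tendsto_param (fun _ => rfl))
      (Tay6.poly 0 0 0 (1 / 3) 0 0) tendsto_param) (Tay6.add (Tay6.poly 2 0 0 0 0 0) (tay_X_pow2 ha₁
      ha₂)) tendsto_param)
    ?_ ?_ ?_ ?_ ?_ ?_).congr_fun
    (Eventually.of_forall fun t => by ring) <;>
    first | ring1 | (field_simp; ring1)

theorem tay_step_sine₄ (ha₁ : -2 < a) (ha₂ : a < 2) :
    Tay6 (𝓝[>] (0:ℝ)) (fun t : ℝ => t) (fun t => isq₄ (paramU a t) (paramV a t) * t ^ 4 * ((a / 2 +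
        paramEps a t) ^ 3 / 4 + 3 * (a / 2 + paramEps a t) / 8))
      0 0 0 0 ((36 * a + 78 * a ^ 3 + 18 * a ^ 5 + a ^ 7) / (2 * (2 + a) ^ 4))
      ((-72 * a + 36 * a ^ 2 - 180 * a ^ 3 + 90 * a ^ 4 - 84 * a ^ 5 + 42 * a ^ 6 - 6 * a ^ 7 +
        3 * a ^ 8) / (2 * (2 + a) ^ 4)) := by
  have hσ : 2 + a ≠ 0 := by linarith
  have hβ : 2 - a ≠ 0 := by linarith
  refine (Tay6.congr (Tay6.mul (Tay6.mul (Tay4.tay6 (tay_isq₄ ha₁ ha₂) tendsto_param (fun _ => rfl))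
      (Tay6.poly 0 0 0 0 1 0) tendsto_param) (Tay6.add (Tay6.const_mul (tay_X_pow3 ha₁ ha₂) (1 / 4))
      (Tay6.const_mul (tay_X ha₁ ha₂) (3 / 8))) tendsto_param)
    ?_ ?_ ?_ ?_ ?_ ?_).congr_fun
    (Eventually.of_forall fun t => by ring) <;>
    first | ring1 | (field_simp; ring1)

theorem tay_step_sine₅ (ha₁ : -2 < a) (ha₂ : a < 2) :
    Tay6 (𝓝[>] (0:ℝ)) (fun t : ℝ => t) (fun t => isq₅ (paramU a t) (paramV a t) * t ^ 5 * ((a / 2 +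
        paramEps a t) ^ 4 / 5 + 4 * (a / 2 + paramEps a t) ^ 2 / 15 + 8 / 15))
      0 0 0 0 0
      ((7680 * a + 6080 * a ^ 3 + 1076 * a ^ 5 + 152 * a ^ 7 + 6 * a ^ 9) / (15 * (2 + a) ^ 5)) :=
      by
  have hσ : 2 + a ≠ 0 := by linarith
  have hβ : 2 - a ≠ 0 := by linarith
  refine (Tay6.congr (Tay6.mul (Tay6.mul (Tay4.tay6 (tay_isq₅ ha₁ ha₂) tendsto_param (fun _ => rfl))
      (Tay6.poly 0 0 0 0 0 1) tendsto_param) (Tay6.add (Tay6.add (Tay6.const_mul (tay_X_pow4 ha₁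
      ha₂) (1 / 5)) (Tay6.const_mul (tay_X_pow2 ha₁ ha₂) (4 / 15))) (Tay6.poly (8 / 15) 0 0 0 0 0))
      tendsto_param)
    ?_ ?_ ?_ ?_ ?_ ?_).congr_fun
    (Eventually.of_forall fun t => by ring) <;>
    first | ring1 | (field_simp; ring1)

theorem tay_step_sine (ha₁ : -2 < a) (ha₂ : a < 2) :
    Tay6 (𝓝[>] (0:ℝ)) (fun t : ℝ => t) (fun t => -(isq₁ (paramU a t) * t) + isq₂ (paramU a t)
        (paramV a t) * t ^ 2 * (a / 2 + paramEps a t) / 2 -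
      isq₃ (paramU a t) (paramV a t) * t ^ 3 * (2 + (a / 2 + paramEps a t) ^ 2) / 3 +
      isq₄ (paramU a t) (paramV a t) * t ^ 4 * ((a / 2 + paramEps a t) ^ 3 / 4 + 3 * (a / 2 +
      paramEps a t) / 8) -
      isq₅ (paramU a t) (paramV a t) * t ^ 5 * ((a / 2 + paramEps a t) ^ 4 / 5 + 4 * (a / 2 +
      paramEps a t) ^ 2 / 15 + 8 / 15))
      0 ((-2 * a) / (2 + a)) ((2 * a + a ^ 3) / (2 + a) ^ 2)
      ((-192 - 240 * a - 24 * a ^ 2 - 40 * a ^ 3 + a ^ 5) / (3 * (2 + a) ^ 3))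
      ((384 + 492 * a + 720 * a ^ 2 + 906 * a ^ 3 + 36 * a ^ 4 - 22 * a ^ 5 - 6 * a ^ 6 +
        a ^ 7) / (6 * (2 + a) ^ 4))
      ((-23040 - 40560 * a - 81600 * a ^ 2 - 75100 * a ^ 3 - 8240 * a ^ 4 - 922 * a ^ 5 +
        40 * a ^ 6 - 124 * a ^ 7 - 20 * a ^ 8 + 3 * a ^ 9) / (30 * (2 + a) ^ 5)) := by
  have hσ : 2 + a ≠ 0 := by linarith
  have hβ : 2 - a ≠ 0 := by linarith
  refine (Tay6.congr (Tay6.add (Tay6.add (Tay6.add (Tay6.add (tay_step_sine₁ ha₁ ha₂)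
      (tay_step_sine₂ ha₁ ha₂)) (Tay6.const_mul (tay_step_sine₃ ha₁ ha₂) (-1))) (tay_step_sine₄ ha₁
      ha₂)) (Tay6.const_mul (tay_step_sine₅ ha₁ ha₂) (-1)))
    ?_ ?_ ?_ ?_ ?_ ?_).congr_fun
    (Eventually.of_forall fun t => by ring) <;>
    first | ring1 | (field_simp; ring1)

/-- The arccosine part and the sine part have odd terms in t, which cancel in this combination. The
factor (2 + a)(2 − a)/4 is there because 2/√((2 + a)(2 − a)) is taken out in front of both parts. -/
theorem tay_rotation (ha₁ : -2 < a) (ha₂ : a < 2) :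
    Tay6 (𝓝[>] (0:ℝ)) (fun t : ℝ => t) (fun t => (2 + a) * (2 - a) / 4 * ((1 + stepU a * paramEps a
        t + stepV a * paramEps a t ^ 2) *
      (Real.sqrt (1 + stepU a * paramEps a t + stepV a * paramEps a t ^ 2))⁻¹) *
      (-(isq₁ (paramU a t) * t) + isq₂ (paramU a t) (paramV a t) * t ^ 2 * (a / 2 + paramEps a t) /
      2 -
      isq₃ (paramU a t) (paramV a t) * t ^ 3 * (2 + (a / 2 + paramEps a t) ^ 2) / 3 +
      isq₄ (paramU a t) (paramV a t) * t ^ 4 * ((a / 2 + paramEps a t) ^ 3 / 4 + 3 * (a / 2 +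
      paramEps a t) / 8) -
      isq₅ (paramU a t) (paramV a t) * t ^ 5 * ((a / 2 + paramEps a t) ^ 4 / 5 + 4 * (a / 2 +
      paramEps a t) ^ 2 / 15 + 8 / 15)) *
      (1 + isq₂ (paramU a t) (paramV a t) / 2 * t ^ 2 +
      3 * isq₄ (paramU a t) (paramV a t) / 8 * t ^ 4)⁻¹ -
      (paramEps a t + isq₁ (stepU a) / 2 * paramEps a t ^ 2 + isq₂ (stepU a) (stepV a) / 3 *
      paramEps a t ^ 3 + isq₃ (stepU a) (stepV a) / 4 * paramEps a t ^ 4 + isq₄ (stepU a) (stepV a)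
      / 5 * paramEps a t ^ 5))
      0 0 ((-16 - 10 * a + 7 * a ^ 2 + a ^ 3) / (2 * (2 + a))) 0
      ((-256 - 12 * a + 198 * a ^ 2 - 34 * a ^ 3 + 5 * a ^ 4 - 8 * a ^ 5 - a ^ 6) / (4 * (2 +
        a) ^ 3))
      0 := by
  have hσ : 2 + a ≠ 0 := by linarith
  have hβ : 2 - a ≠ 0 := by linarith
  refine (Tay6.congr (Tay6.add (Tay6.mul (Tay6.mul (Tay6.const_mul (tay_sqrt_radicand ha₁ ha₂) ((2 +
      a) * (2 - a) / 4)) (tay_step_sine ha₁ ha₂) tendsto_param) (tay_step_mean_inv ha₁ ha₂)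
      tendsto_param) (Tay6.const_mul (tay_arc ha₁ ha₂) (-1)))
    ?_ ?_ ?_ ?_ ?_ ?_).congr_fun
    (Eventually.of_forall fun t => by ring) <;>
    first | ring1 | (field_simp; ring1)

theorem tay_modulus_den (ha₁ : -2 < a) (ha₂ : a < 2) :
    Tay6 (𝓝[>] (0:ℝ)) (fun t : ℝ => t) (fun t => (1 - t) * (1 + 3 * t) * (2 + a + 2 * (2 - a) * t +
        (10 + a) * t ^ 2))
      (2 + a) 8 (12 - 6 * a) (8 + 8 * a) (-30 - 3 * a) 0 := by
  have hσ : 2 + a ≠ 0 := by linarith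
  have hβ : 2 - a ≠ 0 := by linarith
  refine (Tay6.congr (Tay6.poly (2 + a) 8 (12 - 6 * a) (8 + 8 * a) (-30 - 3 * a) 0)
    ?_ ?_ ?_ ?_ ?_ ?_).congr_fun
    (Eventually.of_forall fun t => by ring) <;>
    ring1

theorem tay_modulus_den_inv (ha₁ : -2 < a) (ha₂ : a < 2) :
    Tay6 (𝓝[>] (0:ℝ)) (fun t : ℝ => t) (fun t => ((1 - t) * (1 + 3 * t) * (2 + a + 2 * (2 - a) * t +
        (10 + a) * t ^ 2))⁻¹)
      (1 / (2 + a)) ((-8) / (2 + a) ^ 2) ((40 + 6 * a ^ 2) / (2 + a) ^ 3)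
      ((-160 - 64 * a - 136 * a ^ 2 - 8 * a ^ 3) / (2 + a) ^ 4)
      ((816 + 1408 * a + 1720 * a ^ 2 + 176 * a ^ 3 + 39 * a ^ 4) / (2 + a) ^ 5)
      ((-5888 - 15360 * a - 14976 * a ^ 2 - 2688 * a ^ 3 - 1392 * a ^ 4 - 96 * a ^ 5) / (2 + a) ^ 6)
      := by
  have hσ : 2 + a ≠ 0 := by linarith
  have hβ : 2 - a ≠ 0 := by linarith
  refine Tay6.inv (tay_modulus_den ha₁ ha₂) tendsto_param hσ ?_ ?_ ?_ ?_ ?_ ?_ <;>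
    first | ring1 | (field_simp <;> ring1)

theorem tay_modulus (ha₁ : -2 < a) (ha₂ : a < 2) :
    Tay6 (𝓝[>] (0:ℝ)) (fun t : ℝ => t) (fun t => paramK a t)
      0 (16 / (2 + a)) ((-128) / (2 + a) ^ 2)
      ((704 + 128 * a + 176 * a ^ 2 + 16 * a ^ 3) / (2 + a) ^ 3)
      ((-3072 - 2048 * a - 2816 * a ^ 2 - 256 * a ^ 3) / (2 + a) ^ 4)
      ((15616 + 27648 * a + 31104 * a ^ 2 + 4224 * a ^ 3 + 1104 * a ^ 4 + 96 * a ^ 5) / (2 + a) ^ 5)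
      := by
  have hσ : 2 + a ≠ 0 := by linarith
  have hβ : 2 - a ≠ 0 := by linarith
  refine (Tay6.congr (Tay6.mul (Tay6.poly 0 16 0 (16 + 16 * a) 0 0) (tay_modulus_den_inv ha₁ ha₂)
      tendsto_param)
    ?_ ?_ ?_ ?_ ?_ ?_).congr_fun
    (Eventually.of_forall fun t => by simp only [paramK]; ring) <;>
    first | ring1 | (field_simp; ring1)

theorem tay_modulus_pow2 (ha₁ : -2 < a) (ha₂ : a < 2) :
    Tay6 (𝓝[>] (0:ℝ)) (fun t : ℝ => t) (fun t => paramK a t ^ 2)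
      0 0 (256 / (2 + a) ^ 2) ((-4096) / (2 + a) ^ 3)
      ((38912 + 4096 * a + 5632 * a ^ 2 + 512 * a ^ 3) / (2 + a) ^ 4)
      ((-278528 - 98304 * a - 135168 * a ^ 2 - 12288 * a ^ 3) / (2 + a) ^ 5) := by
  have hσ : 2 + a ≠ 0 := by linarith
  have hβ : 2 - a ≠ 0 := by linarith
  refine (Tay6.congr (Tay6.mul (tay_modulus ha₁ ha₂) (tay_modulus ha₁ ha₂) tendsto_param)
    ?_ ?_ ?_ ?_ ?_ ?_).congr_fun
    (Eventually.of_forall fun t => by ring) <;>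
    first | ring1 | (field_simp; ring1)

theorem tay_modulus_pow3 (ha₁ : -2 < a) (ha₂ : a < 2) :
    Tay6 (𝓝[>] (0:ℝ)) (fun t : ℝ => t) (fun t => paramK a t ^ 3)
      0 0 0 (4096 / (2 + a) ^ 3) ((-98304) / (2 + a) ^ 4)
      ((1327104 + 98304 * a + 135168 * a ^ 2 + 12288 * a ^ 3) / (2 + a) ^ 5) := by
  have hσ : 2 + a ≠ 0 := by linarith
  have hβ : 2 - a ≠ 0 := by linarith
  refine (Tay6.congr (Tay6.mul (tay_modulus_pow2 ha₁ ha₂) (tay_modulus ha₁ ha₂) tendsto_param)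
    ?_ ?_ ?_ ?_ ?_ ?_).congr_fun
    (Eventually.of_forall fun t => by ring) <;>
    first | ring1 | (field_simp; ring1)

theorem tay_modulus_pow4 (ha₁ : -2 < a) (ha₂ : a < 2) :
    Tay6 (𝓝[>] (0:ℝ)) (fun t : ℝ => t) (fun t => paramK a t ^ 4)
      0 0 0 0 (65536 / (2 + a) ^ 4) ((-2097152) / (2 + a) ^ 5) := by
  have hσ : 2 + a ≠ 0 := by linarith
  have hβ : 2 - a ≠ 0 := by linarith
  refine (Tay6.congr (Tay6.mul (tay_modulus_pow3 ha₁ ha₂) (tay_modulus ha₁ ha₂) tendsto_param)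
    ?_ ?_ ?_ ?_ ?_ ?_).congr_fun
    (Eventually.of_forall fun t => by ring) <;>
    first | ring1 | (field_simp; ring1)

theorem tay_modulus_pow5 (ha₁ : -2 < a) (ha₂ : a < 2) :
    Tay6 (𝓝[>] (0:ℝ)) (fun t : ℝ => t) (fun t => paramK a t ^ 5)
      0 0 0 0 0 (1048576 / (2 + a) ^ 5) := by
  have hσ : 2 + a ≠ 0 := by linarith
  have hβ : 2 - a ≠ 0 := by linarith
  refine (Tay6.congr (Tay6.mul (tay_modulus_pow4 ha₁ ha₂) (tay_modulus ha₁ ha₂) tendsto_param)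
    ?_ ?_ ?_ ?_ ?_ ?_).congr_fun
    (Eventually.of_forall fun t => by ring) <;>
    first | ring1 | (field_simp; ring1)

/-- The claimed series composed with κ²(t). Its odd powers of t cancel, in agreement with the action
being expanded in t². -/
theorem tay_modulus_series (ha₁ : -2 < a) (ha₂ : a < 2) :
    Tay6 (𝓝[>] (0:ℝ)) (fun t : ℝ => t) (fun t => paramK a t ^ 2 + paramK a t ^ 3 +
      (97 - 27 * a - 15 * a ^ 2 - a ^ 3) / 2 ^ 7 * paramK a t ^ 4 +
      (33 - 27 * a - 15 * a ^ 2 - a ^ 3) / 2 ^ 6 * paramK a t ^ 5)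
      0 0 (256 / (2 + a) ^ 2) 0 ((-9728 - 9728 * a - 2048 * a ^ 2) / (2 + a) ^ 4) 0 := by
  have hσ : 2 + a ≠ 0 := by linarith
  have hβ : 2 - a ≠ 0 := by linarith
  refine (Tay6.congr (Tay6.add (Tay6.add (Tay6.add (tay_modulus_pow2 ha₁ ha₂) (tay_modulus_pow3 ha₁
      ha₂)) (Tay6.const_mul (tay_modulus_pow4 ha₁ ha₂) ((97 - 27 * a - 15 * a ^ 2 - a ^ 3) / 2 ^
      7))) (Tay6.const_mul (tay_modulus_pow5 ha₁ ha₂) ((33 - 27 * a - 15 * a ^ 2 - a ^ 3) / 2 ^ 6)))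
    ?_ ?_ ?_ ?_ ?_ ?_) <;>
    ring1

end expansions

/-! ### The expansion of the arccosine -/

/-- The derivative of h ↦ arccos(a/2 + h) is −k/√(1 + uh + vh²). Its Taylor polynomial is integrated
term by term, and the mean value inequality turns an error O(h⁵) of the derivative into O(h⁶). -/
theorem arccos_expansion {a : ℝ} (ha₁ : -2 < a) (ha₂ : a < 2) :
    (fun h => Real.arccos (a / 2 + h) - (Real.arccos (a / 2) -
      2 / Real.sqrt ((2 + a) * (2 - a)) * (h + isq₁ (stepU a) / 2 * h ^ 2 +
        isq₂ (stepU a) (stepV a) / 3 * h ^ 3 + isq₃ (stepU a) (stepV a) / 4 * h ^ 4 +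
        isq₄ (stepU a) (stepV a) / 5 * h ^ 5))) =O[𝓝 0] fun h => h ^ 6 := by
  obtain ⟨C, δ, hC, hδ, hexp⟩ := exists_inv_sqrt_expansion (max |stepU a| |stepV a|)
  have hq : 0 < (2 + a) * (2 - a) := mul_pos (by linarith) (by linarith)
  set u := stepU a with hu
  set v := stepV a with hv
  set k := 2 / Real.sqrt ((2 + a) * (2 - a)) with hk
  have hk0 : 0 < k := by positivity
  set G : ℝ → ℝ := fun h => Real.arccos (a / 2 + h) - (Real.arccos (a / 2) -
      k * (h + isq₁ u / 2 * h ^ 2 + isq₂ u v / 3 * h ^ 3 + isq₃ u v / 4 * h ^ 4 +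
        isq₄ u v / 5 * h ^ 5)) with hG
  have hfac : ∀ h, 1 - (a / 2 + h) ^ 2 = (2 + a) * (2 - a) / 4 * (1 + u * h + v * h ^ 2) := fun h =>
      by
    have h1 : 2 + a ≠ 0 := by linarith
    have h2 : 2 - a ≠ 0 := by linarith
    rw [hu, hv, stepU, stepV]
    field_simp
    ring
  have hder : ∀ h, |h| ≤ δ → HasDerivAt G (-(k * ((Real.sqrt (1 + u * h + v * h ^ 2))⁻¹ -
      isqTaylor u v h)) - k * (isq₅ u v * h ^ 5)) h := fun h hh => by
    have hpos := (hexp u v h (le_max_left _ _) (le_max_right _ _) hh).1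
    have h1 : 0 < 1 - (a / 2 + h) ^ 2 := by rw [hfac]; positivity
    have hn1 : a / 2 + h ≠ -1 := fun h0 => by rw [h0] at h1; norm_num at h1
    have hn2 : a / 2 + h ≠ 1 := fun h0 => by rw [h0] at h1; norm_num at h1
    have d1 := (Real.hasDerivAt_arccos hn1 hn2).comp h ((hasDerivAt_id h).const_add (a / 2))
    have p : ∀ n : ℕ, HasDerivAt (fun x : ℝ => x ^ n) (n * h ^ (n - 1)) h := fun n => hasDerivAt_pow
        n h
    have d2 := (((((hasDerivAt_id h).add ((p 2).const_mul (isq₁ u / 2))).add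
      ((p 3).const_mul (isq₂ u v / 3))).add ((p 4).const_mul (isq₃ u v / 4))).add
      ((p 5).const_mul (isq₄ u v / 5))).const_mul k
    refine HasDerivAt.congr_deriv (d1.sub (d2.const_sub (Real.arccos (a / 2)))) ?_
    have h3 : Real.sqrt (1 - (a / 2 + h) ^ 2) =
        Real.sqrt ((2 + a) * (2 - a)) / 2 * Real.sqrt (1 + u * h + v * h ^ 2) := by
      rw [hfac, Real.sqrt_mul (by positivity), Real.sqrt_div' _ (by norm_num),
        show (4:ℝ) = 2 ^ 2 by norm_num, Real.sqrt_sq (by norm_num)]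
    have h4 : 1 / Real.sqrt (1 - (a / 2 + h) ^ 2) = k * (Real.sqrt (1 + u * h + v * h ^ 2))⁻¹ := by
      rw [h3, hk, one_div, mul_inv, inv_div]
    simp only [h4, isqTaylor, Nat.cast_ofNat, Nat.add_one_sub_one]
    ring
  have hG0 : G 0 = 0 := by simp [hG]
  set M := k * (C * δ + |isq₅ u v|) with hM
  have hMb : ∀ h, |h| ≤ δ → |-(k * ((Real.sqrt (1 + u * h + v * h ^ 2))⁻¹ -
      isqTaylor u v h)) - k * (isq₅ u v * h ^ 5)| ≤ M * |h| ^ 5 := fun h hh => by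
    have h1 := (hexp u v h (le_max_left _ _) (le_max_right _ _) hh).2
    have e : -(k * ((Real.sqrt (1 + u * h + v * h ^ 2))⁻¹ - isqTaylor u v h)) -
        k * (isq₅ u v * h ^ 5) = -(k * (((Real.sqrt (1 + u * h + v * h ^ 2))⁻¹ - isqTaylor u v h) +
        isq₅ u v * h ^ 5)) := by ring
    rw [e, abs_neg, abs_mul, abs_of_pos hk0, hM, mul_assoc]
    refine mul_le_mul_of_nonneg_left ((abs_add_le _ _).trans ?_) hk0.le
    rw [abs_mul, abs_pow, add_mul]
    refine add_le_add (h1.trans ?_) le_rfl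
    calc C * |h| ^ 6 = C * |h| * |h| ^ 5 := by ring
      _ ≤ C * δ * |h| ^ 5 := by gcongr
  refine IsBigO.of_bound M ?_
  filter_upwards [Metric.ball_mem_nhds (0:ℝ) hδ] with h hh
  rw [Metric.mem_ball, dist_zero_right, Real.norm_eq_abs] at hh
  have hmem : ∀ x ∈ Set.Icc (-|h|) |h|, |x| ≤ |h| := fun x hx => abs_le.2 hx
  have := Convex.norm_image_sub_le_of_norm_hasDerivWithin_le (f := G) (C := M * |h| ^ 5)
    (s := Set.Icc (-|h|) |h|) (x := 0) (y := h)
    (fun x hx => (hder x ((hmem x hx).trans hh.le)).hasDerivWithinAt)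
    (fun x hx => (hMb x ((hmem x hx).trans hh.le)).trans (mul_le_mul_of_nonneg_left
      (pow_le_pow_left₀ (abs_nonneg _) (hmem x hx) 5) (by positivity)))
    (convex_Icc _ _) ⟨by simp, abs_nonneg h⟩ ⟨neg_abs_le h, le_abs_self h⟩
  rw [hG0, sub_zero, sub_zero, Real.norm_eq_abs, Real.norm_eq_abs] at this
  rw [Real.norm_eq_abs, Real.norm_eq_abs, abs_pow]
  refine this.trans (le_of_eq ?_)
  ring

/-! ### The factors of the expansions in the parameter -/

section param

variable {a t : ℝ}

theorem paramS_mid : (paramS₂ a t + paramS₃ a t) / 2 - paramS₁ a t =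
    (2 - a) * (1 - 3 * t ^ 2) / (1 + 3 * t ^ 2) := by
  unfold paramS₁ paramS₂ paramS₃; field_simp; ring

theorem paramS_mid' : 2 + a - (paramS₂ a t + paramS₃ a t) / 2 =
    (2 + a + (10 + a) * t ^ 2) / (1 + 3 * t ^ 2) := by
  unfold paramS₂ paramS₃; field_simp; ring

theorem paramS_radius : (paramS₃ a t - paramS₂ a t) / 2 = 2 * (2 - a) * t / (1 + 3 * t ^ 2) := by
  unfold paramS₂ paramS₃; field_simp; ring

theorem eventually_sextRoots (ha₁ : -2 < a) (ha₂ : a < 2) : ∀ᶠ t in 𝓝[>] (0:ℝ), 0 < t ∧ t < 1 / 3 ∧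
    SextRoots a (paramE a t) (paramS₁ a t) (paramS₂ a t) (paramS₃ a t) := by
  have h1 : ∀ᶠ t in 𝓝[>] (0:ℝ), t ∈ Set.Ioo (0:ℝ) (1 / 3) := Ioo_mem_nhdsGT (by norm_num)
  have h2 : ∀ᶠ t in 𝓝[>] (0:ℝ), paramS₃ a t < 2 + a := by
    have := ((continuous_paramS a).2.2.tendsto 0).mono_left
      (nhdsWithin_le_nhds (s := Set.Ioi (0:ℝ)))
    refine this.eventually (gt_mem_nhds ?_)
    simp only [paramS₃, mul_zero, zero_mul, zero_div]
    linarith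
  filter_upwards [h1, h2] with t ht ht'
  exact ⟨ht.1, ht.2, paramS_sextRoots ha₂ ht.1 ht.2 ht'⟩

theorem paramD_pos (ht' : t < 1 / 3) (ht : 0 < t)
    (h : SextRoots a (paramE a t) (paramS₁ a t) (paramS₂ a t) (paramS₃ a t)) :
    0 < 2 + a + (10 + a) * t ^ 2 ∧ 0 < paramD a t := by
  have h1 : 0 < (2 + a + (10 + a) * t ^ 2) / (1 + 3 * t ^ 2) := by
    rw [← paramS_mid']; linarith [h.lt₂₃, h.lt₃₄]
  have h2 : 0 < 2 + a + (10 + a) * t ^ 2 := by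
    have := mul_pos h1 (by positivity : 0 < 1 + 3 * t ^ 2)
    rwa [div_mul_cancel₀ _ (by positivity)] at this
  exact ⟨h2, mul_pos (by nlinarith) h2⟩

theorem paramU_spec (hD : 0 < paramD a t) : paramU a t * t *
      (((paramS₂ a t + paramS₃ a t) / 2 - paramS₁ a t) *
        (2 + a - (paramS₂ a t + paramS₃ a t) / 2)) =
    (paramS₃ a t - paramS₂ a t) / 2 * (((paramS₂ a t + paramS₃ a t) / 2 - paramS₁ a t) -
      (2 + a - (paramS₂ a t + paramS₃ a t) / 2)) := by
  have hne := hD.ne'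
  rw [paramS_mid, paramS_mid', paramS_radius, paramU]
  have e : (2 - a) * (1 - 3 * t ^ 2) / (1 + 3 * t ^ 2) *
      ((2 + a + (10 + a) * t ^ 2) / (1 + 3 * t ^ 2)) = (2 - a) * paramD a t / (1 + 3 * t ^ 2) ^ 2 :=
      by
    rw [paramD]; field_simp
  rw [e]
  field_simp
  ring

theorem paramV_spec (hD : 0 < paramD a t) : paramV a t * t ^ 2 *
      (((paramS₂ a t + paramS₃ a t) / 2 - paramS₁ a t) *
        (2 + a - (paramS₂ a t + paramS₃ a t) / 2)) = -((paramS₃ a t - paramS₂ a t) / 2) ^ 2 := by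
  have hne := hD.ne'
  rw [paramS_mid, paramS_mid', paramS_radius, paramV]
  have e : (2 - a) * (1 - 3 * t ^ 2) / (1 + 3 * t ^ 2) *
      ((2 + a + (10 + a) * t ^ 2) / (1 + 3 * t ^ 2)) = (2 - a) * paramD a t / (1 + 3 * t ^ 2) ^ 2 :=
      by
    rw [paramD]; field_simp
  rw [e]
  field_simp
  ring

theorem sqrt_paramS_mid (ha₁ : -2 < a) (ha₂ : a < 2) :
    Real.sqrt (((paramS₂ a t + paramS₃ a t) / 2 - paramS₁ a t) *
        (2 + a - (paramS₂ a t + paramS₃ a t) / 2)) =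
      Real.sqrt ((2 + a) * (2 - a)) * Real.sqrt ((2 + a)⁻¹ * paramD a t) / (1 + 3 * t ^ 2) := by
  have hσ : 0 < 2 + a := by linarith
  have hβ : 0 < 2 - a := by linarith
  have e : (2 - a) * (1 - 3 * t ^ 2) / (1 + 3 * t ^ 2) *
      ((2 + a + (10 + a) * t ^ 2) / (1 + 3 * t ^ 2)) =
      (2 + a) * (2 - a) * ((2 + a)⁻¹ * paramD a t) / (1 + 3 * t ^ 2) ^ 2 := by
    rw [paramD]; field_simp
  rw [paramS_mid, paramS_mid', e, Real.sqrt_div' _ (by positivity), Real.sqrt_sq (by positivity),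
    Real.sqrt_mul (by positivity)]

theorem eventually_bounds (ha₁ : -2 < a) (ha₂ : a < 2) :
    ∃ M, ∀ᶠ t in 𝓝[>] (0:ℝ), |paramU a t| ≤ M ∧ |paramV a t| ≤ M := by
  have h1 := ((tay_U ha₁ ha₂).tendsto tendsto_sq_param).abs
  have h2 := ((tay_V ha₁ ha₂).tendsto tendsto_sq_param).abs
  refine ⟨max (|-4 * a / (2 + a)| + 1) (|(-8 + 4 * a) / (2 + a)| + 1), ?_⟩
  filter_upwards [h1.eventually (gt_mem_nhds (lt_add_one _)),
    h2.eventually (gt_mem_nhds (lt_add_one _))] with t h3 h4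
  exact ⟨h3.le.trans (le_max_left _ _), h4.le.trans (le_max_right _ _)⟩

end param

/-! ### The expansion of the action in the parameter. -/

section param

variable {a : ℝ}

theorem tay_action (ha₁ : -2 < a) (ha₂ : a < 2) :
    Tay4 (𝓝[>] (0:ℝ)) (fun t : ℝ => t ^ 2)
      (fun t => Real.sqrt ((2 + a) * (2 - a)) * paramAction a t) 
      0 (8 - 12 * a + 6 * a ^ 2 - a ^ 3) ((-304 + 152 * a + 164 * a ^ 2 - 94 * a ^ 3 - 10 * a ^ 4 +
      8 * a ^ 5) / (2 + a) ^ 2) ((6880 + 3760 * a - 5976 * a ^ 2 - 2492 * a ^ 3 + 1848 * a ^ 4 + 396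
      * a ^ 5 - 126 * a ^ 6 - 37 * a ^ 7) / (2 + a) ^ 4) := by
  obtain ⟨M, hM⟩ := eventually_bounds ha₁ ha₂
  obtain ⟨C, δ, hδ, h⟩ := exists_angleAction_expansion M
  refine (tay_main ha₁ ha₂).add_isBigO ?_
  have hhd := ((tay_inv_sqrt_D ha₁ ha₂).tendsto tendsto_sq_param).eventually
    (gt_mem_nhds (one_lt_two (α := ℝ)))
  have hq : 0 < (2 + a) * (2 - a) := mul_pos (by linarith) (by linarith)
  have hβ : 0 < 2 - a := by linarith
  have hσ : 0 < 2 + a := by linarith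
  refine IsBigO.of_bound (2 * (|C| * (4 * (2 - a) ^ 2) * (2 - a))) ?_
  have hlt : ∀ᶠ t in 𝓝[>] (0:ℝ), t < δ := nhdsWithin_le_nhds (gt_mem_nhds hδ)
  filter_upwards [hM, hhd, hlt, eventually_sextRoots ha₁ ha₂] with t hUV ht2 htδ ⟨ht, ht', hS⟩
  obtain ⟨-, hD⟩ := paramD_pos ht' ht hS
  have key := h _ _ _ _ _ _ _ hS.lt₁₂ hS.lt₂₃ hS.lt₃₄ (paramU_spec hD) (paramV_spec hD) hUV.1 hUV.2
    (by rw [abs_of_pos ht]; exact htδ.le)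
  rw [sqrt_paramS_mid ha₁ ha₂, paramS_mid, paramS_radius, abs_of_pos ht] at key
  have hN : 1 ≤ 1 + 3 * t ^ 2 := by nlinarith
  have hsD : 0 < Real.sqrt ((2 + a)⁻¹ * paramD a t) := Real.sqrt_pos.2 (by positivity)
  rw [← paramAction] at key
  generalize Real.sqrt ((2 + a)⁻¹ * paramD a t) = s at *
  generalize Real.sqrt ((2 + a) * (2 - a)) = w at *
  generalize isq₁ (paramU a t) = w₁ at *
  generalize isq₂ (paramU a t) (paramV a t) = w₂ at *
  generalize isq₃ (paramU a t) (paramV a t) = w₃ at *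
  generalize isq₄ (paramU a t) (paramV a t) = w₄ at *
  generalize isq₅ (paramU a t) (paramV a t) = w₅ at *
  generalize paramAction a t = J at *
  generalize hNN : 1 + 3 * t ^ 2 = N at *
  have hN0 : 0 < N := by linarith
  rw [Real.norm_eq_abs, Real.norm_eq_abs, abs_of_pos (by positivity : 0 < (t ^ 2) ^ 4)]
  have e : w * J - N * s⁻¹ * ((2 - a) ^ 2 * t ^ 2 * N⁻¹ ^ 3 * ((2 - a) * (1 - 3 * t ^ 2) *
      (1 + w₂ / 4 * t ^ 2 + w₄ / 8 * t ^ 4) - 2 * (2 - a) * (w₁ / 4 * t ^ 2 + w₃ / 8 * t ^ 4 +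
      5 * w₅ / 64 * t ^ 6))) = N * s⁻¹ / 4 * (4 * (w * s / N) * J -
      (2 * (2 - a) * t / N) ^ 2 * ((2 - a) * (1 - 3 * t ^ 2) / N *
      (1 + w₂ / 4 * t ^ 2 + w₄ / 8 * t ^ 4) - 2 * (2 - a) * t / N * (w₁ / 4 * t + w₃ / 8 * t ^ 3 +
      5 * w₅ / 64 * t ^ 5))) := by
    field_simp
    ring
  rw [e, abs_mul, abs_of_pos (by positivity : 0 < N * s⁻¹ / 4)]
  have hN2 : N ≤ 2 := by nlinarith
  have hA : (2 - a) * (1 - 3 * t ^ 2) / N ≤ 2 - a := by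
    rw [div_le_iff₀ hN0]
    nlinarith
  have hA0 : 0 ≤ (2 - a) * (1 - 3 * t ^ 2) / N :=
    div_nonneg (mul_nonneg hβ.le (by nlinarith)) hN0.le
  have hr : 2 * (2 - a) * t / N ≤ 2 * (2 - a) * t := div_le_self (by positivity) hN
  calc _ ≤ N * s⁻¹ / 4 * (C * (2 * (2 - a) * t / N) ^ 2 * ((2 - a) * (1 - 3 * t ^ 2) / N) * t ^ 6)
      :=
        mul_le_mul_of_nonneg_left key (by positivity)
    _ ≤ 2 * 2 / 4 * (|C| * (2 * (2 - a) * t) ^ 2 * (2 - a) * t ^ 6) := by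
      refine mul_le_mul (by gcongr) ?_ ?_ (by positivity)
      · have := le_abs_self C
        gcongr
      · exact (abs_nonneg _).trans key
    _ = |C| * (4 * (2 - a) ^ 2) * (2 - a) * (t ^ 2) ^ 4 := by ring
    _ ≤ _ := by
      have : 0 ≤ |C| * (4 * (2 - a) ^ 2) * (2 - a) * (t ^ 2) ^ 4 := by positivity
      linarith

theorem stepCos_param (ha₂ : a < 2) {t : ℝ} (ht : 0 < t) (ht' : t < 1 / 3) :
    stepCos a (paramS₂ a t) (paramS₃ a t) = a / 2 + paramEps a t := by
  have hβ : 0 < 2 - a := by linarith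
  have h1 : 0 < 1 - t := by linarith
  have hd : 0 < 1 + 3 * t ^ 2 + (2 - a) * t * (1 - t) := by positivity
  have e1 : paramS₃ a t / 2 = (2 - a) * t * (1 - t) / (1 + 3 * t ^ 2) := by
    rw [paramS₃]; ring
  have e2 : (paramS₂ a t + paramS₃ a t) / 2 = -(2 * (2 - a) * t ^ 2) / (1 + 3 * t ^ 2) := by
    unfold paramS₂ paramS₃; field_simp; ring
  have e3 : 1 + (2 - a) * t * (1 - t) / (1 + 3 * t ^ 2) =
    (1 + 3 * t ^ 2 + (2 - a) * t * (1 - t)) / (1 + 3 * t ^ 2) := by field_simp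
  rw [stepCos, e2, paramS_radius, e1, e3, paramEps]
  field_simp
  ring

end param

/-! ### The expansion of the rotation number in the parameter. -/

section param

variable {a : ℝ}

/-- The mean of the expansion of the inverse angular velocity. -/
def stepMean (a t : ℝ) : ℝ :=
  1 + isq₂ (paramU a t) (paramV a t) / 2 * t ^ 2 + 3 * isq₄ (paramU a t) (paramV a t) / 8 * t ^ 4

/-- The coefficient of the sine in the expansion of the time of one step. -/
def stepSine (a t : ℝ) : ℝ :=
  -(isq₁ (paramU a t) * t) + isq₂ (paramU a t) (paramV a t) * t ^ 2 * (a / 2 + paramEps a t) / 2 -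
    isq₃ (paramU a t) (paramV a t) * t ^ 3 * (2 + (a / 2 + paramEps a t) ^ 2) / 3 +
    isq₄ (paramU a t) (paramV a t) * t ^ 4 *
      ((a / 2 + paramEps a t) ^ 3 / 4 + 3 * (a / 2 + paramEps a t) / 8) -
    isq₅ (paramU a t) (paramV a t) * t ^ 5 *
      ((a / 2 + paramEps a t) ^ 4 / 5 + 4 * (a / 2 + paramEps a t) ^ 2 / 15 + 8 / 15)

theorem paramPeriod_isBigO (ha₁ : -2 < a) (ha₂ : a < 2) :
    (fun t => Real.sqrt ((2 + a) * (2 - a)) * Real.sqrt ((2 + a)⁻¹ * paramD a t) /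
        (1 + 3 * t ^ 2) * anglePeriod (paramS₁ a t) (paramS₂ a t) (paramS₃ a t) (2 + a) -
      2 * Real.pi * stepMean a t) =O[𝓝[>] 0] fun t : ℝ => t ^ 6 := by
  obtain ⟨M, hM⟩ := eventually_bounds ha₁ ha₂
  obtain ⟨C, δ, hδ, h⟩ := exists_anglePeriod_expansion M
  have hlt : ∀ᶠ t in 𝓝[>] (0:ℝ), t < δ := nhdsWithin_le_nhds (gt_mem_nhds hδ)
  refine IsBigO.of_bound C ?_
  filter_upwards [hM, hlt, eventually_sextRoots ha₁ ha₂] with t hUV htδ ⟨ht, ht', hS⟩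
  obtain ⟨-, hD⟩ := paramD_pos ht' ht hS
  have key := h _ _ _ _ _ _ _ hS.lt₁₂ hS.lt₂₃ hS.lt₃₄ (paramU_spec hD) (paramV_spec hD) hUV.1 hUV.2
    (by rw [abs_of_pos ht]; exact htδ.le)
  rw [sqrt_paramS_mid ha₁ ha₂] at key
  rwa [Real.norm_eq_abs, Real.norm_eq_abs, abs_pow, stepMean]

theorem paramStep_isBigO (ha₁ : -2 < a) (ha₂ : a < 2) :
    (fun t => Real.sqrt ((2 + a) * (2 - a)) * Real.sqrt ((2 + a)⁻¹ * paramD a t) /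
        (1 + 3 * t ^ 2) * angleStep a (paramS₁ a t) (paramS₂ a t) (paramS₃ a t) -
      (Real.arccos (a / 2 + paramEps a t) * stepMean a t +
        Real.sqrt (1 - (a / 2 + paramEps a t) ^ 2) * stepSine a t))
      =O[𝓝[>] 0] fun t : ℝ => t ^ 6 := by
  obtain ⟨M, hM⟩ := eventually_bounds ha₁ ha₂
  obtain ⟨C, δ, hδ, h⟩ := exists_angleStep_expansion M
  have hlt : ∀ᶠ t in 𝓝[>] (0:ℝ), t < δ := nhdsWithin_le_nhds (gt_mem_nhds hδ)
  refine IsBigO.of_bound C ?_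
  filter_upwards [hM, hlt, eventually_sextRoots ha₁ ha₂] with t hUV htδ ⟨ht, ht', hS⟩
  obtain ⟨-, hD⟩ := paramD_pos ht' ht hS
  have hX := hS.stepCos_bounds ha₂
  have key := h _ _ _ _ _ _ _ _ hS.lt₁₂ hS.lt₂₃ hS.lt₃₄ (paramU_spec hD) (paramV_spec hD) hUV.1
    hUV.2 (by rw [abs_of_pos ht]; exact htδ.le) hX.1 hX.2.le
  rw [sqrt_paramS_mid ha₁ ha₂, ← angleStep, stepCos_param ha₂ ht ht'] at key
  rwa [Real.norm_eq_abs, Real.norm_eq_abs, abs_pow, stepMean, stepSine]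

theorem paramEps_isBigO (ha₁ : -2 < a) (ha₂ : a < 2) :
    (fun t => paramEps a t ^ 6) =O[𝓝[>] 0] fun t : ℝ => t ^ 6 := by
  have h := (tay_eps_pow3 ha₁ ha₂).mul (tay_eps_pow3 ha₁ ha₂) tendsto_param
  simp only [mul_zero, zero_mul, add_zero] at h
  refine IsBigO.congr_left h fun t => ?_
  ring

/-- Step time and period carry the same prefactor, which cancels in their quotient; what remains is
(arccos X · mean + √(1 − X²) · sine)/mean. -/
theorem stepTime_isBigO (ha₁ : -2 < a) (ha₂ : a < 2) :
    (fun t => 2 * Real.pi * paramRotation a t - (Real.arccos (a / 2 + paramEps a t) +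
        Real.sqrt (1 - (a / 2 + paramEps a t) ^ 2) * stepSine a t * (stepMean a t)⁻¹))
      =O[𝓝[>] 0] fun t : ℝ => t ^ 6 := by
  have hP := paramPeriod_isBigO ha₁ ha₂
  have hS := paramStep_isBigO ha₁ ha₂
  have hm : Tendsto (stepMean a) (𝓝[>] 0) (𝓝 1) := (tay_step_mean ha₁ ha₂).tendsto tendsto_param
  have hs : Tendsto (stepSine a) (𝓝[>] 0) (𝓝 0) := (tay_step_sine ha₁ ha₂).tendsto tendsto_param
  have he : Tendsto (paramEps a) (𝓝[>] 0) (𝓝 0) := (tay_eps ha₁ ha₂).tendsto tendsto_param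
  set H : ℝ → ℝ := fun t => Real.arccos (a / 2 + paramEps a t) +
        Real.sqrt (1 - (a / 2 + paramEps a t) ^ 2) * stepSine a t * (stepMean a t)⁻¹ with hH
  have hHt : H =O[𝓝[>] 0] fun _ => (1:ℝ) := by
    have h1 : Tendsto (fun t => a / 2 + paramEps a t) (𝓝[>] 0) (𝓝 (a / 2 + 0)) := he.const_add _
    have h2 : Tendsto (fun t => Real.arccos (a / 2 + paramEps a t)) (𝓝[>] 0)
      (𝓝 (Real.arccos (a / 2 + 0))) := (Real.continuous_arccos.tendsto _).comp h1
    exact Tendsto.isBigO_one ℝ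
      (h2.add ((((h1.pow 2).const_sub 1).sqrt.mul hs).mul (hm.inv₀ one_ne_zero)))
  set p : ℝ → ℝ := fun t => Real.sqrt ((2 + a) * (2 - a)) * Real.sqrt ((2 + a)⁻¹ * paramD a t) /
        (1 + 3 * t ^ 2) * anglePeriod (paramS₁ a t) (paramS₂ a t) (paramS₃ a t) (2 + a) with hp
  have hpt : Tendsto p (𝓝[>] 0) (𝓝 (2 * Real.pi)) := by
    have h6 : Tendsto (fun t : ℝ => t ^ 6) (𝓝[>] 0) (𝓝 0) := by simpa using tendsto_param.pow 6
    have := (hP.trans_tendsto h6).add (hm.const_mul (2 * Real.pi))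
    simpa using this
  have hpi : (2 * Real.pi) ≠ 0 := Real.two_pi_pos.ne'
  have hpinv : (fun t => (p t)⁻¹) =O[𝓝[>] 0] fun _ => (1:ℝ) := (hpt.inv₀ hpi).isBigO_one ℝ
  have hmain := isBigO_mul_pow ((hS.const_mul_left (2 * Real.pi)).sub (isBigO_mul_pow hP hHt)) hpinv
  refine hmain.congr' ?_ EventuallyEq.rfl
  filter_upwards [hm.eventually_ne one_ne_zero, hpt.eventually_ne hpi,
    eventually_sextRoots ha₁ ha₂] with t h1 h2 ⟨ht, ht', hR⟩
  have hρ : paramRotation a t = Real.sqrt ((2 + a) * (2 - a)) *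
      Real.sqrt ((2 + a)⁻¹ * paramD a t) / (1 + 3 * t ^ 2) *
      angleStep a (paramS₁ a t) (paramS₂ a t) (paramS₃ a t) * (p t)⁻¹ := by
    have h3 : Real.sqrt ((2 + a) * (2 - a)) *
      Real.sqrt ((2 + a)⁻¹ * paramD a t) / (1 + 3 * t ^ 2) ≠ 0 := fun h0 => by
      apply h2; simp only [hp, h0, zero_mul]
    rw [paramRotation, ← div_eq_mul_inv, hp, mul_div_mul_left _ _ h3]
  rw [hρ]
  simp only [hH]
  change _ = _ - _
  generalize Real.arccos (a / 2 + paramEps a t) = θ at *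
  generalize Real.sqrt (1 - (a / 2 + paramEps a t) ^ 2) = s at *
  generalize stepMean a t = m at *
  generalize stepSine a t = n at *
  change (2 * Real.pi * (_ - (θ * m + s * n)) - (p t - 2 * Real.pi * m) * (θ + s * n * m⁻¹)) * (p
      t)⁻¹ = _
  generalize p t = P at *
  field_simp
  ring

theorem tay_paramRotation (ha₁ : -2 < a) (ha₂ : a < 2) :
    Tay6 (𝓝[>] (0:ℝ)) (fun t : ℝ => t) (fun t => 2 * Real.pi * paramRotation a t)
      (Real.arccos (a / 2)) 0 (2 / Real.sqrt ((2 + a) * (2 - a)) *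
        ((-16 - 10 * a + 7 * a ^ 2 + a ^ 3) / (2 * (2 + a)))) 0
      (2 / Real.sqrt ((2 + a) * (2 - a)) *
        ((-256 - 12 * a + 198 * a ^ 2 - 34 * a ^ 3 + 5 * a ^ 4 - 8 * a ^ 5 - a ^ 6) /
          (4 * (2 + a) ^ 3))) 0 := by
  have he : Tendsto (paramEps a) (𝓝[>] 0) (𝓝 0) := (tay_eps ha₁ ha₂).tendsto tendsto_param
  have harc := ((arccos_expansion ha₁ ha₂).comp_tendsto he).trans (paramEps_isBigO ha₁ ha₂)
  have h0 := (Tay6.poly (l := 𝓝[>] (0:ℝ)) (x := fun t => t) (Real.arccos (a / 2)) 0 0 0 0 0).add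
    ((tay_rotation ha₁ ha₂).const_mul (2 / Real.sqrt ((2 + a) * (2 - a))))
  have h1 := h0.add_isBigO (g := fun t => Real.arccos (a / 2 + paramEps a t) +
    Real.sqrt (1 - (a / 2 + paramEps a t) ^ 2) * stepSine a t * (stepMean a t)⁻¹)
    (harc.congr' ?_ EventuallyEq.rfl)
  · refine (h1.add_isBigO (stepTime_isBigO ha₁ ha₂)).congr ?_ ?_ ?_ ?_ ?_ ?_ <;> ring
  have hrad := ((tay_radicand ha₁ ha₂).tendsto tendsto_param).eventually
    (lt_mem_nhds (one_pos (α := ℝ)))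
  filter_upwards [hrad] with t hr
  have hσ : 0 < 2 + a := by linarith
  have hβ : 0 < 2 - a := by linarith
  have hq : 0 < (2 + a) * (2 - a) := mul_pos hσ hβ
  have hfac : 1 - (a / 2 + paramEps a t) ^ 2 = (2 + a) * (2 - a) / 4 *
      (1 + stepU a * paramEps a t + stepV a * paramEps a t ^ 2) := by
    rw [stepU, stepV]
    field_simp
    ring
  have h3 : Real.sqrt (1 - (a / 2 + paramEps a t) ^ 2) = Real.sqrt ((2 + a) * (2 - a)) / 2 *
      Real.sqrt (1 + stepU a * paramEps a t + stepV a * paramEps a t ^ 2) := by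
    rw [hfac, Real.sqrt_mul (by positivity), Real.sqrt_div' _ (by norm_num),
      show (4:ℝ) = 2 ^ 2 by norm_num, Real.sqrt_sq (by norm_num)]
  rw [h3]
  simp only [Function.comp_apply]
  rw [← stepMean, ← stepSine]
  have hw : Real.sqrt ((2 + a) * (2 - a)) ^ 2 = (2 + a) * (2 - a) := Real.sq_sqrt hq.le
  have hw0 : Real.sqrt ((2 + a) * (2 - a)) ≠ 0 := (Real.sqrt_pos.2 hq).ne'
  have hrs := Real.sq_sqrt hr.le
  have hrs0 := (Real.sqrt_pos.2 hr).ne'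
  rw [← hw, ← hrs]
  simp only [Real.sqrt_sq (Real.sqrt_nonneg _)]
  generalize Real.sqrt (1 + stepU a * paramEps a t + stepV a * paramEps a t ^ 2) = r at *
  generalize Real.sqrt ((2 + a) * (2 - a)) = w at *
  generalize (stepMean a t)⁻¹ = m
  generalize Real.arccos (a / 2 + paramEps a t) = θ
  field_simp
  ring

end param

/-! ### Comparison with the claimed series. -/

section param

variable {a : ℝ}

theorem four_sub_sq_rpow (ha₁ : -2 < a) (ha₂ : a < 2) : (4 - a ^ 2) ^ (3 / 2 : ℝ) =
    Real.sqrt ((2 + a) * (2 - a)) * ((2 + a) * (2 - a)) := by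
  have hq : 0 < (2 + a) * (2 - a) := mul_pos (by linarith) (by linarith)
  rw [show 4 - a ^ 2 = (2 + a) * (2 - a) by ring, show (3 / 2 : ℝ) = 1 / 2 + 1 by norm_num,
    Real.rpow_add hq, Real.rpow_one, Real.sqrt_eq_rpow]

theorem Tay4.sub_isBigO {α : Type*} {l : Filter α} {x f g : α → ℝ} {c₀ c₁ c₂ c₃ : ℝ}
    (h : Tay4 l x f c₀ c₁ c₂ c₃) (h' : Tay4 l x g c₀ c₁ c₂ c₃) :
    (fun t => f t - g t) =O[l] fun t => x t ^ 4 :=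
  (IsBigO.sub h h').congr_left fun t => by ring

theorem Tay6.sub_isBigO {α : Type*} {l : Filter α} {x f g : α → ℝ} {c₀ c₁ c₂ c₃ c₄ c₅ : ℝ}
    (h : Tay6 l x f c₀ c₁ c₂ c₃ c₄ c₅) (h' : Tay6 l x g c₀ c₁ c₂ c₃ c₄ c₅) :
    (fun t => f t - g t) =O[l] fun t => x t ^ 6 :=
  (IsBigO.sub h h').congr_left fun t => by ring

/-- The claimed series is composed with E(t) and compared with the action up to O(t⁸); t² = O(E)
converts the error. -/
theorem paramAction_sub_seriesInv (ha₁ : -2 < a) (ha₂ : a < 2) :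
    (fun t => paramAction a t - sextActionSeriesInv a (paramE a t))
      =O[𝓝[>] 0] fun t => paramE a t ^ 4 := by
  have hσ : 2 + a ≠ 0 := by linarith
  have hβ : 2 - a ≠ 0 := by linarith
  have hq : 0 < (2 + a) * (2 - a) := mul_pos (by linarith) (by linarith)
  have hE := tay_E ha₁ ha₂
  have hE2 := hE.mul hE tendsto_sq_param
  have hE3 := hE2.mul hE tendsto_sq_param
  have hser := (hE.add (hE2.const_mul (3 * (2 + 2 * a + a ^ 2) / ((2 - a) ^ 3 * (2 + a) ^ 2)))).add
    (hE3.const_mul (10 * (22 + 48 * a + 42 * a ^ 2 + 16 * a ^ 3 + 3 * a ^ 4) /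
      ((2 - a) ^ 6 * (2 + a) ^ 4)))
  have h1 := (tay_action ha₁ ha₂).sub_isBigO (hser.congr ?_ ?_ ?_ ?_)
  · have h2 : (fun t => paramAction a t - sextActionSeriesInv a (paramE a t))
        =O[𝓝[>] 0] fun t : ℝ => (t ^ 2) ^ 4 := by
      refine (h1.const_mul_left (Real.sqrt ((2 + a) * (2 - a)))⁻¹).congr_left fun t => ?_
      have hw := (Real.sqrt_pos.2 hq).ne'
      rw [sextActionSeriesInv, show 4 - a ^ 2 = (2 + a) * (2 - a) by ring,
        show a - 2 = -(2 - a) by ring, show a ^ 2 - 4 = -((2 + a) * (2 - a)) by ring]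
      field_simp
      ring
    refine h2.trans (IsBigO.pow ?_ 4)
    refine IsBigO.of_bound (3 / (2 - a) ^ 3) ?_
    filter_upwards [eventually_sextRoots ha₁ ha₂] with t ⟨ht, ht', hS⟩
    have hβ3 : 0 < (2 - a) ^ 3 := pow_pos (by linarith) 3
    rw [Real.norm_of_nonneg (by positivity), Real.norm_of_nonneg (hS.level_pos ha₂).le,
      div_mul_eq_mul_div, le_div_iff₀ hβ3]
    have := le_paramE ha₂ ht ht'
    linarith
  all_goals first | ring1 | (field_simp; ring1)

/-- The leading term of the action is a positive multiple of t². This converts O(t⁶) into the cube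
of the action. -/
theorem sq_isBigO_paramAction (ha₁ : -2 < a) (ha₂ : a < 2) :
    (fun t : ℝ => t ^ 2) =O[𝓝[>] 0] paramAction a := by
  have hβ : 0 < 2 - a := by linarith
  have hq : 0 < (2 + a) * (2 - a) := mul_pos (by linarith) (by linarith)
  have hw := (Real.sqrt_pos.2 hq).ne'
  have h := tay_action ha₁ ha₂
  have hy : (fun t : ℝ => (t ^ 2) ^ 2) =o[𝓝[>] 0] fun t : ℝ => t ^ 2 := by
    have := (isLittleO_pow_id (𝕜 := ℝ) one_lt_two).comp_tendsto tendsto_sq_param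
    exact this
  set f : ℝ → ℝ := fun t => Real.sqrt ((2 + a) * (2 - a)) * paramAction a t with hf
  have h2 : (fun t => f t - (2 - a) ^ 3 * t ^ 2) =O[𝓝[>] 0] fun t : ℝ => (t ^ 2) ^ 2 := by
    have h3 : (fun t : ℝ => (t ^ 2) ^ 4) =O[𝓝[>] 0] fun t : ℝ => (t ^ 2) ^ 2 := by
      have := isBigO_mul_pow (n := 2) (isBigO_refl (fun t : ℝ => (t ^ 2) ^ 2) (𝓝[>] 0))
        ((tendsto_sq_param.pow 2).isBigO_one ℝ)
      exact this.congr_left fun t => by ring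
    have h4 := isBigO_mul_pow (n := 2) (x := fun t : ℝ => t ^ 2)
      (isBigO_refl (fun t : ℝ => (t ^ 2) ^ 2) (𝓝[>] 0))
      ((Tay4.poly (l := 𝓝[>] (0:ℝ)) (x := fun t : ℝ => t ^ 2)
        ((-304 + 152 * a + 164 * a ^ 2 - 94 * a ^ 3 - 10 * a ^ 4 + 8 * a ^ 5) / (2 + a) ^ 2)
        ((6880 + 3760 * a - 5976 * a ^ 2 - 2492 * a ^ 3 + 1848 * a ^ 4 + 396 * a ^ 5 -
        126 * a ^ 6 - 37 * a ^ 7) / (2 + a) ^ 4) 0 0).isBigO_one tendsto_sq_param)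
    refine ((IsBigO.trans h h3).add h4).congr_left fun t => ?_
    simp only [hf]
    ring
  have h5 := (h2.trans_isLittleO hy)
  have h6 := (h5.trans_isBigO (isBigO_const_mul_self ((2 - a) ^ 3)⁻¹
    (fun t : ℝ => (2 - a) ^ 3 * t ^ 2) (𝓝[>] 0) |>.congr_left fun t => by
        field_simp)).right_isBigO_add
  have h7 : (fun t : ℝ => t ^ 2) =O[𝓝[>] 0] fun t : ℝ => (2 - a) ^ 3 * t ^ 2 :=
    isBigO_const_mul_self ((2 - a) ^ 3)⁻¹
      (fun t : ℝ => (2 - a) ^ 3 * t ^ 2) (𝓝[>] 0) |>.congr_left fun t => by field_simp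
  refine (h7.trans h6).trans ?_
  refine IsBigO.congr_left (isBigO_const_mul_self (Real.sqrt ((2 + a) * (2 - a))) _ _) fun t => ?_
  simp [hf]

theorem tendsto_paramAction (ha₁ : -2 < a) (ha₂ : a < 2) :
    Tendsto (paramAction a) (𝓝[>] 0) (𝓝 0) := by
  have hq : 0 < (2 + a) * (2 - a) := mul_pos (by linarith) (by linarith)
  have hw := (Real.sqrt_pos.2 hq).ne'
  have := ((tay_action ha₁ ha₂).tendsto tendsto_sq_param).const_mul
    (Real.sqrt ((2 + a) * (2 - a)))⁻¹
  simpa [hw] using this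

theorem paramAction_sub_seriesModulus (ha₁ : -2 < a) (ha₂ : a < 2) :
    (fun t => paramAction a t - (2 - a) * (4 - a ^ 2) ^ (3 / 2 : ℝ) / 2 ^ 8 *
      (paramK a t ^ 2 + paramK a t ^ 3 +
      (97 - 27 * a - 15 * a ^ 2 - a ^ 3) / 2 ^ 7 * paramK a t ^ 4 +
      (33 - 27 * a - 15 * a ^ 2 - a ^ 3) / 2 ^ 6 * paramK a t ^ 5))
      =O[𝓝[>] 0] fun t => paramK a t ^ 6 := by
  have hσ : 2 + a ≠ 0 := by linarith
  have hβ : 2 - a ≠ 0 := by linarith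
  have hq : 0 < (2 + a) * (2 - a) := mul_pos (by linarith) (by linarith)
  have hw := (Real.sqrt_pos.2 hq).ne'
  have hw2 : Real.sqrt ((2 + a) * (2 - a)) ^ 2 = (2 + a) * (2 - a) := Real.sq_sqrt hq.le
  have h1 := ((tay_action ha₁ ha₂).tay6 tendsto_param fun _ => rfl).sub_isBigO
    (((tay_modulus_series ha₁ ha₂).const_mul ((2 - a) * ((2 + a) * (2 - a)) ^ 2 / 2 ^ 8)).congr
      ?_ ?_ ?_ ?_ ?_ ?_)
  · have h2 : (fun t => paramAction a t - (2 - a) * (4 - a ^ 2) ^ (3 / 2 : ℝ) / 2 ^ 8 *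
      (paramK a t ^ 2 + paramK a t ^ 3 +
      (97 - 27 * a - 15 * a ^ 2 - a ^ 3) / 2 ^ 7 * paramK a t ^ 4 +
      (33 - 27 * a - 15 * a ^ 2 - a ^ 3) / 2 ^ 6 * paramK a t ^ 5))
        =O[𝓝[>] 0] fun t : ℝ => t ^ 6 := by
      refine (h1.const_mul_left (Real.sqrt ((2 + a) * (2 - a)))⁻¹).congr_left fun t => ?_
      rw [four_sub_sq_rpow ha₁ ha₂, ← hw2]
      simp only [Real.sqrt_sq (Real.sqrt_nonneg _)]
      generalize Real.sqrt ((2 + a) * (2 - a)) = w at *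
      field_simp
    -- `paramK` is t times a function with a nonzero limit, so t = O(κ²).
    refine h2.trans (IsBigO.pow ?_ 6)
    have hd := (tay_modulus_den ha₁ ha₂).tendsto tendsto_param
    have hn : Tendsto (fun t : ℝ => 16 * (1 + (1 + a) * t ^ 2)) (𝓝[>] 0)
        (𝓝 (16 * (1 + (1 + a) * 0))) := ((tendsto_sq_param.const_mul _).const_add _).const_mul _
    have hn0 : (16 * (1 + (1 + a) * 0)) ≠ 0 := by norm_num
    have hb := isBigO_mul_pow (n := 1) (x := paramK a) (f := paramK a)
      (by simpa using isBigO_refl _ _) ((hd.mul (hn.inv₀ hn0)).isBigO_one ℝ)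
    simp only [pow_one] at hb
    refine hb.congr' ?_ EventuallyEq.rfl
    filter_upwards [hd.eventually_ne hσ, hn.eventually_ne hn0] with t h3 h4
    rw [paramK, show 16 * t * (1 + (1 + a) * t ^ 2) = t * (16 * (1 + (1 + a) * t ^ 2)) by ring]
    generalize 16 * (1 + (1 + a) * t ^ 2) = n at *
    generalize (1 - t) * (1 + 3 * t) * (2 + a + 2 * (2 - a) * t + (10 + a) * t ^ 2) = d at *
    field_simp
  all_goals first | ring1 | (field_simp; ring1)

theorem paramRotation_sub_series (ha₁ : -2 < a) (ha₂ : a < 2) :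
    (fun t => paramRotation a t - sextNuSeries a (paramAction a t))
      =O[𝓝[>] 0] fun t => paramAction a t ^ 3 := by
  have hσ : 2 + a ≠ 0 := by linarith
  have hβ : 2 - a ≠ 0 := by linarith
  have hq : 0 < (2 + a) * (2 - a) := mul_pos (by linarith) (by linarith)
  have hw := (Real.sqrt_pos.2 hq).ne'
  have hw2 : Real.sqrt ((2 + a) * (2 - a)) ^ 2 = (2 + a) * (2 - a) := Real.sq_sqrt hq.le
  have hrot := tay_paramRotation ha₁ ha₂
  have hJ := ((tay_action ha₁ ha₂).tay6 tendsto_param fun _ => rfl)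
  have hJ2 := hJ.mul hJ tendsto_param
  generalize hww : Real.sqrt ((2 + a) * (2 - a)) = w at *
  have hser := ((Tay6.poly (l := 𝓝[>] (0:ℝ)) (x := fun t : ℝ => t) (Real.arccos (a / 2)) 0 0 0 0
      0).add
    (hJ.const_mul (-((1 + a) / ((2 - a) * ((2 + a) * (2 - a))) * (8 + a) / w)))).add
    (hJ2.const_mul (-((1 + a) / ((2 - a) * ((2 + a) * (2 - a))) *
      ((736 + 626 * a + 198 * a ^ 2 + 7 * a ^ 3 - a ^ 4) /
        (2 * (2 - a) * ((2 + a) * (2 - a)) ^ 2)) / w)))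
  have h1 := hrot.sub_isBigO (hser.congr ?_ ?_ ?_ ?_ ?_ ?_)
  · have h2 : (fun t => paramRotation a t - sextNuSeries a (paramAction a t))
        =O[𝓝[>] 0] fun t : ℝ => t ^ 6 := by
      refine (h1.const_mul_left (2 * Real.pi)⁻¹).congr_left fun t => ?_
      have hpi := Real.pi_ne_zero
      rw [sextNuSeries, sextNu₀, four_sub_sq_rpow ha₁ ha₂, hww,
        show 4 - a ^ 2 = (2 + a) * (2 - a) by ring, ← hw2]
      generalize Real.arccos (a / 2) = θ
      generalize 736 + 626 * a + 198 * a ^ 2 + 7 * a ^ 3 - a ^ 4 = M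
      generalize paramAction a t = J
      generalize paramRotation a t = ρ
      generalize 2 - a = β at *
      field_simp
      ring
    refine h2.trans ?_
    have := (sq_isBigO_paramAction ha₁ ha₂).pow 3
    exact this.congr_left fun t => by ring
  all_goals first | ring1 | (field_simp; ring1)

end param

/-! ### The action and the rotation number as functions of the level -/

def levelAction (a E : ℝ) : ℝ :=
  angleAction (Real.sqrt 2 * sextQ₁ a E) (Real.sqrt 2 * sextQ₂ a E) (Real.sqrt 2 * sextQ₃ a E) (2 +
      a)

def levelRotation (a E : ℝ) : ℝ :=
  angleStep a (Real.sqrt 2 * sextQ₁ a E) (Real.sqrt 2 * sextQ₂ a E) (Real.sqrt 2 * sextQ₃ a E) /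
    anglePeriod (Real.sqrt 2 * sextQ₁ a E) (Real.sqrt 2 * sextQ₂ a E) (Real.sqrt 2 * sextQ₃ a E)
      (2 + a)

open Classical in
/-- The rotation number of the curve with action `j`; at the origin its limit. -/
def actionRotation (a j : ℝ) : ℝ :=
  if h : ∃ E, (0 < E ∧ E < sextSep a) ∧ levelAction a E = j then levelRotation a h.choose
  else sextNu₀ a

section level

variable {a E : ℝ}

theorem levelAction_injOn (ha₁ : -2 < a) (ha₂ : a < 2) {E' : ℝ} (hE : 0 < E) (hE' : E < sextSep a)
    (hF : 0 < E') (hF' : E' < sextSep a) (h : levelAction a E = levelAction a E') : E = E' := by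
  have h1 := sextRoots ha₁ ha₂ hE hE'
  have h2 := sextRoots ha₁ ha₂ hF hF'
  rcases lt_trichotomy E E' with hlt | he | hlt
  · exact absurd h (h1.angleAction_lt h2 ha₂ hlt).ne
  · exact he
  · exact absurd h (h2.angleAction_lt h1 ha₂ hlt).ne'

theorem actionRotation_levelAction (ha₁ : -2 < a) (ha₂ : a < 2) (hE : 0 < E) (hE' : E < sextSep a) :
    actionRotation a (levelAction a E) = levelRotation a E := by
  have h : ∃ E', (0 < E' ∧ E' < sextSep a) ∧ levelAction a E' = levelAction a E :=
    ⟨E, ⟨hE, hE'⟩, rfl⟩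
  rw [actionRotation, dif_pos h,
    levelAction_injOn ha₁ ha₂ h.choose_spec.1.1 h.choose_spec.1.2 hE hE' h.choose_spec.2]

theorem actionRotation_zero (ha₁ : -2 < a) (ha₂ : a < 2) : actionRotation a 0 = sextNu₀ a := by
  rw [actionRotation, dif_neg]
  rintro ⟨E, ⟨h1, h2⟩, h3⟩
  exact (sextRoots ha₁ ha₂ h1 h2).angleAction_pos.ne' h3

theorem levelAction_paramE (ha₁ : -2 < a) (ha₂ : a < 2) {t : ℝ}
    (h : SextRoots a (paramE a t) (paramS₁ a t) (paramS₂ a t) (paramS₃ a t)) :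
    levelAction a (paramE a t) = paramAction a t ∧
      levelRotation a (paramE a t) = paramRotation a t := by
  obtain ⟨h1, h2, h3⟩ := h.unique (sextRoots ha₁ ha₂ (h.level_pos ha₂) (h.level_lt ha₂))
  rw [levelAction, levelRotation, h1, h2, h3]
  exact ⟨rfl, rfl⟩

theorem actionRotation_paramAction (ha₁ : -2 < a) (ha₂ : a < 2) {t : ℝ}
    (h : SextRoots a (paramE a t) (paramS₁ a t) (paramS₂ a t) (paramS₃ a t)) :
    actionRotation a (paramAction a t) = paramRotation a t := by
  obtain ⟨h1, h2⟩ := levelAction_paramE ha₁ ha₂ h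
  rw [← h1, ← h2, actionRotation_levelAction ha₁ ha₂ (h.level_pos ha₂) (h.level_lt ha₂)]

/-- Every sufficiently small action is the action of a curve with a small parameter. -/
theorem eventually_exists_paramAction_eq (ha₁ : -2 < a) (ha₂ : a < 2) {p : ℝ → Prop}
    (hp : ∀ᶠ t in 𝓝[>] (0:ℝ), p t) : ∀ᶠ j in 𝓝[>] (0:ℝ), ∃ t, p t ∧ paramAction a t = j := by
  obtain ⟨t₀, ht₀, hsub⟩ := mem_nhdsGT_iff_exists_Ioo_subset.1 ((eventually_sextRoots ha₁ ha₂).and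
      hp)
  have ht₀' : 0 < t₀ := ht₀
  have hmem : ∀ t ∈ Set.Ioc 0 (t₀ / 2), SextRoots a (paramE a t) (paramS₁ a t) (paramS₂ a t)
      (paramS₃ a t) ∧ p t := fun t ht => by
    have := hsub ⟨ht.1, by linarith [ht.2]⟩
    exact ⟨this.1.2.2, this.2⟩
  have hj : 0 < paramAction a (t₀ / 2) :=
    (hmem _ ⟨by linarith, le_rfl⟩).1.angleAction_pos
  filter_upwards [Ioo_mem_nhdsGT hj] with j hj'
  have h2 := ((tendsto_paramAction ha₁ ha₂).eventually (gt_mem_nhds hj'.1)).and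
    (Ioo_mem_nhdsGT (half_pos ht₀'))
  -- A parameter whose action is below j; together with t₀ / 2, whose action is above j, it brackets
  -- the solution.
  obtain ⟨t₁, h3, h4⟩ := h2.exists
  have hcont : ContinuousOn (paramAction a) (Set.Icc t₁ (t₀ / 2)) :=
    continuousOn_paramAction fun t ht => (hmem t ⟨h4.1.trans_le ht.1, ht.2⟩).1
  obtain ⟨t, ht, hte⟩ := intermediate_value_Icc h4.2.le hcont ⟨h3.le, hj'.2.le⟩
  exact ⟨t, (hmem t ⟨h4.1.trans_le ht.1, ht.2⟩).2, hte⟩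

theorem actionRotation_sub_series (ha₁ : -2 < a) (ha₂ : a < 2) :
    (fun j => actionRotation a j - sextNuSeries a j) =O[𝓝[>] 0] fun j => j ^ 3 := by
  obtain ⟨C, hC⟩ := (paramRotation_sub_series ha₁ ha₂).bound
  refine IsBigO.of_bound C ?_
  filter_upwards [eventually_exists_paramAction_eq ha₁ ha₂
    (hC.and (eventually_sextRoots ha₁ ha₂))] with j hj
  obtain ⟨t, ⟨h1, -, -, h2⟩, rfl⟩ := hj
  rwa [actionRotation_paramAction ha₁ ha₂ h2]

/-- The rotation number and its truncated series agree at 0 and differ by O(j³) = o(j), so they have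
the same one-sided derivative. -/
theorem hasDerivWithinAt_actionRotation (ha₁ : -2 < a) (ha₂ : a < 2) :
    HasDerivWithinAt (actionRotation a)
      (-(1 / (2 * Real.pi)) * ((1 + a) * (8 + a) / ((2 + a) * (2 - a) ^ 2))) (Set.Ici 0) 0 := by
  have hσ : 2 + a ≠ 0 := by linarith
  have hβ : 2 - a ≠ 0 := by linarith
  rw [← hasDerivWithinAt_Ioi_iff_Ici]
  have hd : HasDerivAt (sextNuSeries a)
      (-(1 / (2 * Real.pi)) * ((1 + a) * (8 + a) / ((2 + a) * (2 - a) ^ 2))) 0 := by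
    unfold sextNuSeries
    have := ((((hasDerivAt_id (0:ℝ)).const_mul (8 + a)).add ((hasDerivAt_pow 2 (0:ℝ)).const_mul
      ((736 + 626 * a + 198 * a ^ 2 + 7 * a ^ 3 - a ^ 4)
          / (2 * (2 - a) * (4 - a ^ 2) ^ (3 / 2 : ℝ))))).const_mul
      (1 / (2 * Real.pi) * ((1 + a) / ((2 - a) * (4 - a ^ 2))))).const_sub (sextNu₀ a)
    refine HasDerivAt.congr_deriv this ?_
    have hpi := Real.pi_ne_zero
    rw [show 4 - a ^ 2 = (2 + a) * (2 - a) by ring]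
    simp only [Nat.cast_ofNat, Nat.add_one_sub_one, pow_one, mul_zero, add_zero, mul_one]
    field_simp
  have hs := hasDerivWithinAt_iff_isLittleO.1 (hd.hasDerivWithinAt (s := Set.Ioi 0))
  rw [hasDerivWithinAt_iff_isLittleO]
  have h3 : (fun j : ℝ => j ^ 3) =o[𝓝[>] 0] fun j : ℝ => j - 0 := by
    have := (isLittleO_pow_id (𝕜 := ℝ) (n := 3) (by norm_num)).mono
      (nhdsWithin_le_nhds (s := Set.Ioi (0:ℝ)))
    simpa using this
  refine (((actionRotation_sub_series ha₁ ha₂).trans_isLittleO h3).add hs).congr_left fun j => ?_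
  have h0 : sextNuSeries a 0 = sextNu₀ a := by simp [sextNuSeries]
  rw [actionRotation_zero ha₁ ha₂, h0]
  ring

theorem exists_closedCurve_iff (ha₁ : -2 < a) (ha₂ : a < 2) :
    (∃ q p T, IsSextClosedCurve a E q p T) ↔ 0 < E ∧ E < sextSep a := by
  constructor
  · rintro ⟨q, p, T, h⟩
    obtain ⟨s₁, s₂, s₃, t, hs, -⟩ := h.exists_roots ha₁ ha₂
    exact ⟨hs.level_pos ha₂, hs.level_lt ha₂⟩
  · rintro ⟨h1, h2⟩
    obtain ⟨φ, -, -, h, -⟩ := (isSextAngleCurve (sextRoots ha₁ ha₂ h1 h2)).exists_closedCurve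
    exact ⟨_, _, _, h⟩

theorem closedCurve_level_spec (ha₁ : -2 < a) (ha₂ : a < 2) {q p : ℝ → ℝ} {T : ℝ}
    (h : IsSextClosedCurve a E q p T) : canonicalAction q p T = levelAction a E ∧
      ∃ T', 0 < T' ∧ T' < T ∧ (∀ t, sextMap a (q t, p t) = (q (t + T'), p (t + T'))) ∧
        actionRotation a (levelAction a E) = T' / T := by
  obtain ⟨hE, hE'⟩ := (exists_closedCurve_iff ha₁ ha₂).1 ⟨q, p, T, h⟩
  obtain ⟨h1, h2, h3, h4, h5⟩ := (sextRoots ha₁ ha₂ hE hE').closedCurve_spec ha₁ ha₂ h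
  refine ⟨h1, _, h3, h4, h5, ?_⟩
  rw [actionRotation_levelAction ha₁ ha₂ hE hE', levelRotation, ← h2]

/-- The curve built over q is a closed curve of the same level, so its action is `levelAction a E`;
no change of variables between the two integrals is needed. -/
theorem exists_quartic_action (ha₁ : -2 < a) (ha₂ : a < 2) (hE : 0 < E) (hE' : E < sextSep a) :
    ∃ q₁ q₂ q₃ q₄ : ℝ, q₁ < q₂ ∧ q₂ < q₃ ∧ q₃ < q₄ ∧
      (∀ x, sextP a E x = (x - q₁) * (x - q₂) * (x - q₃) * (x - q₄)) ∧
      levelAction a E = 1 / (2 * Real.pi) * (∫ x in q₂..q₃, Real.sqrt (sextP a E x) / (x + 1)) ∧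
      levelAction a E = sextActionRoots a q₁ q₂ q₃ q₄ := by
  obtain ⟨q₁, q₂, q₃, q₄, h1, h12, h23, h34, e1, e2, e3, e4⟩ := exists_quartic_roots ha₁ ha₂ hE hE'
  have hP : ∀ x, sextP a E x = (x - q₁) * (x - q₂) * (x - q₃) * (x - q₄) := fun x => by
    rw [sextP]
    linear_combination x ^ 3 * e1 - x ^ 2 * e2 + x * e3 - e4
  obtain ⟨q, p, T, hc, hact⟩ := integral_quartic_action h1 h12 h23 h34 hP
  have h := ((closedCurve_level_spec ha₁ ha₂ hc).1).symm.trans hact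
  exact ⟨q₁, q₂, q₃, q₄, h12, h23, h34, hP, h,
    h.trans (integral_quartic_eq h1 h12 h23 h34 hP e1 e2)⟩

theorem rotated_action (ha₁ : -2 < a) (ha₂ : a < 2) (hE : 0 < E) (hE' : E < sextSep a) :
    levelAction a E = 1 / Real.pi *
        (∫ Q in (sextQ₂ a E)..(sextQ₃ a E), Real.sqrt (sextG a E Q / (sextQ₄ a - Q))) ∧
      levelAction a E = sextActionRotated a E := by
  have h := sextRoots ha₁ ha₂ hE hE'
  have h1 : levelAction a E = _ := angleAction_rotated h
  exact ⟨h1, h1.trans (integral_rotated_eq h)⟩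

theorem sextSep_pos (ha₁ : -2 < a) (ha₂ : a < 2) : 0 < sextSep a :=
  lt_min (div_pos (pow_pos (by linarith) 3) (by norm_num)) (pow_pos (by linarith) 2)

theorem levelAction_sub_seriesInv (ha₁ : -2 < a) (ha₂ : a < 2) :
    (fun E => levelAction a E - sextActionSeriesInv a E) =O[𝓝[>] 0] fun E => E ^ 4 := by
  obtain ⟨τ, hτ, ht⟩ := exists_sextParam ha₁ ha₂
  refine ((paramAction_sub_seriesInv ha₁ ha₂).comp_tendsto ht).congr' ?_ ?_ <;>
  · filter_upwards [Ioo_mem_nhdsGT (sextSep_pos ha₁ ha₂)] with E hE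
    obtain ⟨-, -, h1, h2, h3, h4⟩ := hτ E hE.1 hE.2
    simp only [Function.comp_apply, ← h4]
    try rw [levelAction, h1, h2, h3, paramAction]

theorem eventually_sextModulus_sq (ha₁ : -2 < a) (ha₂ : a < 2) : ∃ τ : ℝ → ℝ,
    Tendsto τ (𝓝[>] 0) (𝓝[>] 0) ∧ ∀ᶠ E in 𝓝[>] (0:ℝ), 0 < sextModulus a E ∧
      sextModulus a E ^ 2 = paramK a (τ E) ∧ levelAction a E = paramAction a (τ E) := by
  obtain ⟨τ, hτ, ht⟩ := exists_sextParam ha₁ ha₂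
  refine ⟨τ, ht, ?_⟩
  filter_upwards [Ioo_mem_nhdsGT (sextSep_pos ha₁ ha₂)] with E hE
  obtain ⟨h0, h0', h1, h2, h3, h4⟩ := hτ E hE.1 hE.2
  have hr := sextRoots ha₁ ha₂ hE.1 hE.2
  obtain ⟨g1, g2, g3, -⟩ := sextG_roots hr
  refine ⟨Real.sqrt_pos.2 (div_pos (mul_pos (by linarith) (by linarith))
    (mul_pos (by linarith) (by linarith))), sextModulus_sq hr ha₂ h0 h0' h1 h2 h3, ?_⟩
  rw [levelAction, h1, h2, h3, paramAction]

theorem tendsto_sextModulus (ha₁ : -2 < a) (ha₂ : a < 2) :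
    Tendsto (sextModulus a) (𝓝[>] 0) (𝓝[>] 0) := by
  obtain ⟨τ, ht, hτ⟩ := eventually_sextModulus_sq ha₁ ha₂
  refine tendsto_nhdsWithin_iff.2 ⟨?_, hτ.mono fun E hE => hE.1⟩
  have h1 := (((tay_modulus ha₁ ha₂).tendsto tendsto_param).comp ht).sqrt
  rw [Real.sqrt_zero] at h1
  refine h1.congr' (hτ.mono fun E hE => ?_)
  rw [Function.comp_apply, ← hE.2.1, Real.sqrt_sq hE.1.le]

theorem levelAction_sub_seriesModulus (ha₁ : -2 < a) (ha₂ : a < 2) :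
    (fun E => levelAction a E - sextActionSeriesModulus a (sextModulus a E))
      =O[𝓝[>] 0] fun E => sextModulus a E ^ 12 := by
  obtain ⟨τ, ht, hτ⟩ := eventually_sextModulus_sq ha₁ ha₂
  refine ((paramAction_sub_seriesModulus ha₁ ha₂).comp_tendsto ht).congr' ?_ ?_ <;>
  · filter_upwards [hτ] with E hE
    simp only [Function.comp_apply, ← hE.2.1, ← hE.2.2, sextActionSeriesModulus]
    ring

end level

end

theorem mainTheorem4 (a : ℝ) (ha₁ : -2 < a) (ha₂ : a < 2) :
    -- closed invariant curves exist exactly for `0 < E < sextSep a`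
    (∀ E : ℝ, (∃ q p T, IsSextClosedCurve a E q p T) ↔ 0 < E ∧ E < sextSep a) ∧
    ∃ J ν : ℝ → ℝ,
      -- `J E` is the action of every closed invariant curve at the level `E`, in both coordinate
      -- systems, and `ν (J E)` is its rotation number `T'/T`, where `T'` is the time in which the
      -- Hamiltonian flow realizes one step of the map
      (∀ (E : ℝ) (q p : ℝ → ℝ) (T : ℝ), IsSextClosedCurve a E q p T →
        canonicalAction q p T = J E ∧
        canonicalAction (rotQ q p) (rotP q p) T = J E ∧
        ∃ T', 0 < T' ∧ T' < T ∧
          (∀ t, sextMap a (q t, p t) = (q (t + T'), p (t + T'))) ∧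
          ν (J E) = T' / T) ∧
      -- closed form in terms of the roots of the quartic polynomial `𝒫`
      (∀ E, 0 < E → E < sextSep a →
        ∃ q₁ q₂ q₃ q₄ : ℝ, q₁ < q₂ ∧ q₂ < q₃ ∧ q₃ < q₄ ∧
          (∀ x, sextP a E x = (x - q₁) * (x - q₂) * (x - q₃) * (x - q₄)) ∧
          J E = 1 / (2 * Real.pi) * ∫ x in q₂..q₃, Real.sqrt (sextP a E x) / (x + 1) ∧
          J E = sextActionRoots a q₁ q₂ q₃ q₄) ∧
      -- closed form in terms of the roots of the cubic polynomial `𝒢` in rotated coordinates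
      (∀ E, 0 < E → E < sextSep a →
        sextQ₁ a E < sextQ₂ a E ∧ sextQ₂ a E < sextQ₃ a E ∧ sextQ₃ a E < sextQ₄ a ∧
        (∀ Q, sextG a E Q = -((Q - sextQ₁ a E) * (Q - sextQ₂ a E) * (Q - sextQ₃ a E))) ∧
        J E = 1 / Real.pi *
          (∫ Q in (sextQ₂ a E)..(sextQ₃ a E), Real.sqrt (sextG a E Q / (sextQ₄ a - Q))) ∧
        J E = sextActionRotated a E) ∧
      -- power series of the action in the elliptic modulus and in the invariant
      Tendsto (sextModulus a) (𝓝[>] 0) (𝓝[>] 0) ∧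
      ((fun E => J E - sextActionSeriesModulus a (sextModulus a E))
        =O[𝓝[>] 0] fun E => sextModulus a E ^ 12) ∧
      ((fun E => J E - sextActionSeriesInv a E) =O[𝓝[>] 0] fun E => E ^ 4) ∧
      -- power series of the rotation number in the action, and the detuning
      ν 0 = sextNu₀ a ∧
      ((fun j => ν j - sextNuSeries a j) =O[𝓝[>] 0] fun j => j ^ 3) ∧
      HasDerivWithinAt ν
        (-(1 / (2 * Real.pi)) * ((1 + a) * (8 + a) / ((2 + a) * (2 - a) ^ 2)))
        (Set.Ici 0) 0 := by
  refine ⟨fun E => exists_closedCurve_iff ha₁ ha₂, levelAction a, actionRotation a,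
    fun E q p T h => ?_, fun E => exists_quartic_action ha₁ ha₂, fun E hE hE' => ?_,
    tendsto_sextModulus ha₁ ha₂, levelAction_sub_seriesModulus ha₁ ha₂,
    levelAction_sub_seriesInv ha₁ ha₂, actionRotation_zero ha₁ ha₂,
    actionRotation_sub_series ha₁ ha₂, hasDerivWithinAt_actionRotation ha₁ ha₂⟩
  · obtain ⟨h1, h2⟩ := closedCurve_level_spec ha₁ ha₂ h
    exact ⟨h1, h.canonicalAction_rot.trans h1, h2⟩
  · have h := sextRoots ha₁ ha₂ hE hE'
    obtain ⟨h1, h2, h3, -⟩ := sextG_roots h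
    exact ⟨h1, h2, h3, sextG_eq h, rotated_action ha₁ ha₂ hE hE'⟩
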